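/- For a Lebesgue measurable set $S\subseteq\mathbb{R}^2$ of finite positive measure, let $\operatorname{c}(S)=\sup\{\lambda_2(K): K\subseteq S \text{ convex}\}/\lambda_2(S)$ be its convexity ratio. Let $\operatorname{seg}(S)$ be the set of pairs $(A,B)\in S\times S$ such that the closed line segment $\overline{AB}$ is contained in $S$; if $\operatorname{seg}(S)$ is Lebesgue measurable, then the Beer index of convexity $\operatorname{b}(S)=\lambda_4(\operatorname{seg}(S))/\lambda_2(S)^2$ is said to be defined. Here $\lambda_k$ denotes $k$-dimensional Lebesgue measure. A simple polygon is a closed polygonal curve with at least three vertices that does not meet itself, together with the bounded region that it encloses. For every simple polygon $P\subseteq\mathbb{R}^2$, the Beer index $\operatorname{b}(P)$ is defined, and $$\operatorname{b}(P)\leq 180\,\operatorname{c}(P).$$ -/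

import Mathlib

open MeasureTheory

/-- The segment set of `S`: the pairs of points of `S` that see each other in `S`. -/
def segSet {d : ℕ} (S : Set (EuclideanSpace ℝ (Fin d))) :
    Set (EuclideanSpace ℝ (Fin d) × EuclideanSpace ℝ (Fin d)) :=
  {p | p.1 ∈ S ∧ p.2 ∈ S ∧ segment ℝ p.1 p.2 ⊆ S}

/-- The supremum of the Lebesgue measures of the convex subsets of `S`. -/
noncomputable def supConvexMeasure {d : ℕ} (S : Set (EuclideanSpace ℝ (Fin d))) : ENNReal :=
  sSup {m | ∃ K : Set (EuclideanSpace ℝ (Fin d)), K ⊆ S ∧ Convex ℝ K ∧ m = volume K}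

/-- The Beer index of `S` is defined: `S` is Lebesgue measurable, has finite positive measure,
and its segment set is Lebesgue measurable. -/
def BeerIndexDefined {d : ℕ} (S : Set (EuclideanSpace ℝ (Fin d))) : Prop :=
  NullMeasurableSet S volume ∧ 0 < volume S ∧ volume S < ⊤ ∧ NullMeasurableSet (segSet S) volume

/-- The convexity ratio of `S` (meaningful when `S` has finite positive measure). -/
noncomputable def convexityRatio {d : ℕ} (S : Set (EuclideanSpace ℝ (Fin d))) : ENNReal :=
  supConvexMeasure S / volume S

/-- The Beer index of convexity of `S` (meaningful under `BeerIndexDefined S`). -/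
noncomputable def beerIndex {d : ℕ} (S : Set (EuclideanSpace ℝ (Fin d))) : ENNReal :=
  volume (segSet S) / volume S ^ 2

/-- A polygon in the plane is simple if its closed boundary curve does not meet itself: the
parametrization of the curve, edge by edge, each edge taken without its final endpoint, is
injective. -/
def Polygon.IsSimple {n : ℕ} (P : Polygon (EuclideanSpace ℝ (Fin 2)) n) : Prop :=
  3 ≤ n ∧ Function.Injective
    (fun q : Fin n × Set.Ico (0 : ℝ) 1 => P.edgePath ℝ q.1 (q.2 : ℝ))

/-- The closed planar region bounded by a polygon: its boundary curve, together with the points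
off the curve that lie in a bounded connected component of the complement of the curve. -/
def Polygon.region {n : ℕ} (P : Polygon (EuclideanSpace ℝ (Fin 2)) n) :
    Set (EuclideanSpace ℝ (Fin 2)) :=
  P.boundary ℝ ∪ {x | x ∉ P.boundary ℝ ∧
    Bornology.IsBounded (connectedComponentIn (P.boundary ℝ)ᶜ x)}

open Complex Set Topology Filter MeasureTheory

/-! Work in `ℂ` with the filled boundary curve `F`. For all visible pairs outside a null set the
segment stays in the interior of `F` (`SimpleEdges.volume_sees_le`), so it suffices to treat each
component `U` of the interior. If convex subsets of `U` have area at most `κ`, then the visible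
pairs of `U` have measure at most `96 κ |U|` (`Domain.volume_sees_le`), and `96 ≤ 180`.

Simple connectedness is used only as `LogConnected`. A closed path in `U` has winding number zero
about every outside point, and winding numbers of polygonal paths are sums of principal arguments.
Hence triangles with visible sides are filled (`Sees.triangle`). Moreover, from a point `A` that
sees no point of a connected set `X`, all of `X` is hidden behind a single ray (`exists_frame`).

Let `W` be the set of points that see `X`. The hiding ray has three consequences. `W` is relatively
convex: it meets each segment of `U` in an interval. The part of the view from `A` that precedes
`W`, the shadow of `A`, is convex and so has area at most `κ`. Along a segment entering `W`, the set
`W` is bounded by a line, the window, and two points whose joining segment sees but misses `W` have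
the same window (`VisSetting.common_window`).

Fix `O` in `U` and let level `k` consist of the points reached from `O` by at most `k` segments. A
visible segment meets its first level in an interval of parameters. Either this interval omits an
end quarter of the segment, or it contains both quarter points. In the first case, after a swap if
needed, the quarter point lies in the shadow of the first endpoint, which leaves area `16 κ` for the
other endpoint. In the second case the two quarter points lie on one level, their segment misses the
previous one, and they share a window. The quadrilateral of the two points and their window points
then confines the point nearer to the window to area `8 κ` (`abs_cross_quad_le`,
`volume_lower_region_le`). On the first level `O` takes the role of the window. -/

/-! ### Visibility and branches of the logarithm. -/

/-- `Sees U a b`: the segment from `a` to `b` stays inside `U`. -/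
def Sees (U : Set ℂ) (a b : ℂ) : Prop := segment ℝ a b ⊆ U

/-- There is a continuous branch of `log (x - z)` on `Y`. -/
def HasLog (z : ℂ) (Y : Set ℂ) : Prop :=
  ∃ f : ℂ → ℂ, ContinuousOn f Y ∧ ∀ x ∈ Y, exp (f x) = x - z

/-- A form of simple connectedness: branches of the logarithm about outside points exist on
compact subsets. -/
def LogConnected (U : Set ℂ) : Prop :=
  ∀ z ∉ U, ∀ Y ⊆ U, IsCompact Y → HasLog z Y

theorem Sees.symm {U : Set ℂ} {a b : ℂ} (h : Sees U a b) : Sees U b a := by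
  unfold Sees; rw [segment_symm]; exact h

theorem Sees.left_mem {U : Set ℂ} {a b : ℂ} (h : Sees U a b) : a ∈ U := h (left_mem_segment ℝ a b)

theorem Sees.right_mem {U : Set ℂ} {a b : ℂ} (h : Sees U a b) : b ∈ U :=
  h (right_mem_segment ℝ a b)

theorem Sees.refl {U : Set ℂ} {a : ℂ} (h : a ∈ U) : Sees U a a := by
  simpa [Sees] using h

theorem Sees.mono_seg {U : Set ℂ} {a b c d : ℂ} (h : Sees U a b) (hc : c ∈ segment ℝ a b)
    (hd : d ∈ segment ℝ a b) : Sees U c d :=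
  ((convex_segment a b).segment_subset hc hd).trans h

theorem isPreconnected_segment (a b : ℂ) : IsPreconnected (segment ℝ a b) :=
  (convex_segment a b).isPreconnected

theorem isCompact_segment (a b : ℂ) : IsCompact (segment ℝ a b) := by
  rw [segment_eq_image]
  exact isCompact_Icc.image (by fun_prop)

/-- If the ratio were `-s` with `s ≥ 0`, then `z = (s a + x) / (1 + s)` would lie on the segment. -/
theorem div_mem_slitPlane {a x z : ℂ} (h : z ∉ segment ℝ a x) : (x - z) / (a - z) ∈ slitPlane := by
  by_contra hn
  have ha : a - z ≠ 0 := by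
    intro h0
    exact h (by rw [← sub_eq_zero.mp h0]; exact left_mem_segment ℝ a x)
  rw [mem_slitPlane_iff, not_or, not_lt, not_not] at hn
  obtain ⟨h1, h2⟩ := hn
  set r := (x - z) / (a - z) with hr
  have hre : r = ((r.re : ℝ) : ℂ) := by
    apply Complex.ext <;> simp [h2]
  have hx : x - z = r.re * (a - z) := by
    rw [← hre, hr]; field_simp
  set s := -r.re with hs
  have hs0 : 0 ≤ s := by linarith
  apply h
  refine ⟨s / (1 + s), 1 / (1 + s), by positivity, by positivity, by field_simp; ring, ?_⟩
  have h3 : x = z - s * (a - z) := by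
    rw [hs]; push_cast; linear_combination hx
  rw [h3]
  have : (1 + s : ℂ) ≠ 0 := by
    exact_mod_cast (by positivity : (1 + s : ℝ) ≠ 0)
  simp only [real_smul]
  push_cast
  field_simp
  ring

/-- The difference divided by `2πi` is continuous and integer valued on a preconnected set. -/
theorem log_sub_log_const {S : Set ℂ} (hS : IsPreconnected S) {f g : ℂ → ℂ}
    (hf : ContinuousOn f S) (hg : ContinuousOn g S) (h : ∀ x ∈ S, exp (f x) = exp (g x))
    {x y : ℂ} (hx : x ∈ S) (hy : y ∈ S) : f x - g x = f y - g y := by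
  have h2 : ∀ x ∈ S, ∃ n : ℤ, f x - g x = n * (2 * Real.pi * I) := by
    intro x hx
    obtain ⟨n, hn⟩ := exp_eq_exp_iff_exists_int.mp (h x hx)
    exact ⟨n, by rw [hn]; ring⟩
  have hpi : (2 * Real.pi * I : ℂ) ≠ 0 := by
    simp [Real.pi_ne_zero]
  let k : ℂ → ℝ := fun x => ((f x - g x) / (2 * Real.pi * I)).re
  have hk : ContinuousOn k S :=
    continuous_re.comp_continuousOn ((hf.sub hg).div_const _)
  have hkZ : MapsTo k S (range ((↑) : ℤ → ℝ)) := by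
    intro x hx
    obtain ⟨n, hn⟩ := h2 x hx
    refine ⟨n, ?_⟩
    simp only [k, hn]
    rw [mul_div_assoc, div_self hpi]
    simp
  have hd : IsDiscrete (range ((↑) : ℤ → ℝ)) :=
    by
    rw [← image_univ]
    exact IsDiscrete.univ.image Int.isClosedEmbedding_coe_real.isEmbedding.isInducing
  have h3 := hS.constant_of_mapsTo hd hk hkZ hx hy
  obtain ⟨n, hn⟩ := h2 x hx
  obtain ⟨m, hm⟩ := h2 y hy
  simp only [k, hn, hm] at h3
  rw [mul_div_cancel_right₀ _ hpi, mul_div_cancel_right₀ _ hpi] at h3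
  simp at h3
  rw [hn, hm, h3]

/-- Along the segment the ratio `(x - z) / (a - z)` stays in the slit plane, so its principal
logarithm is itself a branch up to a constant. Turning along polygonal paths thus becomes a sum of
principal arguments. -/
theorem log_edge {Y : Set ℂ} {f : ℂ → ℂ} {z a b : ℂ} (hf : ContinuousOn f Y)
    (h : ∀ x ∈ Y, exp (f x) = x - z) (hab : segment ℝ a b ⊆ Y) :
    f b - f a = log ((b - z) / (a - z)) := by
  have hz : ∀ x ∈ Y, x ≠ z := fun x hx hxz => exp_ne_zero _ (by rw [h x hx, hxz, sub_self])
  have haY := hab (left_mem_segment ℝ a b)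
  have haz : a - z ≠ 0 := sub_ne_zero.mpr (hz a haY)
  have key := log_sub_log_const (isPreconnected_segment a b) (hf.mono hab)
    (g := fun x => log ((x - z) / (a - z)) + f a) ?_ ?_ (right_mem_segment ℝ a b)
    (left_mem_segment ℝ a b)
  · simp only [div_self haz, log_one] at key
    linear_combination key
  · refine ContinuousOn.add (ContinuousOn.clog (by fun_prop) ?_) continuousOn_const
    intro x hx
    apply div_mem_slitPlane
    intro hzx
    exact hz z (hab ((convex_segment a b).segment_subset (left_mem_segment ℝ a b) hx hzx)) rfl
  · intro x hx
    have hxz : x - z ≠ 0 := sub_ne_zero.mpr (hz x (hab hx))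
    rw [exp_add, exp_log (div_ne_zero hxz haz), h x (hab hx), h a haY]
    field_simp

theorem arg_pos_of_im_pos {w : ℂ} (h : 0 < w.im) : 0 < arg w := by
  rcases (arg_nonneg_iff.mpr h.le).lt_or_eq with h1 | h1
  · exact h1
  · exact absurd (arg_eq_zero_iff.mp h1.symm).2 h.ne'

theorem arg_neg_of_im_neg {w : ℂ} (h : w.im < 0) : arg w < 0 := arg_neg_iff.mpr h

theorem inv_im_pos_iff {w : ℂ} : 0 < (w⁻¹).im ↔ w.im < 0 := by
  rw [inv_im]
  constructor
  · intro h
    by_contra hn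
    have := div_nonneg (not_lt.mp hn) (normSq_nonneg w)
    rw [neg_div] at h
    linarith
  · intro h
    have : w ≠ 0 := fun h0 => by simp [h0] at h
    exact div_pos (by linarith) (normSq_pos.mpr this)

/-- A point `z` of the triangle outside `U` would lie off the sides. The arguments along the three
sides sum to zero because the branch returns to its start, but the sides all turn about `z` in the
same sense. -/
theorem Sees.triangle {U : Set ℂ} (hU : LogConnected U) {a b c : ℂ} (hab : Sees U a b)
    (hbc : Sees U b c) (hca : Sees U c a) {α β γ : ℝ} (hα : 0 ≤ α) (hβ : 0 ≤ β) (hγ : 0 ≤ γ)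
    (h1 : α + β + γ = 1) : α • a + β • b + γ • c ∈ U := by
  by_contra hz
  set z := α • a + β • b + γ • c with hzdef
  have hαp : 0 < α := by
    refine lt_of_le_of_ne hα fun h0 => hz (hbc ⟨β, γ, hβ, hγ, by linarith, ?_⟩)
    rw [hzdef, ← h0]; simp
  have hβp : 0 < β := by
    refine lt_of_le_of_ne hβ fun h0 => hz (hca ⟨γ, α, hγ, hα, by linarith, ?_⟩)
    rw [hzdef, ← h0]; simp [add_comm]
  have hγp : 0 < γ := by
    refine lt_of_le_of_ne hγ fun h0 => hz (hab ⟨α, β, hα, hβ, by linarith, ?_⟩)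
    rw [hzdef, ← h0]; simp
  obtain ⟨f, hf, hexp⟩ := hU z hz (segment ℝ a b ∪ segment ℝ b c ∪ segment ℝ c a)
    (union_subset (union_subset hab hbc) hca)
    (((isCompact_segment a b).union (isCompact_segment b c)).union (isCompact_segment c a))
  have e1 := log_edge hf hexp (a := a) (b := b) (fun x hx => Or.inl (Or.inl hx))
  have e2 := log_edge hf hexp (a := b) (b := c) (fun x hx => Or.inl (Or.inr hx))
  have e3 := log_edge hf hexp (a := c) (b := a) (fun x hx => Or.inr hx)
  have hsum : log ((b - z) / (a - z)) + log ((c - z) / (b - z)) + log ((a - z) / (c - z)) = 0 := by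
    rw [← e1, ← e2, ← e3]; ring
  have hsum' : arg ((b - z) / (a - z)) + arg ((c - z) / (b - z)) + arg ((a - z) / (c - z)) = 0 := by
    simpa [log_im] using congrArg Complex.im hsum
  have hU' : ∀ x ∈ U, x - z ≠ 0 := fun x hx h0 => hz (sub_eq_zero.mp h0 ▸ hx)
  have ha := hU' a hab.left_mem
  have hb := hU' b hbc.left_mem
  have hc := hU' c hca.left_mem
  have s3 : (a - z) / (c - z) ∈ slitPlane := div_mem_slitPlane (fun h => hz (hca h))
  have s1 : (b - z) / (a - z) ∈ slitPlane := div_mem_slitPlane (fun h => hz (hab h))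
  have hrel : (α : ℂ) * (a - z) + β * (b - z) + γ * (c - z) = 0 := by
    have h1' : (α + β + γ : ℂ) = 1 := by exact_mod_cast h1
    have : z = α * a + β * b + γ * c := by rw [hzdef]; simp only [real_smul]
    linear_combination -this - z * h1'
  set r := (b - z) / (a - z) with hr
  set s := (c - z) / (a - z) with hs
  have hr0 : r ≠ 0 := div_ne_zero hb ha
  have hs0 : s ≠ 0 := div_ne_zero hc ha
  have e21 : (c - z) / (b - z) = s / r := by rw [hr, hs]; field_simp
  have e31 : (a - z) / (c - z) = s⁻¹ := by rw [hs]; field_simp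
  rw [e21, e31] at hsum'
  rw [e31] at s3
  have hrel2 : (α : ℂ) + β * r + γ * s = 0 := by
    rw [hr, hs]; field_simp; linear_combination hrel
  have him : β * r.im + γ * s.im = 0 := by
    simpa using congrArg Complex.im hrel2
  have hre : α + β * r.re + γ * s.re = 0 := by
    simpa using congrArg Complex.re hrel2
  have hrel3 : (α : ℂ) * r⁻¹ + β + γ * (s / r) = 0 := by
    field_simp; linear_combination hrel2
  have him3 : α * (r⁻¹).im + γ * (s / r).im = 0 := by
    simpa using congrArg Complex.im hrel3
  rcases lt_trichotomy r.im 0 with hlt | heq | hgt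
  · have hs1 : 0 < s.im := by
      by_contra hn
      nlinarith [mul_neg_of_pos_of_neg hβp hlt, mul_nonneg hγp.le (by linarith : 0 ≤ -s.im)]
    have hq : (s / r).im < 0 := by
      have := mul_pos hαp (inv_im_pos_iff.mpr hlt)
      by_contra hn
      nlinarith [mul_nonneg hγp.le (not_lt.mp hn)]
    have hsi : (s⁻¹).im < 0 := by
      rw [inv_im, neg_div]
      exact neg_lt_zero.mpr (div_pos hs1 (normSq_pos.mpr hs0))
    linarith [arg_neg_of_im_neg hlt, arg_neg_of_im_neg hq, arg_neg_of_im_neg hsi]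
  -- Collinear case: `z` is on no side, so both `r` and `s` are positive reals, against `hre`.
  · have hs1 : s.im = 0 := by
      rw [heq] at him
      simpa [hγp.ne'] using him
    have hrp : 0 < r.re := by
      rcases s1 with h | h
      · exact h
      · exact absurd heq h
    have hsp : 0 < s.re := by
      rcases s3 with h | h
      · rw [inv_re] at h
        exact (div_pos_iff_of_pos_right (normSq_pos.mpr hs0)).mp h
      · exact absurd (by rw [inv_im, hs1]; simp) h
    nlinarith [mul_pos hβp hrp, mul_pos hγp hsp]
  · have hs1 : s.im < 0 := by
      by_contra hn
      nlinarith [mul_pos hβp hgt, mul_nonneg hγp.le (not_lt.mp hn)]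
    have hri : (r⁻¹).im < 0 := by
      rw [inv_im, neg_div]
      exact neg_lt_zero.mpr (div_pos hgt (normSq_pos.mpr hr0))
    have hq : 0 < (s / r).im := by
      have := mul_neg_of_pos_of_neg hαp hri
      by_contra hn
      nlinarith [mul_nonneg hγp.le (by linarith : 0 ≤ -(s / r).im)]
    linarith [arg_pos_of_im_pos hgt, arg_pos_of_im_pos hq,
      arg_pos_of_im_pos (inv_im_pos_iff.mpr hs1)]

theorem Sees.convexHull_subset {U : Set ℂ} (hU : LogConnected U) {a b c : ℂ} (hab : Sees U a b)
    (hbc : Sees U b c) (hca : Sees U c a) : convexHull ℝ {a, b, c} ⊆ U := by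
  intro x hx
  rw [convexHull_insert (by simp), convexHull_pair, mem_convexJoin] at hx
  obtain ⟨a', ha', y, hy, hxy⟩ := hx
  rw [mem_singleton_iff] at ha'
  subst ha'
  obtain ⟨p, q, hp, hq, hpq, rfl⟩ := hy
  obtain ⟨s, t, hs, ht, hst, rfl⟩ := hxy
  have := Sees.triangle hU hab hbc hca (α := s) (β := t * p) (γ := t * q) hs (by positivity)
    (by positivity) (by rw [add_assoc, ← mul_add, hpq, mul_one, hst])
  rwa [smul_add, ← mul_smul, ← mul_smul, ← add_assoc]

/-- The hypothesis `h` puts `q` and `s` strictly on opposite sides of the line `p r`. All four sides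
then turn in one sense about a missing point of the diagonal, so their arguments cannot sum to zero.
-/
theorem Sees.diagonal {U : Set ℂ} (hU : LogConnected U) {p q r s : ℂ} (hpq : Sees U p q)
    (hqr : Sees U q r) (hrs : Sees U r s) (hsp : Sees U s p)
    (h : ((q - p) * (starRingEnd ℂ) (r - p)).im * ((s - p) * (starRingEnd ℂ) (r - p)).im < 0) :
    Sees U p r := by
  have main : ∀ q s : ℂ, Sees U p q → Sees U q r → Sees U r s → Sees U s p →
      0 < ((q - p) * (starRingEnd ℂ) (r - p)).im → ((s - p) * (starRingEnd ℂ) (r - p)).im < 0 →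
      Sees U p r := by
    clear! q s
    intro q s hpq hqr hrs hsp hqi hsi z hzs
    by_contra hz
    obtain ⟨f, hf, hexp⟩ := hU z hz
      (segment ℝ p q ∪ segment ℝ q r ∪ (segment ℝ r s ∪ segment ℝ s p))
      (union_subset (union_subset hpq hqr) (union_subset hrs hsp))
      (((isCompact_segment _ _).union (isCompact_segment _ _)).union
        ((isCompact_segment _ _).union (isCompact_segment _ _)))
    have e1 := log_edge hf hexp (a := p) (b := q) (fun x hx => Or.inl (Or.inl hx))
    have e2 := log_edge hf hexp (a := q) (b := r) (fun x hx => Or.inl (Or.inr hx))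
    have e3 := log_edge hf hexp (a := r) (b := s) (fun x hx => Or.inr (Or.inl hx))
    have e4 := log_edge hf hexp (a := s) (b := p) (fun x hx => Or.inr (Or.inr hx))
    have hsum : log ((q - z) / (p - z)) + log ((r - z) / (q - z)) + log ((s - z) / (r - z))
        + log ((p - z) / (s - z)) = 0 := by
      rw [← e1, ← e2, ← e3, ← e4]; ring
    have hsum' : arg ((q - z) / (p - z)) + arg ((r - z) / (q - z)) + arg ((s - z) / (r - z))
        + arg ((p - z) / (s - z)) = 0 := by
      simpa [log_im] using congrArg Complex.im hsum
    obtain ⟨α, β, hα, hβ, hαβ, hzd⟩ := hzs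
    have hαβ' : (α + β : ℂ) = 1 := by exact_mod_cast hαβ
    simp only [real_smul] at hzd
    have hU' : ∀ x ∈ U, x - z ≠ 0 := fun x hx h0 => hz (sub_eq_zero.mp h0 ▸ hx)
    have hp := hU' p hpq.left_mem
    have hr := hU' r hrs.left_mem
    have hpz : p - z = -(β * (r - p)) := by linear_combination p * (-hαβ') + hzd
    have hrz : r - z = α * (r - p) := by linear_combination r * (-hαβ') + hzd
    have hβp : 0 < β := lt_of_le_of_ne hβ fun h0 => hp (by rw [hpz, ← h0]; simp)
    have hαp : 0 < α := lt_of_le_of_ne hα fun h0 => hr (by rw [hrz, ← h0]; simp)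
    have hd : r - p ≠ 0 := fun h0 => hr (by rw [hrz, h0, mul_zero])
    set d := r - p with hdd
    have hN : 0 < normSq d := normSq_pos.mpr hd
    have hqz : ((q - z) / d).im = ((q - p) * (starRingEnd ℂ) d).im / normSq d := by
      have : (q - z) / d = (q - p) / d - β := by
        rw [eq_sub_iff_add_eq, div_add' _ _ _ hd]; congr 1; linear_combination hpz
      rw [this, sub_im, ofReal_im, sub_zero, div_im, mul_im]
      simp; ring
    have hsz : ((s - z) / d).im = ((s - p) * (starRingEnd ℂ) d).im / normSq d := by
      have : (s - z) / d = (s - p) / d - β := by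
        rw [eq_sub_iff_add_eq, div_add' _ _ _ hd]; congr 1; linear_combination hpz
      rw [this, sub_im, ofReal_im, sub_zero, div_im, mul_im]
      simp; ring
    have hqp : 0 < ((q - z) / d).im := hqz ▸ div_pos hqi hN
    have hsn : ((s - z) / d).im < 0 := hsz ▸ div_neg_of_neg_of_pos hsi hN
    set x := (q - z) / d with hx
    set y := (s - z) / d with hy
    have a1 : (q - z) / (p - z) = ((-(1 / β) : ℝ) : ℂ) * x := by
      rw [hpz, hx]; push_cast; field_simp
    have a2 : (r - z) / (q - z) = (α : ℂ) * x⁻¹ := by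
      rw [hrz, hx]; field_simp
    have a3 : (s - z) / (r - z) = ((1 / α : ℝ) : ℂ) * y := by
      rw [hrz, hy]; push_cast; field_simp
    have a4 : (p - z) / (s - z) = ((-β : ℝ) : ℂ) * y⁻¹ := by
      rw [hpz, hy]; push_cast; field_simp
    have hyi : 0 < (y⁻¹).im := inv_im_pos_iff.mpr hsn
    have hxi : (x⁻¹).im < 0 := by
      rw [inv_im, neg_div]
      exact neg_lt_zero.mpr (div_pos hqp (normSq_pos.mpr (fun h0 => by simp [h0] at hqp)))
    have i1 : ((q - z) / (p - z)).im < 0 := by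
      rw [a1, im_ofReal_mul]; exact mul_neg_of_neg_of_pos (neg_lt_zero.mpr (by positivity)) hqp
    have i2 : ((r - z) / (q - z)).im < 0 := by
      rw [a2, im_ofReal_mul]; exact mul_neg_of_pos_of_neg hαp hxi
    have i3 : ((s - z) / (r - z)).im < 0 := by
      rw [a3, im_ofReal_mul]; exact mul_neg_of_pos_of_neg (by positivity) hsn
    have i4 : ((p - z) / (s - z)).im < 0 := by
      rw [a4, im_ofReal_mul]; exact mul_neg_of_neg_of_pos (neg_lt_zero.mpr hβp) hyi
    linarith [arg_neg_of_im_neg i1, arg_neg_of_im_neg i2, arg_neg_of_im_neg i3,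
      arg_neg_of_im_neg i4]
  rcases mul_neg_iff.mp h with ⟨h1, h2⟩ | ⟨h1, h2⟩
  · exact main q s hpq hqr hrs hsp h1 h2
  · exact main s q hsp.symm hrs.symm hqr.symm hpq.symm h2 h1

/-! ### Exits from the region seen from a point. -/

theorem isOpen_sees {U : Set ℂ} (hU : IsOpen U) : IsOpen {p : ℂ × ℂ | Sees U p.1 p.2} := by
  rw [isOpen_iff_eventually]
  rintro ⟨a, b⟩ hab
  have := isCompact_Icc (a := (0 : ℝ)) (b := 1).eventually_forall_of_forall_eventually
    (x₀ := (a, b)) (P := fun (p : ℂ × ℂ) (t : ℝ) => p.1 + t • (p.2 - p.1) ∈ U) ?_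
  · filter_upwards [this] with p hp
    change segment ℝ p.1 p.2 ⊆ U
    rw [segment_eq_image']
    rintro _ ⟨t, ht, rfl⟩
    exact hp t ht
  · intro t ht
    have hc : Continuous fun z : (ℂ × ℂ) × ℝ => z.1.1 + z.2 • (z.1.2 - z.1.1) := by fun_prop
    refine hc.continuousAt.eventually_mem (hU.mem_nhds (hab ?_))
    rw [segment_eq_image']
    exact ⟨t, ht, rfl⟩

theorem exists_first_exit {U : Set ℂ} (hU : IsOpen U) (hb : Bornology.IsBounded U) {A ζ : ℂ}
    (hA : A ∈ U) (hζ : ζ ≠ 0) :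
    ∃ r : ℝ, 0 < r ∧ A + r * ζ ∉ U ∧ ∀ s : ℝ, 0 ≤ s → s < r → Sees U A (A + s * ζ) := by
  let T : Set ℝ := Ici 0 ∩ (fun s : ℝ => A + s * ζ) ⁻¹' Uᶜ
  have hT : IsClosed T := isClosed_Ici.inter (hU.isClosed_compl.preimage (by fun_prop))
  have hne : T.Nonempty := by
    obtain ⟨R, hR⟩ := hb.subset_closedBall A
    have hζ' : 0 < ‖ζ‖ := norm_pos_iff.mpr hζ
    have hR0 : 0 ≤ R := by simpa using Metric.mem_closedBall.mp (hR hA)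
    refine ⟨(R + 1) / ‖ζ‖, by simp only [mem_Ici]; positivity, fun h => ?_⟩
    have := Metric.mem_closedBall.mp (hR h)
    rw [dist_eq_norm, add_sub_cancel_left, norm_mul, norm_real, Real.norm_of_nonneg (by positivity),
      div_mul_cancel₀ _ hζ'.ne'] at this
    linarith
  have hbd : BddBelow T := ⟨0, fun s hs => hs.1⟩
  have hmem := hT.csInf_mem hne hbd
  have hlt : ∀ s : ℝ, 0 ≤ s → s < sInf T → A + s * ζ ∈ U := by
    intro s hs hsT
    by_contra h
    exact absurd (csInf_le hbd ⟨hs, h⟩) (not_le.mpr hsT)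
  refine ⟨sInf T, lt_of_le_of_ne hmem.1 fun h0 => hmem.2 (by rw [← h0]; simpa using hA), hmem.2, ?_⟩
  intro s hs hsT p hp
  rw [segment_eq_image'] at hp
  obtain ⟨t, ht, rfl⟩ := hp
  have := hlt (t * s) (mul_nonneg ht.1 hs) (lt_of_le_of_lt (mul_le_of_le_one_left hs ht.2) hsT)
  convert this using 2
  simp only [real_smul]; push_cast; ring

theorem Sees.to_segment {U : Set ℂ} (hL : LogConnected U) {A M N p : ℂ} (h1 : Sees U A M)
    (h2 : Sees U A N) (h3 : Sees U M N) (hp : p ∈ segment ℝ M N) : Sees U A p := by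
  refine subset_trans ?_ (Sees.convexHull_subset hL h1 h3 h2.symm)
  refine (convex_convexHull ℝ _).segment_subset (subset_convexHull ℝ _ (by simp)) ?_
  exact (convex_convexHull ℝ _).segment_subset (subset_convexHull ℝ _ (by simp))
    (subset_convexHull ℝ _ (by simp)) hp

/-- The seen points form an initial piece of the segment: if `p` is seen, then the triangle `A M p`
is filled and everything between `M` and `p` is seen. Since visibility is an open condition, `w`
itself is not seen. -/
theorem exists_exit {U : Set ℂ} (hU : IsOpen U) (hL : LogConnected U) {A M m : ℂ}
    (hAM : Sees U A M) (hMm : Sees U M m) (hAm : ¬ Sees U A m) :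
    ∃ w ∈ segment ℝ M m, (∀ p ∈ segment ℝ M w, p ≠ w → Sees U A p) ∧
      ∀ p ∈ segment ℝ w m, ¬ Sees U A p := by
  let P : ℝ → ℂ := fun s => M + s • (m - M)
  have hPc : Continuous P := by fun_prop
  let T : Set ℝ := Icc 0 1 ∩ P ⁻¹' {p | Sees U A p}ᶜ
  have hO : IsOpen {p | Sees U A p} :=
    (isOpen_sees hU).preimage (by fun_prop : Continuous fun p : ℂ => (A, p))
  have hT : IsClosed T := isClosed_Icc.inter (hO.isClosed_compl.preimage hPc)
  have hne : T.Nonempty := ⟨1, by simp, by simpa [P] using hAm⟩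
  have hbd : BddBelow T := ⟨0, fun s hs => hs.1.1⟩
  have hmem := hT.csInf_mem hne hbd
  set s := sInf T with hs
  have hPs : P s ∈ segment ℝ M m := by
    rw [segment_eq_image']; exact ⟨s, hmem.1, rfl⟩
  have hnot : ¬ Sees U A (P s) := hmem.2
  refine ⟨P s, hPs, ?_, ?_⟩
  · intro p hp hpne
    rw [segment_eq_image'] at hp
    obtain ⟨t, ht, rfl⟩ := hp
    by_contra hn
    have h1 : (fun θ : ℝ => M + θ • (P s - M)) t = P (t * s) := by
      simp only [P, add_sub_cancel_left, mul_smul]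
    rw [h1] at hn hpne
    have hts : t * s ≤ s := mul_le_of_le_one_left hmem.1.1 ht.2
    have h2 : t * s ∈ T := ⟨⟨mul_nonneg ht.1 hmem.1.1, hts.trans hmem.1.2⟩, hn⟩
    have h3 := csInf_le hbd h2
    rw [← hs] at h3
    exact hpne (by rw [le_antisymm hts h3])
  · intro p hp hAp
    apply hnot
    have hpm : p ∈ segment ℝ M m := (convex_segment M m).segment_subset hPs
      (right_mem_segment ℝ M m) hp
    refine Sees.to_segment hL hAM hAp (hMm.mono_seg (left_mem_segment ℝ M m) hpm) ?_
    rw [segment_eq_image'] at hp ⊢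
    obtain ⟨t, ht, rfl⟩ := hp
    by_cases h0 : s + t * (1 - s) = 0
    · have : s = 0 := by nlinarith [mul_nonneg ht.1 (sub_nonneg.mpr hmem.1.2), hmem.1.1]
      exact ⟨0, by simp, by simp [P, this]⟩
    · have hpos : 0 < s + t * (1 - s) :=
        lt_of_le_of_ne (add_nonneg hmem.1.1 (mul_nonneg ht.1 (sub_nonneg.mpr hmem.1.2))) (Ne.symm h0)
      refine ⟨s / (s + t * (1 - s)), ⟨div_nonneg hmem.1.1 hpos.le, ?_⟩, ?_⟩
      · rw [div_le_one hpos]; nlinarith [mul_nonneg ht.1 (sub_nonneg.mpr hmem.1.2)]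
      · have hc : ((s : ℂ) + t * (1 - s)) ≠ 0 := by exact_mod_cast h0
        simp only [P, real_smul]
        push_cast
        field_simp
        ring

/-- The arguments of `-τ` and `1 - τ⁻¹` have opposite signs or vanish, so the logarithm of their
product splits with no multiple of `2πi`. With `τ = (x - A) / (z - A)` this compares branches about
`A` and about `z`. -/
theorem log_radial {τ : ℂ} (h : -τ ∈ slitPlane) :
    log (1 - τ) - log (1 - τ⁻¹) = log (-τ) := by
  have h0 : τ ≠ 0 := fun h0 => by simp [h0] at h
  have hprod : 1 - τ = -τ * (1 - τ⁻¹) := by field_simp; ring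
  have h1 : 1 - τ⁻¹ ≠ 0 := by
    intro h1
    have : τ = 1 := by
      rw [sub_eq_zero] at h1; exact inv_eq_one.mp h1.symm
    rw [this] at h
    simp [mem_slitPlane_iff] at h
    linarith
  have hN := normSq_pos.mpr h0
  rw [hprod, log_mul (neg_ne_zero.mpr h0) h1]
  · ring
  · have hy : (1 - τ⁻¹).im = τ.im / normSq τ := by rw [sub_im, inv_im]; simp [neg_div]
    rcases lt_trichotomy τ.im 0 with hlt | heq | hgt
    · have a1 := arg_pos_of_im_pos (w := -τ) (by simpa using hlt)
      have a2 := arg_neg_of_im_neg (w := 1 - τ⁻¹) (by rw [hy]; exact div_neg_of_neg_of_pos hlt hN)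
      exact ⟨by linarith [neg_pi_lt_arg (1 - τ⁻¹)], by linarith [arg_le_pi (-τ)]⟩
    · have hre : 0 < (-τ).re := by
        rcases h with h | h
        · exact h
        · exact absurd (by simp [heq]) h
      have e1 : arg (-τ) = 0 := arg_eq_zero_iff.mpr ⟨hre.le, by simp [heq]⟩
      have e2 : arg (1 - τ⁻¹) = 0 := by
        refine arg_eq_zero_iff.mpr ⟨?_, by rw [hy, heq, zero_div]⟩
        rw [sub_re, inv_re, one_re]
        have : τ.re / normSq τ < 0 := div_neg_of_neg_of_pos (by simpa using hre) hN
        linarith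
      rw [e1, e2]
      exact ⟨by linarith [Real.pi_pos], by linarith [Real.pi_pos]⟩
    · have a1 := arg_neg_of_im_neg (w := -τ) (by simpa using hgt)
      have a2 := arg_pos_of_im_pos (w := 1 - τ⁻¹) (by rw [hy]; exact div_pos hgt hN)
      exact ⟨by linarith [neg_pi_lt_arg (-τ)], by linarith [arg_le_pi (1 - τ⁻¹)]⟩

theorem not_mem_segment_of_slitPlane {A x ζ : ℂ} {r : ℝ} (hr : 0 ≤ r) (hζ : ζ ≠ 0)
    (h : -((x - A) / ζ) ∈ slitPlane) : x ∉ segment ℝ A (A + r * ζ) := by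
  intro hx
  rw [segment_eq_image'] at hx
  obtain ⟨t, ht, rfl⟩ := hx
  have : -((A + t • (A + r * ζ - A) - A) / ζ) = ((-(t * r) : ℝ) : ℂ) := by
    simp only [real_smul]; push_cast; field_simp; ring
  simp only at h
  rw [this, mem_slitPlane_iff] at h
  simp at h
  nlinarith [mul_nonneg ht.1 hr]

/-- A branch of the logarithm about `A` on a set that avoids a segment leading from `A` out of
`U`, with its values at two points seen from `A`. -/
theorem exists_log_of_sees {U : Set ℂ} (hL : LogConnected U) {A ζ p q : ℂ} {r : ℝ} (hr : 0 < r)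
    (hζ : ζ ≠ 0) (hz : A + r * ζ ∉ U) {Y : Set ℂ} (hY : Y ⊆ U) (hYc : IsCompact Y)
    (hYz : ∀ y ∈ Y, y ∉ segment ℝ A (A + r * ζ)) (hp : p ∈ Y) (hq : q ∈ Y)
    (hAp : Sees U A p) (hAq : Sees U A q) (hpζ : -((p - A) / ζ) ∈ slitPlane)
    (hqζ : -((q - A) / ζ) ∈ slitPlane) :
    ∃ a : ℂ → ℂ, ContinuousOn a Y ∧ (∀ y ∈ Y, exp (a y) = y - A) ∧
      a p - a q = log (-((p - A) / ζ)) - log (-((q - A) / ζ)) := by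
  set z := A + r * ζ with hzdef
  -- A branch about the outside point `z` is moved to the base point `A` by subtracting the
  -- logarithm of `(x - z) / (x - A)`, which is legitimate because `Y` avoids the segment `A z`. The
  -- segments `A p` and `A q` are included to compute the values at `p` and `q`.
  obtain ⟨f, hf, hexp⟩ := hL z hz (Y ∪ segment ℝ A p ∪ segment ℝ A q)
    (union_subset (union_subset hY hAp) hAq)
    ((hYc.union (isCompact_segment _ _)).union (isCompact_segment _ _))
  have hYsub : Y ⊆ Y ∪ segment ℝ A p ∪ segment ℝ A q := fun x hx => Or.inl (Or.inl hx)
  have hslit : ∀ y ∈ Y, (y - z) / (y - A) ∈ slitPlane := by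
    intro y hy
    have := div_mem_slitPlane (a := A) (x := z) (z := y) (hYz y hy)
    rwa [← neg_sub y z, ← neg_sub y A, neg_div_neg_eq] at this
  have hr' : (r : ℂ) ≠ 0 := by exact_mod_cast hr.ne'
  have key : ∀ x, -((x - A) / ζ) ∈ slitPlane → x ∈ Y →
      log ((x - z) / (A - z)) - log ((x - z) / (x - A))
        = log (-((x - A) / ζ)) - Real.log r := by
    intro x hx hxY
    have hxA : x - A ≠ 0 := fun h0 => by simp [h0] at hx
    set τ := (x - A) / (r * ζ) with hτ
    have e0 : -τ = ((r⁻¹ : ℝ) : ℂ) * -((x - A) / ζ) := by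
      rw [hτ]; push_cast; field_simp
    have hmem : -τ ∈ slitPlane := by
      rw [e0, mem_slitPlane_iff, re_ofReal_mul, im_ofReal_mul]
      rw [mem_slitPlane_iff] at hx
      rcases hx with h | h
      · exact Or.inl (mul_pos (inv_pos.mpr hr) h)
      · exact Or.inr (mul_ne_zero (inv_ne_zero hr.ne') h)
    have e1 : (x - z) / (A - z) = 1 - τ := by
      rw [hzdef, hτ]; field_simp; ring
    have e2 : (x - z) / (x - A) = 1 - τ⁻¹ := by
      rw [hzdef, hτ, inv_div]; field_simp; ring
    rw [e1, e2, log_radial hmem, e0, log_ofReal_mul (inv_pos.mpr hr) (slitPlane_ne_zero hx),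
      Real.log_inv]
    push_cast; ring
  refine ⟨fun x => f x - log ((x - z) / (x - A)), ?_, ?_, ?_⟩
  · refine (hf.mono hYsub).sub (ContinuousOn.clog (ContinuousOn.div (by fun_prop) (by fun_prop) ?_)
      hslit)
    intro x hx h0
    have := hslit x hx
    rw [h0, div_zero] at this
    simp at this
  · intro y hy
    have h1 := slitPlane_ne_zero (hslit y hy)
    have h2 : y - z ≠ 0 := fun h0 => h1 (by rw [h0, zero_div])
    rw [exp_sub, exp_log h1, hexp y (hYsub hy), div_div_cancel₀ h2]
  · have e1 := log_edge hf hexp (a := A) (b := p) (fun x hx => Or.inl (Or.inr hx))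
    have e2 := log_edge hf hexp (a := A) (b := q) (fun x hx => Or.inr hx)
    have k1 := key p hpζ hp
    have k2 := key q hqζ hq
    linear_combination e1 - e2 + k1 - k2

/-- As `exists_log_of_sees`, for two points that are limits of points seen from `A`, on a set of
points that are not seen from `A`. -/
theorem exists_log_of_exit {U : Set ℂ} (hU : IsOpen U) (hb : Bornology.IsBounded U)
    (hL : LogConnected U) {A ζ M₁ M₂ w₁ w₂ : ℂ} (hA : A ∈ U) (hζ : ζ ≠ 0) {Y : Set ℂ}
    (hY : Y ⊆ U) (hYc : IsCompact Y) (hYA : ∀ y ∈ Y, ¬ Sees U A y) (h₁ : w₁ ∈ Y) (h₂ : w₂ ∈ Y)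
    (hA₁ : Sees U A M₁) (hA₂ : Sees U A M₂) (hM₁ : Sees U M₁ w₁) (hM₂ : Sees U M₂ w₂)
    (hs₁ : ∀ p ∈ segment ℝ M₁ w₁, p ≠ w₁ → Sees U A p)
    (hs₂ : ∀ p ∈ segment ℝ M₂ w₂, p ≠ w₂ → Sees U A p)
    (hζ₁ : -((w₁ - A) / ζ) ∈ slitPlane) (hζ₂ : -((w₂ - A) / ζ) ∈ slitPlane) :
    ∃ a : ℂ → ℂ, ContinuousOn a Y ∧ (∀ y ∈ Y, exp (a y) = y - A) ∧
      a w₁ - a w₂ = log (-((w₁ - A) / ζ)) - log (-((w₂ - A) / ζ)) := by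
  obtain ⟨r, hr, hz, hvis⟩ := exists_first_exit hU hb hA hζ
  -- An exit is a limit of seen points; it is replaced by a seen point so close that the directions
  -- from `A` in between stay off the cut.
  have approx : ∀ M w : ℂ, w ∈ Y → Sees U A M → Sees U M w →
      (∀ p ∈ segment ℝ M w, p ≠ w → Sees U A p) →
      -((w - A) / ζ) ∈ slitPlane → ∃ p, Sees U A p ∧ segment ℝ p w ⊆ U ∧
        ∀ x ∈ segment ℝ p w, -((x - A) / ζ) ∈ slitPlane := by
    intro M w hwY hAM hMw hs hw
    have hne : M ≠ w := by
      rintro rfl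
      exact hYA M hwY hAM
    have hO : IsOpen {x : ℂ | -((x - A) / ζ) ∈ slitPlane} :=
      isOpen_slitPlane.preimage (by fun_prop)
    obtain ⟨ε, hε, hball⟩ := Metric.isOpen_iff.mp hO w hw
    have hd : 0 < ‖M - w‖ := norm_pos_iff.mpr (sub_ne_zero.mpr hne)
    set t := min 1 (ε / 2 / ‖M - w‖) with ht
    have ht0 : 0 < t := by positivity
    have hp : w + t • (M - w) ∈ segment ℝ M w := by
      rw [segment_symm, segment_eq_image']
      exact ⟨t, ⟨ht0.le, min_le_left _ _⟩, rfl⟩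
    refine ⟨w + t • (M - w), hs _ hp ?_, hMw.mono_seg hp (right_mem_segment ℝ M w), ?_⟩
    · intro h0
      rw [add_eq_left, smul_eq_zero] at h0
      rcases h0 with h0 | h0
      · exact ht0.ne' h0
      · exact hne (sub_eq_zero.mp h0)
    · have hpb : w + t • (M - w) ∈ Metric.ball w ε := by
        rw [Metric.mem_ball, dist_eq_norm, add_sub_cancel_left, norm_smul,
          Real.norm_of_nonneg ht0.le]
        have : t * ‖M - w‖ ≤ ε / 2 := by
          rw [← le_div_iff₀ hd]; exact min_le_right _ _
        linarith
      exact ((convex_ball w ε).segment_subset hpb (Metric.mem_ball_self hε)).trans hball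
  obtain ⟨p₁, hAp₁, hpU₁, hpw₁⟩ := approx M₁ w₁ h₁ hA₁ hM₁ hs₁ hζ₁
  obtain ⟨p₂, hAp₂, hpU₂, hpw₂⟩ := approx M₂ w₂ h₂ hA₂ hM₂ hs₂ hζ₂
  -- The cut runs from `A` to its first exit. It consists of seen points and one point outside `U`,
  -- whereas `Y` is an unseen part of `U`.
  have hYz : ∀ y ∈ Y ∪ segment ℝ p₁ w₁ ∪ segment ℝ p₂ w₂, y ∉ segment ℝ A (A + r * ζ) := by
    rintro y ((hy | hy) | hy)
    · intro hys
      rw [segment_eq_image'] at hys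
      obtain ⟨t, ht, rfl⟩ := hys
      rcases ht.2.lt_or_eq with h1 | h1
      · apply hYA _ hy
        convert hvis (t * r) (mul_nonneg ht.1 hr.le) (by nlinarith) using 1
        simp only [real_smul]; push_cast; ring
      · apply hz
        rw [h1] at hy
        simpa using hY hy
    · exact not_mem_segment_of_slitPlane hr.le hζ (hpw₁ y hy)
    · exact not_mem_segment_of_slitPlane hr.le hζ (hpw₂ y hy)
  obtain ⟨a, ha, hexp, hdiff⟩ := exists_log_of_sees hL hr hζ hz
    (Y := Y ∪ segment ℝ p₁ w₁ ∪ segment ℝ p₂ w₂) (union_subset (union_subset hY hpU₁) hpU₂)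
    ((hYc.union (isCompact_segment _ _)).union (isCompact_segment _ _)) hYz
    (p := p₁) (q := p₂) (Or.inl (Or.inr (left_mem_segment ℝ _ _)))
    (Or.inr (left_mem_segment ℝ _ _)) hAp₁ hAp₂ (hpw₁ _ (left_mem_segment ℝ _ _))
    (hpw₂ _ (left_mem_segment ℝ _ _))
  have edge : ∀ p w : ℂ, segment ℝ p w ⊆ Y ∪ segment ℝ p₁ w₁ ∪ segment ℝ p₂ w₂ →
      (∀ x ∈ segment ℝ p w, -((x - A) / ζ) ∈ slitPlane) →
      a p - log (-((p - A) / ζ)) = a w - log (-((w - A) / ζ)) := by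
    intro p w hsub hsl
    have := log_sub_log_const (isPreconnected_segment p w) (ha.mono hsub)
      (g := fun x => log (-((x - A) / ζ)) + log (-ζ)) ?_ ?_ (left_mem_segment ℝ _ _)
      (right_mem_segment ℝ _ _)
    · linear_combination this
    · exact (ContinuousOn.clog (by fun_prop) hsl).add continuousOn_const
    · intro x hx
      rw [hexp x (hsub hx), exp_add, exp_log (slitPlane_ne_zero (hsl x hx)),
        exp_log (neg_ne_zero.mpr hζ)]
      field_simp
  have E1 := edge p₁ w₁ (fun x hx => Or.inl (Or.inr hx)) hpw₁
  have E2 := edge p₂ w₂ (fun x hx => Or.inr hx) hpw₂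
  refine ⟨a, ha.mono fun x hx => Or.inl (Or.inl hx), fun y hy => hexp y (Or.inl (Or.inl hy)), ?_⟩
  linear_combination hdiff - E1 + E2

/-- Two nonzero vectors not on a common ray are strictly separated by a line through the origin; `η`
and `κ * η` are the two vectors after that line has been turned to the real axis. -/
theorem exists_separating_direction {κ : ℂ} (h0 : κ ≠ 0) (h : ¬ ∃ t : ℝ, 0 < t ∧ κ = t) :
    ∃ η : ℂ, 0 < η.im ∧ (κ * η).im < 0 := by
  by_cases hi : κ.im = 0
  · have hre : κ.re < 0 := by
      rcases lt_trichotomy κ.re 0 with h1 | h1 | h1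
      · exact h1
      · exact absurd (Complex.ext h1 hi) h0
      · exact absurd ⟨κ.re, h1, Complex.ext rfl (by simpa using hi)⟩ h
    exact ⟨I, by simp, by simpa [mul_im] using hre⟩
  · refine ⟨⟨-(κ.re + 1) / κ.im, 1⟩, by simp, ?_⟩
    rw [mul_im]
    simp only
    field_simp
    linarith

/-- Two exit points from the region seen from `A` that are joined outside that region lie on the
same ray from `A`. -/
theorem exits_same_ray {U : Set ℂ} (hU : IsOpen U) (hb : Bornology.IsBounded U)
    (hL : LogConnected U) {A M₁ M₂ w₁ w₂ : ℂ} (hA : A ∈ U) {Y : Set ℂ}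
    (hY : Y ⊆ U) (hYc : IsCompact Y) (hYp : IsPreconnected Y) (hYA : ∀ y ∈ Y, ¬ Sees U A y)
    (h₁ : w₁ ∈ Y) (h₂ : w₂ ∈ Y) (hA₁ : Sees U A M₁) (hA₂ : Sees U A M₂)
    (hM₁ : Sees U M₁ w₁) (hM₂ : Sees U M₂ w₂)
    (hs₁ : ∀ p ∈ segment ℝ M₁ w₁, p ≠ w₁ → Sees U A p)
    (hs₂ : ∀ p ∈ segment ℝ M₂ w₂, p ≠ w₂ → Sees U A p) :
    ∃ t : ℝ, 0 < t ∧ w₂ - A = t * (w₁ - A) := by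
  have hw₁ : w₁ - A ≠ 0 := fun h => hYA _ h₁ (by rw [sub_eq_zero.mp h]; exact Sees.refl hA)
  have hw₂ : w₂ - A ≠ 0 := fun h => hYA _ h₂ (by rw [sub_eq_zero.mp h]; exact Sees.refl hA)
  by_contra hcon
  have hκ0 : (w₂ - A) / (w₁ - A) ≠ 0 := div_ne_zero hw₂ hw₁
  obtain ⟨η, hη, hκη⟩ := exists_separating_direction hκ0 (by
    rintro ⟨t, ht, h⟩
    exact hcon ⟨t, ht, by rw [← h]; field_simp⟩)
  have hη0 : η ≠ 0 := fun h => by simp [h] at hη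
  set κ := (w₂ - A) / (w₁ - A) with hκ
  have d1 : (w₁ - A) / ((w₁ - A) / η) = η := by field_simp
  have d2 : (w₂ - A) / ((w₁ - A) / η) = κ * η := by rw [hκ]; field_simp
  have hζ : (w₁ - A) / η ≠ 0 := div_ne_zero hw₁ hη0
  -- Take two branches about `A`, cut along opposite rays of a line separating the two exits. On the
  -- connected set `Y` they have the same increment between the exits, but the explicit values
  -- differ by `2π`.
  obtain ⟨a, ha, hae, had⟩ := exists_log_of_exit hU hb hL hA hζ hY hYc hYA h₁ h₂ hA₁ hA₂ hM₁ hM₂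
    hs₁ hs₂ (by rw [d1]; exact Or.inr (by simpa using hη.ne'))
    (by rw [d2]; exact Or.inr (by rw [neg_im]; linarith))
  obtain ⟨b, hb', hbe, hbd⟩ := exists_log_of_exit hU hb hL hA (neg_ne_zero.mpr hζ) hY hYc hYA h₁ h₂
    hA₁ hA₂ hM₁ hM₂ hs₁ hs₂ (by rw [div_neg, d1, neg_neg]; exact Or.inr hη.ne')
    (by rw [div_neg, d2, neg_neg]; exact Or.inr hκη.ne)
  have key := log_sub_log_const hYp ha hb' (fun x hx => by rw [hae x hx, hbe x hx]) h₁ h₂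
  rw [d1, d2] at had
  rw [div_neg, div_neg, d1, d2, neg_neg, neg_neg] at hbd
  have e : log (-η) - log (-(κ * η)) = log η - log (κ * η) := by
    rw [← had, ← hbd]; linear_combination key
  have e' := congrArg Complex.im e
  simp only [sub_im, log_im] at e'
  rw [arg_neg_eq_arg_sub_pi_of_im_pos hη, arg_neg_eq_arg_add_pi_of_im_neg hκη] at e'
  linarith [Real.pi_pos]

/-- If `M` were on the line through `A` in direction `u`, the segments from `A` to `M` and from `M`
to the exit would cover the segment from `A` to the exit. -/
theorem im_ne_zero_of_exit {U : Set ℂ} {A M u : ℂ} {t : ℝ} (hu : u ≠ 0) (ht : 0 < t)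
    (hAM : Sees U A M) (hMw : Sees U M (A + t * u)) (hAw : ¬ Sees U A (A + t * u)) :
    ((M - A) / u).im ≠ 0 := by
  intro h
  apply hAw
  set x := ((M - A) / u).re with hx
  have hM : M = A + x * u := by
    have : (M - A) / u = (x : ℂ) := Complex.ext rfl (by simpa using h)
    field_simp at this
    linear_combination this
  have hpt : ∀ s : ℝ, 0 ≤ s → s ≤ t → A + s * u ∈ U := by
    intro s hs0 hst
    rcases le_total s x with hsx | hsx
    · apply hAM
      rw [segment_eq_image', hM]
      by_cases hx0 : x = 0
      · have : s = 0 := by linarith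
        exact ⟨0, by simp, by simp [this]⟩
      · have hxp : 0 < x := lt_of_le_of_ne (hs0.trans hsx) (Ne.symm hx0)
        refine ⟨s / x, ⟨by positivity, (div_le_one hxp).mpr hsx⟩, ?_⟩
        simp only [real_smul]
        push_cast
        have : (x : ℂ) ≠ 0 := by exact_mod_cast hx0
        field_simp
        ring
    · apply hMw
      rw [segment_eq_image', hM]
      by_cases hx0 : t - x = 0
      · have : s = x := by linarith
        exact ⟨0, by simp, by simp [this]⟩
      · have hxp : 0 < t - x := lt_of_le_of_ne (by linarith) (Ne.symm hx0)
        refine ⟨(s - x) / (t - x), ⟨div_nonneg (by linarith) hxp.le,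
          (div_le_one hxp).mpr (by linarith)⟩, ?_⟩
        simp only [real_smul]
        push_cast
        have : (t - x : ℂ) ≠ 0 := by exact_mod_cast hx0
        field_simp
        ring
  intro p hp
  rw [segment_eq_image'] at hp
  obtain ⟨s, hs, rfl⟩ := hp
  have := hpt (s * t) (mul_nonneg hs.1 ht.le) (mul_le_of_le_one_left ht.le hs.2)
  convert this using 2
  simp only [real_smul]; push_cast; ring

/-- Two points seen from `A` that see points joined outside the region seen from `A` lie strictly
on the same side of the ray through the exit points. -/
theorem exits_same_side {U : Set ℂ} (hU : IsOpen U) (hb : Bornology.IsBounded U)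
    (hL : LogConnected U) {A M₁ M₂ u : ℂ} {t₁ t₂ : ℝ} (hA : A ∈ U) (hu : u ≠ 0) (ht₁ : 0 < t₁)
    (ht₂ : 0 < t₂) {Y : Set ℂ}
    (hY : Y ⊆ U) (hYc : IsCompact Y) (hYp : IsPreconnected Y) (hYA : ∀ y ∈ Y, ¬ Sees U A y)
    (h₁ : A + t₁ * u ∈ Y) (h₂ : A + t₂ * u ∈ Y) (hA₁ : Sees U A M₁) (hA₂ : Sees U A M₂)
    (hM₁ : Sees U M₁ (A + t₁ * u)) (hM₂ : Sees U M₂ (A + t₂ * u))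
    (hs₁ : ∀ p ∈ segment ℝ M₁ (A + t₁ * u), p ≠ A + t₁ * u → Sees U A p)
    (hs₂ : ∀ p ∈ segment ℝ M₂ (A + t₂ * u), p ≠ A + t₂ * u → Sees U A p) :
    0 < ((M₁ - A) / u).im * ((M₂ - A) / u).im := by
  have hi₁ := im_ne_zero_of_exit hu ht₁ hA₁ hM₁ (hYA _ h₁)
  have hi₂ := im_ne_zero_of_exit hu ht₂ hA₂ hM₂ (hYA _ h₂)
  -- Turning is measured about `v`, the point where the ray leaves `U`. It precedes both exits,
  -- since these are unseen points of `U` on the ray.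
  obtain ⟨r, hr, hv, hvis⟩ := exists_first_exit hU hb hA hu
  have hrt : ∀ t : ℝ, 0 < t → A + t * u ∈ Y → r < t := by
    intro t ht htY
    by_contra hn
    rcases (not_lt.mp hn).lt_or_eq with h | h
    · exact hYA _ htY (hvis t ht.le h)
    · exact hv (h ▸ hY htY)
  have hr₁ := hrt t₁ ht₁ h₁
  have hr₂ := hrt t₂ ht₂ h₂
  set v := A + r * u with hvdef
  have hYv : ∀ y ∈ Y, y ∉ segment ℝ A v := by
    intro y hy hys
    rw [segment_eq_image'] at hys
    obtain ⟨t, ht, rfl⟩ := hys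
    rcases ht.2.lt_or_eq with h1 | h1
    · apply hYA _ hy
      convert hvis (t * r) (mul_nonneg ht.1 hr.le) (by nlinarith) using 1
      simp only [real_smul, hvdef]; push_cast; ring
    · apply hv
      rw [h1] at hy
      simpa using hY hy
  obtain ⟨f, hf, hfe⟩ := hL v hv (Y ∪ (segment ℝ A M₁ ∪ segment ℝ M₁ (A + t₁ * u)) ∪
      (segment ℝ A M₂ ∪ segment ℝ M₂ (A + t₂ * u)))
    (union_subset (union_subset hY (union_subset hA₁ hM₁)) (union_subset hA₂ hM₂))
    ((hYc.union ((isCompact_segment _ _).union (isCompact_segment _ _))).union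
      ((isCompact_segment _ _).union (isCompact_segment _ _)))
  have p1 := log_edge hf hfe (a := A) (b := M₁) (fun x hx => Or.inl (Or.inr (Or.inl hx)))
  have p2 := log_edge hf hfe (a := M₁) (b := A + t₁ * u)
    (fun x hx => Or.inl (Or.inr (Or.inr hx)))
  have q1 := log_edge hf hfe (a := A) (b := M₂) (fun x hx => Or.inr (Or.inl hx))
  have q2 := log_edge hf hfe (a := M₂) (b := A + t₂ * u) (fun x hx => Or.inr (Or.inr hx))
  have hYsub : Y ⊆ Y ∪ (segment ℝ A M₁ ∪ segment ℝ M₁ (A + t₁ * u)) ∪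
      (segment ℝ A M₂ ∪ segment ℝ M₂ (A + t₂ * u)) := fun x hx => Or.inl (Or.inl hx)
  have hslit : ∀ y ∈ Y, (y - v) / (y - A) ∈ slitPlane := by
    intro y hy
    have := div_mem_slitPlane (a := A) (x := v) (z := y) (hYv y hy)
    rwa [← neg_sub y v, ← neg_sub y A, neg_div_neg_eq] at this
  -- With the cut opposite to `u`, both exits have the same argument about `A`. Along `Y` the
  -- branches about `v` and about `A` differ by the logarithm of `(x - v) / (x - A)` and a constant,
  -- and that logarithm is real at the exits, so the arguments about `v` agree as well.
  obtain ⟨a, ha, hae, had⟩ := exists_log_of_exit hU hb hL hA (neg_ne_zero.mpr hu) hY hYc hYA h₁ h₂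
    hA₁ hA₂ hM₁ hM₂ hs₁ hs₂
    (by left; rw [div_neg, neg_neg, add_sub_cancel_left, mul_div_cancel_right₀ _ hu]; simpa)
    (by left; rw [div_neg, neg_neg, add_sub_cancel_left, mul_div_cancel_right₀ _ hu]; simpa)
  rw [div_neg, div_neg, neg_neg, neg_neg, add_sub_cancel_left, add_sub_cancel_left,
    mul_div_cancel_right₀ _ hu, mul_div_cancel_right₀ _ hu, ← ofReal_log ht₁.le,
    ← ofReal_log ht₂.le] at had
  have had' : (a (A + t₁ * u)).im - (a (A + t₂ * u)).im = 0 := by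
    rw [← sub_im, had, sub_im, ofReal_im, ofReal_im, sub_zero]
  have key := log_sub_log_const hYp (f := fun x => f x - log ((x - v) / (x - A))) (g := a) ?_ ha ?_
    h₁ h₂
  rotate_left
  · refine (hf.mono hYsub).sub (ContinuousOn.clog (ContinuousOn.div (by fun_prop) (by fun_prop) ?_)
      hslit)
    intro x hx h0
    have := hslit x hx
    rw [h0, div_zero] at this
    simp at this
  · intro y hy
    have h1 := slitPlane_ne_zero (hslit y hy)
    have h2 : y - v ≠ 0 := fun h0 => h1 (by rw [h0, zero_div])
    rw [exp_sub, exp_log h1, hfe y (hYsub hy), div_div_cancel₀ h2, hae y hy]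
  have hlog : ∀ t : ℝ, r < t → (log ((A + t * u - v) / (A + t * u - A))).im = 0 := by
    intro t ht
    have : (A + t * u - v) / (A + t * u - A) = (((t - r) / t : ℝ) : ℂ) := by
      have : (t : ℂ) ≠ 0 := by exact_mod_cast (hr.trans ht).ne'
      rw [hvdef]; push_cast; field_simp; ring
    rw [this, ← ofReal_log (div_nonneg (by linarith) (by linarith)), ofReal_im]
  -- The path from `A` through `M` to the exit goes half way round `v`, and the sign of the turn
  -- tells the side of `M`. Equal turning forces equal sides.
  have turn : ∀ (M : ℂ) (t : ℝ), r < t → ((M - A) / u).im ≠ 0 →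
      (log ((M - v) / (A - v)) + log ((A + t * u - v) / (M - v))).im
        = if 0 < ((M - A) / u).im then -Real.pi else Real.pi := by
    intro M t ht hM
    set μ := (M - v) / u with hμ
    have hμi : μ.im = ((M - A) / u).im := by
      have : (M - A) / u = μ + r := by rw [hμ, hvdef]; field_simp; ring
      rw [this]; simp
    have e1 : (M - v) / (A - v) = ((r⁻¹ : ℝ) : ℂ) * -μ := by
      have : (r : ℂ) ≠ 0 := by exact_mod_cast hr.ne'
      rw [hμ, hvdef]; push_cast; field_simp; ring
    have e2 : (A + t * u - v) / (M - v) = ((t - r : ℝ) : ℂ) * μ⁻¹ := by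
      rw [hμ, hvdef, inv_div]; push_cast; ring
    rw [← hμi] at hM ⊢
    rw [add_im, log_im, log_im, e1, e2, arg_real_mul _ (inv_pos.mpr hr),
      arg_real_mul _ (sub_pos.mpr ht), arg_inv]
    have hpi : arg μ ≠ Real.pi := fun h => hM (arg_eq_pi_iff.mp h).2
    rw [if_neg hpi]
    split_ifs with h
    · rw [arg_neg_eq_arg_sub_pi_of_im_pos h]; ring
    · rw [arg_neg_eq_arg_add_pi_of_im_neg (lt_of_le_of_ne (not_lt.mp h) hM)]; ring
  have T1 := turn M₁ t₁ hr₁ hi₁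
  have T2 := turn M₂ t₂ hr₂ hi₂
  rw [← p1, ← p2, sub_add_sub_cancel'] at T1
  rw [← q1, ← q2, sub_add_sub_cancel'] at T2
  have key' := congrArg Complex.im key
  simp only [sub_im] at key'
  rw [hlog t₁ hr₁, hlog t₂ hr₂] at key'
  rw [sub_im] at T1 T2
  have hpi := Real.pi_pos
  split_ifs at T1 T2 with s1 s2 s2
  · exact mul_pos s1 s2
  · linarith
  · linarith
  · exact mul_pos_of_neg_of_neg (lt_of_le_of_ne (not_lt.mp s1) hi₁)
      (lt_of_le_of_ne (not_lt.mp s2) hi₂)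

/-! ### Sets of points that see a connected set. -/

/-- The set of points that see some point of `X`. -/
def visSet (U X : Set ℂ) : Set ℂ := {p | ∃ x ∈ X, Sees U p x}

/-- The ray from a point `A` that does not see `X` behind which `X` is hidden. -/
theorem exists_frame {U : Set ℂ} (hU : IsOpen U) (hb : Bornology.IsBounded U)
    (hL : LogConnected U) {X : Set ℂ} (hX : IsPathConnected X) (hXU : X ⊆ U) {A : ℂ}
    (hA : A ∉ visSet U X) {M₀ : ℂ} (hM₀ : M₀ ∈ visSet U X) (hAM₀ : Sees U A M₀) :
    ∃ (u : ℂ) (σ : ℝ), u ≠ 0 ∧ ∀ M, Sees U A M → ∀ m ∈ X, Sees U M m →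
      0 < σ * ((M - A) / u).im ∧ ∃ t : ℝ, 0 < t ∧ A + t * u ∈ segment ℝ M m ∧
        ∀ p ∈ segment ℝ M (A + t * u), p ≠ A + t * u → Sees U A p := by
  have hAX : ∀ x ∈ X, ¬ Sees U A x := fun x hx h => hA ⟨x, hx, h⟩
  have hAU := hAM₀.left_mem
  obtain ⟨m₀, hm₀, hMm₀⟩ := hM₀
  obtain ⟨w₀, hw₀, hv₀, hn₀⟩ := exists_exit hU hL hAM₀ hMm₀ (hAX m₀ hm₀)
  have hw₀A : ¬ Sees U A w₀ := hn₀ _ (left_mem_segment ℝ _ _)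
  have hu : w₀ - A ≠ 0 := fun h => hw₀A (by rw [sub_eq_zero.mp h]; exact Sees.refl hAU)
  refine ⟨w₀ - A, ((M₀ - A) / (w₀ - A)).im, hu, ?_⟩
  intro M hAM m hm hMm
  obtain ⟨w, hw, hv, hn⟩ := exists_exit hU hL hAM hMm (hAX m hm)
  obtain ⟨γ, hγ⟩ := hX.joinedIn m₀ hm₀ m hm
  have hwm₀ : segment ℝ w₀ m₀ ⊆ U := hMm₀.mono_seg hw₀ (right_mem_segment ℝ _ _)
  have hwm : segment ℝ w m ⊆ U := hMm.mono_seg hw (right_mem_segment ℝ _ _)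
  -- The two unseen tails, joined by a path in `X`, form the connected unseen set that links the
  -- exits.
  set Y := segment ℝ w₀ m₀ ∪ range γ ∪ segment ℝ w m with hYdef
  have hYU : Y ⊆ U := union_subset (union_subset hwm₀
    (range_subset_iff.mpr fun t => hXU (hγ t))) hwm
  have hYc : IsCompact Y := ((isCompact_segment _ _).union (isCompact_range γ.continuous)).union
    (isCompact_segment _ _)
  have hYp : IsPreconnected Y := by
    refine IsPreconnected.union m (Or.inr ⟨1, by simp⟩) (right_mem_segment ℝ _ _) ?_
      (isPreconnected_segment _ _)
    exact IsPreconnected.union m₀ (right_mem_segment ℝ _ _) ⟨0, by simp⟩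
      (isPreconnected_segment _ _) (isPreconnected_range γ.continuous)
  have hYA : ∀ y ∈ Y, ¬ Sees U A y := by
    rintro y ((hy | ⟨t, rfl⟩) | hy)
    · exact hn₀ y hy
    · exact hAX _ (hγ t)
    · exact hn y hy
  have h₁ : w₀ ∈ Y := Or.inl (Or.inl (left_mem_segment ℝ _ _))
  have h₂ : w ∈ Y := Or.inr (left_mem_segment ℝ _ _)
  have hMw₀ : Sees U M₀ w₀ := hMm₀.mono_seg (left_mem_segment ℝ _ _) hw₀
  have hMw : Sees U M w := hMm.mono_seg (left_mem_segment ℝ _ _) hw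
  obtain ⟨t, ht, hwt⟩ := exits_same_ray hU hb hL hAU hYU hYc hYp hYA h₁ h₂ hAM₀ hAM hMw₀ hMw hv₀ hv
  have e1 : A + ((1 : ℝ) : ℂ) * (w₀ - A) = w₀ := by push_cast; ring
  have e2 : A + (t : ℂ) * (w₀ - A) = w := by rw [← hwt]; ring
  refine ⟨?_, t, ht, ?_⟩
  · exact exits_same_side hU hb hL hAU hu one_pos ht hYU hYc hYp hYA (by rwa [e1]) (by rwa [e2])
      hAM₀ hAM (by rwa [e1]) (by rwa [e2]) (by rwa [e1]) (by rwa [e2])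
  · rw [e2]; exact ⟨hw, hv⟩

theorem isOpen_visSet {U : Set ℂ} (hU : IsOpen U) (X : Set ℂ) : IsOpen (visSet U X) := by
  have : visSet U X = ⋃ x ∈ X, {p | Sees U p x} := by
    ext p; simp [visSet]
  rw [this]
  exact isOpen_biUnion fun x _ =>
    (isOpen_sees hU).preimage (by fun_prop : Continuous fun p : ℂ => (p, x))

theorem visSet_subset (U X : Set ℂ) : visSet U X ⊆ U := fun _ ⟨_, _, h⟩ => h.left_mem

/-- The setting of the visibility lemmas: an open bounded set in which branches of logarithms
about outside points exist, and a path connected subset. -/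
structure VisSetting (U X : Set ℂ) : Prop where
  isOpen : IsOpen U
  bdd : Bornology.IsBounded U
  log : LogConnected U
  conn : IsPathConnected X
  sub : X ⊆ U

/-- Relative convexity. At a point `C` outside, the hiding ray would have `M₁` and `M₂` strictly on
one side of its line, which is impossible for a point between them. -/
theorem VisSetting.segment_subset {U X : Set ℂ} (h : VisSetting U X) {M₁ M₂ : ℂ}
    (h₁ : M₁ ∈ visSet U X) (h₂ : M₂ ∈ visSet U X) (h12 : Sees U M₁ M₂) :
    segment ℝ M₁ M₂ ⊆ visSet U X := by
  intro C hC
  by_contra hn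
  have hC1 : Sees U C M₁ := h12.mono_seg hC (left_mem_segment ℝ _ _)
  have hC2 : Sees U C M₂ := h12.mono_seg hC (right_mem_segment ℝ _ _)
  obtain ⟨u, σ, hu, hF⟩ := exists_frame h.isOpen h.bdd h.log h.conn h.sub hn h₁ hC1
  obtain ⟨m₁, hm₁, hs₁⟩ := h₁
  obtain ⟨m₂, hm₂, hs₂⟩ := h₂
  have i1 := (hF M₁ hC1 m₁ hm₁ hs₁).1
  have i2 := (hF M₂ hC2 m₂ hm₂ hs₂).1
  obtain ⟨α, β, hα, hβ, hαβ, rfl⟩ := hC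
  have key : (α : ℂ) * ((M₁ - (α • M₁ + β • M₂)) / u) + β * ((M₂ - (α • M₁ + β • M₂)) / u) = 0 := by
    have : (α : ℂ) + β = 1 := by exact_mod_cast hαβ
    simp only [real_smul]
    field_simp
    linear_combination (-(α * M₁ + β * M₂)) * this
  have key' := congrArg Complex.im key
  simp only [add_im, im_ofReal_mul, zero_im] at key'
  rcases hα.lt_or_eq with h0 | h0
  · have h3 : α * (σ * ((M₁ - (α • M₁ + β • M₂)) / u).im)
        + β * (σ * ((M₂ - (α • M₁ + β • M₂)) / u).im) = 0 := by linear_combination σ * key'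
    linarith [mul_pos h0 i1, mul_nonneg hβ i2.le]
  · have : β = 1 := by linarith
    rw [← h0, this] at key'
    simp only [zero_mul, one_mul, zero_add] at key'
    rw [this, ← h0] at i2
    rw [key'] at i2
    simp at i2

/-- `RayMeets U X A u M₁ M₂`: the ray from `A` through `M₁` meets the segment from `M₂` to a point
of the ray in direction `u`. -/
def RayMeets (U X : Set ℂ) (A u M₁ M₂ : ℂ) : Prop :=
  ∃ l τ t : ℝ, 0 < l ∧ 0 ≤ τ ∧ τ < 1 ∧ 0 < t ∧
    (l : ℂ) * (M₁ - A) = (1 - τ) * (M₂ - A) + τ * (t * u) ∧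
    ∀ p ∈ segment ℝ M₂ (A + l * (M₁ - A)), Sees U A p ∧ p ∈ visSet U X

/-- `M₁` and `M₂` lie on one side of the hiding ray. The ray towards the one at the smaller angle
from `u` crosses the segment from the other one to its exit; the sign of a cross product tells which
is which. -/
theorem rayMeets_or {U X : Set ℂ} {A u M₁ M₂ : ℂ} {σ : ℝ} (hu : u ≠ 0)
    (hF : ∀ M, Sees U A M → ∀ m ∈ X, Sees U M m →
      0 < σ * ((M - A) / u).im ∧ ∃ t : ℝ, 0 < t ∧ A + t * u ∈ segment ℝ M m ∧
        ∀ p ∈ segment ℝ M (A + t * u), p ≠ A + t * u → Sees U A p)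
    (h₁ : M₁ ∈ visSet U X) (h₂ : M₂ ∈ visSet U X) (hA₁ : Sees U A M₁) (hA₂ : Sees U A M₂) :
    RayMeets U X A u M₁ M₂ ∨ RayMeets U X A u M₂ M₁ := by
  have main : ∀ M₁ M₂ : ℂ, M₁ ∈ visSet U X → M₂ ∈ visSet U X → Sees U A M₁ → Sees U A M₂ →
      0 ≤ σ * (((M₁ - A) / u).re * ((M₂ - A) / u).im - ((M₂ - A) / u).re * ((M₁ - A) / u).im) →
      RayMeets U X A u M₁ M₂ := by
    rintro M₁ M₂ ⟨m₁, hm₁, hs₁⟩ ⟨m₂, hm₂, hs₂⟩ hA₁ hA₂ hD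
    obtain ⟨i1, -⟩ := hF M₁ hA₁ m₁ hm₁ hs₁
    obtain ⟨i2, t, ht, hw, hv⟩ := hF M₂ hA₂ m₂ hm₂ hs₂
    set g := (M₁ - A) / u with hg
    set h := (M₂ - A) / u with hh
    set D := σ * (g.re * h.im - h.re * g.im) with hDdef
    have hden : 0 < D + t * (σ * g.im) := add_pos_of_nonneg_of_pos hD (mul_pos ht i1)
    -- The values of `τ` and `l` solve `l g = (1 - τ) h + τ t` by Cramer's rule.
    set τ := D / (D + t * (σ * g.im)) with hτ
    have hτ0 : 0 ≤ τ := div_nonneg hD hden.le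
    have hτ1 : τ < 1 := by
      rw [hτ, div_lt_one hden]; linarith [mul_pos ht i1]
    have hσ : σ ≠ 0 := fun h0 => by simp [h0] at i1
    have hgi : g.im ≠ 0 := fun h0 => by simp [h0] at i1
    set l := (1 - τ) * (σ * h.im) / (σ * g.im) with hl
    have hl0 : 0 < l := div_pos (mul_pos (by linarith) i2) i1
    have hlg : (l : ℂ) * g = (1 - τ) * h + τ * t := by
      have h1τ : 1 - τ = t * (σ * g.im) / (D + t * (σ * g.im)) := by
        rw [hτ, eq_div_iff hden.ne', sub_mul, div_mul_cancel₀ _ hden.ne']; ring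
      apply Complex.ext
      · simp only [add_re, mul_re, sub_re, one_re, ofReal_re, sub_im, one_im,
          ofReal_im, sub_zero, zero_mul]
        rw [hl, h1τ, hτ]
        field_simp
        rw [hDdef]
        ring
      · simp only [add_im, mul_im, sub_re, one_re, ofReal_re, sub_im, one_im,
          ofReal_im, sub_zero, zero_mul, mul_zero, add_zero]
        rw [hl]
        field_simp
    have hrel : (l : ℂ) * (M₁ - A) = (1 - τ) * (M₂ - A) + τ * (t * u) := by
      have e1 : M₁ - A = g * u := by rw [hg]; field_simp
      have e2 : M₂ - A = h * u := by rw [hh]; field_simp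
      rw [e1, e2]; linear_combination u * hlg
    refine ⟨l, τ, t, hl0, hτ0, hτ1, ht, hrel, ?_⟩
    intro p hp
    rw [segment_eq_image'] at hp
    obtain ⟨s, hs, rfl⟩ := hp
    have hpe : M₂ + s • (A + l * (M₁ - A) - M₂) = M₂ + (s * τ) • (A + t * u - M₂) := by
      rw [hrel]; simp only [real_smul]; push_cast; ring
    have hsτ0 : 0 ≤ s * τ := mul_nonneg hs.1 hτ0
    have hsτ1 : s * τ < 1 := by nlinarith [hs.1, hs.2]
    simp only [hpe]
    have hps : M₂ + (s * τ) • (A + t * u - M₂) ∈ segment ℝ M₂ (A + t * u) := by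
      rw [segment_eq_image']; exact ⟨s * τ, ⟨hsτ0, hsτ1.le⟩, rfl⟩
    refine ⟨hv _ hps ?_, m₂, hm₂, ?_⟩
    · intro h0
      have : (1 - s * τ) * h.im = 0 := by
        have h1 : ((M₂ + (s * τ) • (A + t * u - M₂) - (A + t * u)) / u) = ((1 - s * τ : ℝ) : ℂ) * (h - t) := by
          rw [hh]; simp only [real_smul]; push_cast; field_simp; ring
        rw [h0, sub_self, zero_div] at h1
        have h2 := congrArg Complex.im h1
        rw [im_ofReal_mul] at h2
        simpa using h2.symm
      rcases mul_eq_zero.mp this with h3 | h3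
      · linarith
      · simp [h3] at i2
    · exact hs₂.mono_seg ((convex_segment M₂ m₂).segment_subset (left_mem_segment ℝ _ _) hw hps)
        (right_mem_segment ℝ _ _)
  rcases le_total 0 (σ * (((M₁ - A) / u).re * ((M₂ - A) / u).im
      - ((M₂ - A) / u).re * ((M₁ - A) / u).im)) with h | h
  · exact Or.inl (main M₁ M₂ h₁ h₂ hA₁ hA₂ h)
  · exact Or.inr (main M₂ M₁ h₂ h₁ hA₂ hA₁ (by linarith))

theorem Sees.extend {U : Set ℂ} {E Z z : ℂ} {k : ℝ} (hk : 0 ≤ k) (hE : E = Z - k * (z - Z))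
    (h1 : Sees U E Z) (h2 : Sees U Z z) : Sees U E z := by
  intro p hp
  rw [segment_eq_image'] at hp
  obtain ⟨s, hs, rfl⟩ := hp
  have hp : E + s • (z - E) = Z + ((s * (1 + k) - k : ℝ) : ℂ) * (z - Z) := by
    rw [hE]; simp only [real_smul]; push_cast; ring
  simp only [hp]
  rcases le_total 0 (s * (1 + k) - k) with h | h
  · apply h2
    rw [segment_eq_image']
    exact ⟨s * (1 + k) - k, ⟨h, by nlinarith [hs.2]⟩, by simp⟩
  · apply h1
    rw [segment_symm, segment_eq_image']
    have hk0 : 0 < k ∨ k = 0 := hk.lt_or_eq.imp id Eq.symm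
    rcases hk0 with hk0 | hk0
    · refine ⟨(k - s * (1 + k)) / k, ⟨div_nonneg (by linarith) hk, ?_⟩, ?_⟩
      · rw [div_le_one hk0]; nlinarith [hs.1]
      · have : (k : ℂ) ≠ 0 := by exact_mod_cast hk0.ne'
        rw [hE]; simp only [real_smul]; push_cast; field_simp; ring
    · refine ⟨0, by simp, ?_⟩
      have : s = 0 := by rw [hk0] at h; nlinarith [hs.1]
      simp [hk0, this]

/-! ### Convexity of shadows. -/

/-- The points before the first hit of `visSet U X` on the segments seen from `A`. -/
def shadow (U X : Set ℂ) (A : ℂ) : Set ℂ :=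
  {p | ∃ M ∈ visSet U X, Sees U A M ∧ p ∈ segment ℝ A M ∧ ∀ q ∈ segment ℝ A p, q ∉ visSet U X}

theorem mem_segment_of_smul {A p : ℂ} {θ : ℝ} (h0 : 0 ≤ θ) (h1 : θ ≤ 1) :
    A + θ * (p - A) ∈ segment ℝ A p := by
  rw [segment_eq_image']; exact ⟨θ, ⟨h0, h1⟩, by simp⟩

/-- Suppose the point `Z` of the triangle `A p₁ p₂` saw some `z ∈ X`. On its way to the hiding ray
the line of sight crosses the ray `A p₁`, at a point of `visSet U X` and so beyond `p₁`. Prolonged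
backwards past `Z` it therefore meets the segment `A p₂`, in a point that also sees `z`, against
`hn₂`. -/
theorem shadow_combination {U X : Set ℂ} (hS : VisSetting U X) {A u M₁ M₂ p₁ p₂ : ℂ} {σ : ℝ}
    (hF : ∀ M, Sees U A M → ∀ m ∈ X, Sees U M m →
      0 < σ * ((M - A) / u).im ∧ ∃ t : ℝ, 0 < t ∧ A + t * u ∈ segment ℝ M m ∧
        ∀ p ∈ segment ℝ M (A + t * u), p ≠ A + t * u → Sees U A p)
    (hR : RayMeets U X A u M₁ M₂) (hp₁ : p₁ ∈ segment ℝ A M₁) (hp₂ : p₂ ∈ segment ℝ A M₂)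
    (hn₁ : ∀ q ∈ segment ℝ A p₁, q ∉ visSet U X) (hn₂ : ∀ q ∈ segment ℝ A p₂, q ∉ visSet U X)
    {α β : ℝ} (hα : 0 ≤ α) (hβ : 0 ≤ β) (hαβ : α + β ≤ 1) :
    A + (α * (p₁ - A) + β * (p₂ - A)) ∉ visSet U X ∧
      ∃ M ∈ visSet U X, Sees U A M ∧ A + (α * (p₁ - A) + β * (p₂ - A)) ∈ segment ℝ A M := by
  obtain ⟨l, τ, t, hl, hτ0, hτ1, ht, hrel, hNM⟩ := hR
  set N := A + l * (M₁ - A) with hN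
  have hNA : N - A = l * (M₁ - A) := by rw [hN]; ring
  obtain ⟨hAN, hNW⟩ := hNM N (right_mem_segment ℝ _ _)
  obtain ⟨hAM₂, hM₂W⟩ := hNM M₂ (left_mem_segment ℝ _ _)
  rw [segment_eq_image'] at hp₁ hp₂
  obtain ⟨s₁, ⟨hs₁0, hs₁1⟩, hp₁⟩ := hp₁
  obtain ⟨s₂, ⟨hs₂0, hs₂1⟩, hp₂⟩ := hp₂
  simp only [real_smul] at hp₁ hp₂
  -- `N` belongs to `visSet U X`, so the ray reaches it only after `p₁`.
  have hls : s₁ < l := by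
    by_contra hcon
    have hs₁p : 0 < s₁ := lt_of_lt_of_le hl (not_lt.mp hcon)
    refine hn₁ N ?_ hNW
    have := mem_segment_of_smul (A := A) (p := p₁) (θ := l / s₁) (by positivity)
      ((div_le_one hs₁p).mpr (not_lt.mp hcon))
    convert this using 1
    have h0 : (s₁ : ℂ) ≠ 0 := by exact_mod_cast hs₁p.ne'
    rw [hN, ← hp₁]; push_cast; field_simp; ring
  set κ := s₁ / l with hκ
  have hκ0 : 0 ≤ κ := by positivity
  have hκ1 : κ < 1 := (div_lt_one hl).mpr hls
  have hl' : (l : ℂ) ≠ 0 := by exact_mod_cast hl.ne'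
  have hpN : p₁ - A = κ * (N - A) := by
    rw [hNA, ← hp₁, hκ]; push_cast; field_simp; ring
  have hpM : p₂ - A = s₂ * (M₂ - A) := by rw [← hp₂]; ring
  set Z := A + (α * (p₁ - A) + β * (p₂ - A)) with hZ
  obtain ⟨MZ, hMZs, hZMZ⟩ : ∃ M ∈ segment ℝ M₂ N, Z ∈ segment ℝ A M := by
    by_cases hc : α * κ + β * s₂ = 0
    · have h1 : α * κ = 0 := by nlinarith [mul_nonneg hα hκ0, mul_nonneg hβ hs₂0]
      have h2 : β * s₂ = 0 := by nlinarith [mul_nonneg hα hκ0, mul_nonneg hβ hs₂0]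
      refine ⟨M₂, left_mem_segment ℝ _ _, ?_⟩
      have h1' : (α : ℂ) * κ = 0 := by exact_mod_cast h1
      have h2' : (β : ℂ) * s₂ = 0 := by exact_mod_cast h2
      have : Z = A := by
        rw [hZ, hpN, hpM]; linear_combination (N - A) * h1' + (M₂ - A) * h2'
      rw [this]; exact left_mem_segment ℝ _ _
    · have hcp : 0 < α * κ + β * s₂ :=
        lt_of_le_of_ne (add_nonneg (mul_nonneg hα hκ0) (mul_nonneg hβ hs₂0)) (Ne.symm hc)
      have hc' : (α * κ + β * s₂ : ℂ) ≠ 0 := by exact_mod_cast hc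
      refine ⟨(β * s₂ / (α * κ + β * s₂)) • M₂ + (α * κ / (α * κ + β * s₂)) • N,
        ⟨_, _, div_nonneg (by positivity) hcp.le, div_nonneg (by positivity) hcp.le,
          by field_simp; ring, rfl⟩, ?_⟩
      have := mem_segment_of_smul (A := A) (θ := α * κ + β * s₂)
        (p := (β * s₂ / (α * κ + β * s₂)) • M₂ + (α * κ / (α * κ + β * s₂)) • N) hcp.le
        (by nlinarith)
      convert this using 1
      rw [hZ, hpN, hpM]
      simp only [real_smul]; push_cast
      field_simp
      ring
  obtain ⟨hAMZ, hMZW⟩ := hNM MZ hMZs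
  refine ⟨?_, MZ, hMZW, hAMZ, hZMZ⟩
  rintro ⟨z, hz, hZz⟩
  have hZW : Z ∈ visSet U X := ⟨z, hz, hZz⟩
  have hAZ : Sees U A Z := hAMZ.mono_seg (left_mem_segment ℝ _ _) hZMZ
  have hn₁' : ∀ θ : ℝ, 0 ≤ θ → θ ≤ 1 → A + θ * (p₁ - A) ∉ visSet U X :=
    fun θ h0 h1 => hn₁ _ (mem_segment_of_smul h0 h1)
  have hn₂' : ∀ θ : ℝ, 0 ≤ θ → θ ≤ 1 → A + θ * (p₂ - A) ∉ visSet U X :=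
    fun θ h0 h1 => hn₂ _ (mem_segment_of_smul h0 h1)
  obtain ⟨-, tZ, htZ, hwZ, -⟩ := hF Z hAZ z hz hZz
  have hα0 : 0 < α := by
    refine lt_of_le_of_ne hα fun h0 => hn₂' β hβ (by linarith) ?_
    convert hZW using 1
    rw [hZ, ← h0]; simp
  have hβ0 : 0 < β := by
    refine lt_of_le_of_ne hβ fun h0 => hn₁' α hα (by linarith) ?_
    convert hZW using 1
    rw [hZ, ← h0]; simp
  have hκp : 0 < κ := by
    refine lt_of_le_of_ne hκ0 fun h0 => hn₂' β hβ (by linarith) ?_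
    convert hZW using 1
    rw [hZ, hpN, ← h0]; simp
  have hs₂p : 0 < s₂ := by
    refine lt_of_le_of_ne hs₂0 fun h0 => hn₁' α hα (by linarith) ?_
    convert hZW using 1
    rw [hZ, hpM, ← h0]; simp
  have hκc : (κ : ℂ) ≠ 0 := by exact_mod_cast hκp.ne'
  have hs₂c : (s₂ : ℂ) ≠ 0 := by exact_mod_cast hs₂p.ne'
  -- For `τ = 0` the points `p₁`, `p₂`, `Z` are on one ray from `A`, and `Z` does not lie beyond the
  -- farther of the other two.
  rcases hτ0.eq_or_lt with hτz | hτp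
  · have hNM₂ : N - A = M₂ - A := by rw [hNA, hrel, ← hτz]; simp
    have hZe : Z = A + (α * κ + β * s₂) * (M₂ - A) := by
      rw [hZ, hpN, hpM, hNM₂]; ring
    rcases le_total s₂ κ with hle | hle
    · refine hn₁' ((α * κ + β * s₂) / κ) (by positivity)
        ((div_le_one hκp).mpr (by nlinarith)) ?_
      convert hZW using 1
      rw [hZe, hpN, hNM₂]; push_cast; field_simp
    · refine hn₂' ((α * κ + β * s₂) / s₂) (by positivity)
        ((div_le_one hs₂p).mpr (by nlinarith)) ?_
      convert hZW using 1
      rw [hZe, hpM]; push_cast; field_simp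
  have hτc : (τ : ℂ) ≠ 0 := by exact_mod_cast hτp.ne'
  have htc : (t : ℂ) ≠ 0 := by exact_mod_cast ht.ne'
  -- In the basis `p₁ - A`, `p₂ - A` the exit of the line of sight has coordinates `(x, -y)` with
  -- `x` and `y` positive, while `Z` has coordinates `(α, β)`.
  set x := tZ / (τ * t * κ) with hx
  set y := tZ * (1 - τ) / (τ * t * s₂) with hy
  have hx0 : 0 < x := by positivity
  have hy0 : 0 < y := div_pos (mul_pos htZ (by linarith)) (by positivity)
  have hw : (tZ : ℂ) * u = x * (p₁ - A) - y * (p₂ - A) := by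
    have hu' : u = (N - A - (1 - τ) * (M₂ - A)) / (τ * t) := by
      rw [hNA, hrel]; field_simp; ring
    rw [hpN, hpM, hx, hy, hu']; push_cast; field_simp
  -- Parameter at which the line from `Z` to the exit has second coordinate zero; `ρ` is its first
  -- coordinate there.
  set lam := β / (β + y) with hlam
  have hlam0 : 0 < lam := by positivity
  have hlam1 : lam < 1 := (div_lt_one (by positivity)).mpr (by linarith)
  set ρ := α + lam * (x - α) with hρ
  have hρ0 : 0 ≤ ρ := by nlinarith [mul_pos hlam0 hx0]
  have hSρ : A + ρ * (p₁ - A) = Z + lam * (A + tZ * u - Z) := by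
    have : ((lam : ℝ) : ℂ) * (β + y) = β := by
      have h0 : (β + y : ℂ) ≠ 0 := by exact_mod_cast (by positivity : β + y ≠ 0)
      rw [hlam]; push_cast; field_simp
    rw [hw, hZ, hρ]; push_cast; linear_combination (p₂ - A) * this
  obtain ⟨ω, hω, hωe⟩ : ∃ ω : ℝ, 0 ≤ ω ∧ A + tZ * u = Z + ω * (z - Z) := by
    rw [segment_eq_image'] at hwZ
    obtain ⟨ω, hω, h⟩ := hwZ
    exact ⟨ω, hω.1, by rw [← h]; simp⟩
  have hSW : A + ρ * (p₁ - A) ∈ visSet U X := by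
    refine ⟨z, hz, hZz.mono_seg ?_ (right_mem_segment ℝ _ _)⟩
    rw [hSρ]
    exact (convex_segment Z z).segment_subset (left_mem_segment ℝ _ _) hwZ
      (mem_segment_of_smul hlam0.le hlam1.le)
  have hρ1 : 1 < ρ := by
    by_contra h
    exact hn₁' ρ hρ0 (not_lt.mp h) hSW
  have hρα : 0 < ρ - α := by linarith
  have hραc : (ρ - α : ℂ) ≠ 0 := by exact_mod_cast hρα.ne'
  -- The line through `(ρ, 0)` and `(α, β)` meets the second axis at `σ₂`, which is at most `1`
  -- because `ρ > 1` and `α + β ≤ 1`.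
  set σ₂ := β * ρ / (ρ - α) with hσ₂
  have hσ₂0 : 0 ≤ σ₂ := by positivity
  have hσ₂1 : σ₂ ≤ 1 := by rw [hσ₂, div_le_one hρα]; nlinarith
  refine hn₂' σ₂ hσ₂0 hσ₂1 ⟨z, hz, ?_⟩
  refine Sees.extend (Z := Z) (k := α / (ρ - α) * (lam * ω))
    (by positivity) ?_ ?_ hZz
  · have e1 : A + σ₂ * (p₂ - A) = Z - (α / (ρ - α)) * (A + ρ * (p₁ - A) - Z) := by
      rw [hσ₂, hZ]; push_cast; field_simp; ring
    rw [e1, hSρ, hωe]; push_cast; ring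
  · have hull := Sees.convexHull_subset hS.log hAM₂
      (b := M₂) (c := MZ) (fun q hq => (hNM q ((convex_segment M₂ N).segment_subset
        (left_mem_segment ℝ _ _) hMZs hq)).1.right_mem) hAMZ.symm
    have hc := convex_convexHull ℝ ({A, M₂, MZ} : Set ℂ)
    have vA : A ∈ convexHull ℝ ({A, M₂, MZ} : Set ℂ) := subset_convexHull ℝ _ (by simp)
    have v2 : M₂ ∈ convexHull ℝ ({A, M₂, MZ} : Set ℂ) := subset_convexHull ℝ _ (by simp)
    have v3 : MZ ∈ convexHull ℝ ({A, M₂, MZ} : Set ℂ) := subset_convexHull ℝ _ (by simp)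
    refine (hc.segment_subset (hc.segment_subset vA v2 ?_) (hc.segment_subset vA v3 hZMZ)).trans hull
    have : A + σ₂ * (p₂ - A) = A + ((σ₂ * s₂ : ℝ) : ℂ) * (M₂ - A) := by
      rw [hpM]; push_cast; ring
    rw [this]
    exact mem_segment_of_smul (by positivity) (by nlinarith)

theorem VisSetting.convex_shadow {U X : Set ℂ} (h : VisSetting U X) {A : ℂ}
    (hA : A ∉ visSet U X) : Convex ℝ (shadow U X A) := by
  rintro p₁ ⟨M₁, hW₁, hA₁, hp₁, hn₁⟩ p₂ ⟨M₂, hW₂, hA₂, hp₂, hn₂⟩ a b ha hb hab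
  obtain ⟨u, σ, hu, hF⟩ := exists_frame h.isOpen h.bdd h.log h.conn h.sub hA hW₁ hA₁
  have hab' : (a + b : ℂ) = 1 := by exact_mod_cast hab
  have e : ∀ θ : ℝ, A + θ • (a • p₁ + b • p₂ - A)
      = A + (((θ * a : ℝ) : ℂ) * (p₁ - A) + ((θ * b : ℝ) : ℂ) * (p₂ - A)) := by
    intro θ
    simp only [real_smul]; push_cast; linear_combination (θ * A) * hab'
  -- The factor `θ` runs along the segment from `A` to the combination, all of which has to avoid
  -- `visSet U X`.
  have key : ∀ θ : ℝ, 0 ≤ θ → θ ≤ 1 → A + θ • (a • p₁ + b • p₂ - A) ∉ visSet U X ∧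
      ∃ M ∈ visSet U X, Sees U A M ∧ A + θ • (a • p₁ + b • p₂ - A) ∈ segment ℝ A M := by
    intro θ h0 h1
    have hle : θ * a + θ * b ≤ 1 := by rw [← mul_add, hab, mul_one]; exact h1
    rcases rayMeets_or hu hF hW₁ hW₂ hA₁ hA₂ with hR | hR
    · rw [e]
      exact shadow_combination h hF hR hp₁ hp₂ hn₁ hn₂ (mul_nonneg h0 ha) (mul_nonneg h0 hb) hle
    · rw [e, add_comm (((θ * a : ℝ) : ℂ) * (p₁ - A))]
      exact shadow_combination h hF hR hp₂ hp₁ hn₂ hn₁ (mul_nonneg h0 hb) (mul_nonneg h0 ha)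
        (by linarith)
  obtain ⟨M, hM, hAM, hMs⟩ := (key 1 zero_le_one le_rfl).2
  rw [one_smul, add_sub_cancel] at hMs
  refine ⟨M, hM, hAM, hMs, ?_⟩
  intro q hq
  rw [segment_eq_image'] at hq
  obtain ⟨θ, hθ, rfl⟩ := hq
  exact (key θ hθ.1 hθ.2).1

theorem shadow_subset (U X : Set ℂ) (A : ℂ) : shadow U X A ⊆ U :=
  fun _ ⟨_, _, hAM, hp, _⟩ => hAM hp

/-! ### Windows: local boundary lines of visibility sets. -/

/-- Along a segment from a point outside `visSet U X` to a point inside it, the points of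
`visSet U X` are those beyond a first hit. -/
theorem VisSetting.exists_hit {U X : Set ℂ} (h : VisSetting U X) {p N : ℂ}
    (hp : p ∉ visSet U X) (hN : N ∈ visSet U X) (hpN : Sees U p N) :
    ∃ s₁ : ℝ, 0 ≤ s₁ ∧ s₁ < 1 ∧
      ∀ s : ℝ, 0 ≤ s → s ≤ 1 → (p + s * (N - p) ∈ visSet U X ↔ s₁ < s) := by
  let P : ℝ → ℂ := fun s => p + s * (N - p)
  have hPc : Continuous P := by fun_prop
  have hPseg : ∀ s : ℝ, 0 ≤ s → s ≤ 1 → P s ∈ segment ℝ p N :=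
    fun s h0 h1 => mem_segment_of_smul h0 h1
  let T : Set ℝ := Icc 0 1 ∩ P ⁻¹' (visSet U X)ᶜ
  have hT : IsClosed T := isClosed_Icc.inter ((isOpen_visSet h.isOpen X).isClosed_compl.preimage hPc)
  have h0T : (0 : ℝ) ∈ T := ⟨by simp, by simpa [P] using hp⟩
  have hbd : BddAbove T := ⟨1, fun s hs => hs.1.2⟩
  -- The supremum is the last point outside; an earlier point of `visSet U X` would contradict
  -- relative convexity.
  have hmem := hT.csSup_mem ⟨0, h0T⟩ hbd
  have hN1 : P 1 = N := by simp [P]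
  refine ⟨sSup T, hmem.1.1, lt_of_le_of_ne hmem.1.2 fun h1 => ?_, ?_⟩
  · have := hmem.2
    rw [h1, mem_preimage, hN1] at this
    exact this hN
  · intro s hs0 hs1
    constructor
    · intro hs
      by_contra hle
      refine hmem.2 (h.segment_subset hs hN
        (hpN.mono_seg (hPseg s hs0 hs1) (right_mem_segment ℝ _ _)) ?_)
      rw [segment_eq_image']
      by_cases hs1' : s = 1
      · have h1 : sSup T = 1 := le_antisymm hmem.1.2 (by linarith)
        have h2 := hmem.2
        rw [h1, mem_preimage, hN1] at h2
        exact absurd hN h2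
      · have h1s : 0 < 1 - s := sub_pos.mpr (lt_of_le_of_ne hs1 hs1')
        refine ⟨(sSup T - s) / (1 - s), ⟨div_nonneg (by linarith) h1s.le,
          (div_le_one h1s).mpr (by linarith [hmem.1.2])⟩, ?_⟩
        have : (1 - s : ℂ) ≠ 0 := by exact_mod_cast h1s.ne'
        simp only [P, real_smul]; push_cast; field_simp; ring
    · intro hs
      by_contra hn
      exact absurd (le_csSup hbd (⟨⟨hs0, hs1⟩, hn⟩ : s ∈ T)) (not_le.mpr hs)

theorem mem_shadow_self {U X : Set ℂ} {A M : ℂ} (hA : A ∉ visSet U X) (hM : M ∈ visSet U X)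
    (hAM : Sees U A M) : A ∈ shadow U X A :=
  ⟨M, hM, hAM, left_mem_segment ℝ _ _, by simpa [segment_same] using hA⟩

/-- In a triangle seen from `p` with two vertices in `visSet U X`, the set `visSet U X` is cut out
by the line through the two first hits. -/
theorem VisSetting.triangle_halfPlane {U X : Set ℂ} (h : VisSetting U X) {p N₁ N₂ : ℂ}
    (hp : p ∉ visSet U X) (h₁ : N₁ ∈ visSet U X) (h₂ : N₂ ∈ visSet U X) (hs₁ : Sees U p N₁)
    (hs₂ : Sees U p N₂) (h12 : Sees U N₁ N₂) {s₁ s₂ : ℝ} (hs₁0 : 0 < s₁) (hs₂0 : 0 < s₂)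
    (hs₁1 : s₁ < 1) (hs₂1 : s₂ < 1)
    (hit₁ : ∀ s : ℝ, 0 ≤ s → s ≤ 1 → (p + s * (N₁ - p) ∈ visSet U X ↔ s₁ < s))
    (hit₂ : ∀ s : ℝ, 0 ≤ s → s ≤ 1 → (p + s * (N₂ - p) ∈ visSet U X ↔ s₂ < s))
    {α β : ℝ} (hα : 0 < α) (hβ : 0 < β) (hαβ : α + β < 1) :
    p + (α * (N₁ - p) + β * (N₂ - p)) ∈ visSet U X ↔ 1 < α / s₁ + β / s₂ := by
  have hs₁c : (s₁ : ℂ) ≠ 0 := by exact_mod_cast hs₁0.ne'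
  have hs₂c : (s₂ : ℂ) ≠ 0 := by exact_mod_cast hs₂0.ne'
  have hhull := Sees.convexHull_subset h.log hs₁ h12 hs₂.symm
  have hc := convex_convexHull ℝ ({p, N₁, N₂} : Set ℂ)
  have vp : p ∈ convexHull ℝ ({p, N₁, N₂} : Set ℂ) := subset_convexHull ℝ _ (by simp)
  have v1 : N₁ ∈ convexHull ℝ ({p, N₁, N₂} : Set ℂ) := subset_convexHull ℝ _ (by simp)
  have v2 : N₂ ∈ convexHull ℝ ({p, N₁, N₂} : Set ℂ) := subset_convexHull ℝ _ (by simp)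
  constructor
  · contrapose!
    intro hle hx
    have hK := h.convex_shadow hp
    have mem : ∀ (N : ℂ) (s : ℝ), 0 ≤ s → s ≤ 1 → N ∈ visSet U X → Sees U p N →
        (∀ r : ℝ, 0 ≤ r → r ≤ 1 → (p + r * (N - p) ∈ visSet U X ↔ s < r)) →
        p + s * (N - p) ∈ shadow U X p := by
      intro N s hs0 hs1 hN hpN hit
      refine ⟨N, hN, hpN, mem_segment_of_smul hs0 hs1, ?_⟩
      intro q hq
      rw [segment_eq_image'] at hq
      obtain ⟨θ, hθ, rfl⟩ := hq
      have e : p + θ • (p + s * (N - p) - p) = p + ((θ * s : ℝ) : ℂ) * (N - p) := by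
        simp only [real_smul]; push_cast; ring
      simp only [e]
      rw [hit _ (mul_nonneg hθ.1 hs0) (by nlinarith [hθ.1, hθ.2]), not_lt]
      exact mul_le_of_le_one_left hs0 hθ.2
    have m1 := mem N₁ s₁ hs₁0.le hs₁1.le h₁ hs₁ hit₁
    have m2 := mem N₂ s₂ hs₂0.le hs₂1.le h₂ hs₂ hit₂
    have m0 := mem_shadow_self hp h₁ hs₁
    -- On or below the line, the point is a convex combination of `p` and the two hits. These belong
    -- to the convex shadow, as the hits themselves are not yet in `visSet U X`.
    have hx' := hK.sum_mem (t := Finset.univ) (w := ![α / s₁, β / s₂, 1 - (α / s₁ + β / s₂)])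
      (z := ![p + s₁ * (N₁ - p), p + s₂ * (N₂ - p), p])
      (by
        intro i _; fin_cases i
        · exact div_nonneg hα.le hs₁0.le
        · exact div_nonneg hβ.le hs₂0.le
        · exact sub_nonneg.mpr hle)
      (by simp [Fin.sum_univ_three])
      (by intro i _; fin_cases i; exacts [m1, m2, m0])
    simp only [Fin.sum_univ_three, Matrix.cons_val_zero, Matrix.cons_val_one, Matrix.cons_val,
      real_smul] at hx'
    obtain ⟨M, -, -, -, hq⟩ := hx'
    refine hq _ (right_mem_segment ℝ _ _) ?_
    convert hx using 1
    push_cast; field_simp; ring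
  · intro hgt
    -- Above the line, both hits are moved at proportional rates towards `N₁` and `N₂` until the
    -- line joining them passes through the point. Relative convexity then applies to the moved
    -- hits.
    have hcont : ContinuousOn (fun τ : ℝ => α / (s₁ + τ * (1 - s₁)) + β / (s₂ + τ * (1 - s₂)))
        (Icc 0 1) := by
      refine ContinuousOn.add (continuousOn_const.div (by fun_prop) ?_)
        (continuousOn_const.div (by fun_prop) ?_)
      · exact fun τ hτ => (add_pos_of_pos_of_nonneg hs₁0
          (mul_nonneg hτ.1 (sub_pos.mpr hs₁1).le)).ne'
      · exact fun τ hτ => (add_pos_of_pos_of_nonneg hs₂0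
          (mul_nonneg hτ.1 (sub_pos.mpr hs₂1).le)).ne'
    obtain ⟨τ, hτ, hτe⟩ := intermediate_value_Icc' zero_le_one hcont (show (1 : ℝ) ∈ _ by
      simp only [one_mul, zero_mul, add_zero, add_sub_cancel, div_one]
      exact ⟨hαβ.le, hgt.le⟩)
    simp only at hτe
    have hτ0 : 0 < τ := by
      refine lt_of_le_of_ne hτ.1 fun h0 => ?_
      rw [← h0] at hτe
      simp only [zero_mul, add_zero] at hτe
      linarith
    set r₁ := s₁ + τ * (1 - s₁) with hr₁
    set r₂ := s₂ + τ * (1 - s₂) with hr₂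
    have r₁s : s₁ < r₁ := by rw [hr₁]; linarith [mul_pos hτ0 (sub_pos.mpr hs₁1)]
    have r₂s : s₂ < r₂ := by rw [hr₂]; linarith [mul_pos hτ0 (sub_pos.mpr hs₂1)]
    have r₁1 : r₁ ≤ 1 := by rw [hr₁]; nlinarith [hτ.2]
    have r₂1 : r₂ ≤ 1 := by rw [hr₂]; nlinarith [hτ.2]
    have r₁0 : 0 < r₁ := hs₁0.trans r₁s
    have r₂0 : 0 < r₂ := hs₂0.trans r₂s
    have w1 := (hit₁ r₁ r₁0.le r₁1).mpr r₁s
    have w2 := (hit₂ r₂ r₂0.le r₂1).mpr r₂s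
    have hsee : Sees U (p + r₁ * (N₁ - p)) (p + r₂ * (N₂ - p)) :=
      (hc.segment_subset (hc.segment_subset vp v1 (mem_segment_of_smul r₁0.le r₁1))
        (hc.segment_subset vp v2 (mem_segment_of_smul r₂0.le r₂1))).trans hhull
    apply h.segment_subset w1 w2 hsee
    refine ⟨α / r₁, β / r₂, by positivity, by positivity, hτe, ?_⟩
    have c1 : (r₁ : ℂ) ≠ 0 := by exact_mod_cast r₁0.ne'
    have c2 : (r₂ : ℂ) ≠ 0 := by exact_mod_cast r₂0.ne'
    have hτc : (α / r₁ + β / r₂ : ℂ) = 1 := by exact_mod_cast hτe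
    simp only [real_smul]; push_cast
    have g1 : (α / r₁ : ℂ) * r₁ = α := by field_simp
    have g2 : (β / r₂ : ℂ) * r₂ = β := by field_simp
    linear_combination p * hτc + (N₁ - p) * g1 + (N₂ - p) * g2

/-- `visSet U X` is given by `c < re (ν * x)` in a neighbourhood of the segment `C M`. -/
def HalfPlaneNear (U X : Set ℂ) (C M ν : ℂ) (c : ℝ) : Prop :=
  ∃ O : Set ℂ, IsOpen O ∧ segment ℝ C M ⊆ O ∧ ∀ x ∈ O, (x ∈ visSet U X ↔ c < (ν * x).re)

/-- If the hits on the first side began at `p` itself, a hit close to `p` joined to `p + n₂` would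
cross the axis in its clear stretch, against relative convexity. -/
theorem VisSetting.hit_pos {U X : Set ℂ} (h : VisSetting U X) {V : Set ℂ} (hV : Convex ℝ V)
    (hVU : V ⊆ U) {p d n₁ n₂ : ℂ} {ε k : ℝ} (hε : 0 < ε) (hk : 0 < k) (hn : n₁ + n₂ = k * d)
    (hclear : ∀ s : ℝ, 0 ≤ s → s ≤ ε → p + s * d ∉ visSet U X) (hp : p ∈ V)
    (h₁V : p + n₁ ∈ V) (h₂V : p + n₂ ∈ V) (h₂ : p + n₂ ∈ visSet U X) {s₁ : ℝ} (h0 : 0 ≤ s₁)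
    (hit₁ : ∀ s : ℝ, 0 ≤ s → s ≤ 1 → (p + s * n₁ ∈ visSet U X ↔ s₁ < s)) : 0 < s₁ := by
  refine lt_of_le_of_ne h0 fun hs => ?_
  rw [← hs] at hit₁
  set s := min 1 (ε / k) with hsd
  have hs0 : 0 < s := by positivity
  have hs1 : s ≤ 1 := min_le_left _ _
  have hsk : s * k ≤ ε := by rw [← le_div_iff₀ hk]; exact min_le_right _ _
  have hw := (hit₁ s hs0.le hs1).mpr hs0
  have hpV : p + s * n₁ ∈ V := hV.segment_subset hp h₁V (by
    have := mem_segment_of_smul (A := p) (p := p + n₁) hs0.le hs1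
    rwa [add_sub_cancel_left] at this)
  have hseg := h.segment_subset hw h₂ ((hV.segment_subset hpV h₂V).trans hVU)
  have h1s : 0 < 1 + s := by linarith
  refine hclear (s * k / (1 + s)) (by positivity) (by
    rw [div_le_iff₀ h1s]; nlinarith) (hseg ?_)
  refine ⟨1 / (1 + s), s / (1 + s), by positivity, by positivity, by field_simp, ?_⟩
  have : (1 + s : ℂ) ≠ 0 := by exact_mod_cast h1s.ne'
  simp only [real_smul]; push_cast
  field_simp
  linear_combination s * hn

/-- `VisSetting.triangle_halfPlane` is applied to a thin triangle around the segment: its apex is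
slightly behind `C`, its other vertices slightly past `M` on either side. -/
theorem VisSetting.exists_halfPlane {U X : Set ℂ} (h : VisSetting U X) {C M : ℂ}
    (hC : C ∉ visSet U X) (hM : M ∈ visSet U X) (hCM : Sees U C M) :
    ∃ (ν : ℂ) (c : ℝ), ν ≠ 0 ∧ HalfPlaneNear U X C M ν c := by
  obtain ⟨δ, hδ, hδU⟩ := (isCompact_segment C M).exists_thickening_subset_open h.isOpen hCM
  obtain ⟨δ', hδ', hδW⟩ := Metric.isOpen_iff.mp (isOpen_visSet h.isOpen X) M hM
  have hV : Convex ℝ (Metric.thickening δ (segment ℝ C M)) := (convex_segment C M).thickening δ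
  set V := Metric.thickening δ (segment ℝ C M) with hVdef
  set d := M - C with hd
  have hd0 : d ≠ 0 := fun h0 => hC (by rw [sub_eq_zero] at h0; rwa [h0] at hM)
  have hdn : 0 < ‖d‖ := norm_pos_iff.mpr hd0
  set ε := min δ δ' / (4 * ‖d‖) with hε
  have hε0 : 0 < ε := by positivity
  have hεd : ε * ‖d‖ = min δ δ' / 4 := by rw [hε]; field_simp
  have hεδ : ε * ‖d‖ < δ / 2 := by rw [hεd]; linarith [min_le_left δ δ']
  have hεδ' : ε * ‖d‖ < δ' / 2 := by rw [hεd]; linarith [min_le_right δ δ']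
  have hsegV : segment ℝ C M ⊆ V := Metric.self_subset_thickening hδ _
  have nearV : ∀ x y, y ∈ segment ℝ C M → ‖x - y‖ < δ → x ∈ V := by
    intro x y hy hxy
    exact Metric.mem_thickening_iff.mpr ⟨y, hy, by rwa [dist_eq_norm]⟩
  set p := C - ε * d with hp
  have hpV : p ∈ V := nearV p C (left_mem_segment ℝ _ _) (by
    rw [hp, sub_sub_cancel_left, norm_neg, norm_mul, norm_real, Real.norm_of_nonneg hε0.le]; linarith)
  set n₁ := (1 + 2 * ε) * d + ε * I * d with hn₁
  set n₂ := (1 + 2 * ε) * d - ε * I * d with hn₂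
  have nn : ∀ s : ℂ, ‖s‖ = 1 → p + ((1 + 2 * ε) * d + ε * s * d) ∈ V ∧
      p + ((1 + 2 * ε) * d + ε * s * d) ∈ visSet U X := by
    intro s hs
    have e : p + ((1 + 2 * ε) * d + ε * s * d) - M = ε * d + ε * s * d := by rw [hp, hd]; ring
    have hle : ‖p + ((1 + 2 * ε) * d + ε * s * d) - M‖ ≤ 2 * (ε * ‖d‖) := by
      rw [e]
      refine (norm_add_le _ _).trans ?_
      rw [norm_mul, norm_mul, norm_mul, norm_real, Real.norm_of_nonneg hε0.le, hs]
      linarith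
    exact ⟨nearV _ M (right_mem_segment ℝ _ _) (by linarith),
      hδW (by rw [Metric.mem_ball, dist_eq_norm]; linarith)⟩
  obtain ⟨h1V, h1W⟩ := nn I (by simp)
  obtain ⟨h2V, h2W⟩ := nn (-I) (by simp)
  have e2 : (1 + 2 * ε) * d + ε * -I * d = n₂ := by rw [hn₂]; ring
  rw [e2] at h2V h2W
  rw [← hn₁] at h1V h1W
  have seesV : ∀ x ∈ V, ∀ y ∈ V, Sees U x y := fun x hx y hy => (hV.segment_subset hx hy).trans hδU
  have hMV := hsegV (right_mem_segment ℝ C M)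
  -- A point of `visSet U X` behind `C` would place `C` between two points of it.
  have hclear : ∀ s : ℝ, 0 ≤ s → s ≤ ε → p + s * d ∉ visSet U X := by
    intro s hs0 hs1 hs
    have hsV : p + s * d ∈ V := nearV _ C (left_mem_segment ℝ _ _) (by
      have : p + s * d - C = ((s - ε : ℝ) : ℂ) * d := by rw [hp]; push_cast; ring
      rw [this, norm_mul, norm_real, Real.norm_eq_abs, abs_of_nonpos (by linarith)]
      nlinarith)
    refine hC (h.segment_subset hs hM (seesV _ hsV _ hMV) ?_)
    have hpos : 0 < 1 + ε - s := by linarith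
    have := mem_segment_of_smul (A := p + s * d) (p := M) (θ := (ε - s) / (1 + ε - s))
      (div_nonneg (by linarith) hpos.le) ((div_le_one hpos).mpr (by linarith))
    convert this using 1
    have hc : (1 + ε - s : ℂ) ≠ 0 := by exact_mod_cast hpos.ne'
    rw [hp, hd]; push_cast; field_simp; ring
  have hpn : p ∉ visSet U X := by simpa using hclear 0 le_rfl hε0.le
  have s1 := seesV p hpV _ h1V
  have s2 := seesV p hpV _ h2V
  obtain ⟨s₁, hs₁0, hs₁1, hit₁⟩ := h.exists_hit hpn h1W s1
  obtain ⟨s₂, hs₂0, hs₂1, hit₂⟩ := h.exists_hit hpn h2W s2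
  have hk : 0 < 2 * (1 + 2 * ε) := by positivity
  have p₁ : 0 < s₁ := h.hit_pos hV hδU hε0 hk (n₁ := n₁) (n₂ := n₂) (by
    rw [hn₁, hn₂]; push_cast; ring) hclear hpV h1V h2V h2W hs₁0
      (by simpa only [add_sub_cancel_left] using hit₁)
  have p₂ : 0 < s₂ := h.hit_pos hV hδU hε0 hk (n₁ := n₂) (n₂ := n₁) (by
    rw [hn₁, hn₂]; push_cast; ring) hclear hpV h2V h1V h1W hs₂0
      (by simpa only [add_sub_cancel_left] using hit₂)
  have key : ∀ α β : ℝ, 0 < α → 0 < β → α + β < 1 →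
      (p + (α * n₁ + β * n₂) ∈ visSet U X ↔ 1 < α / s₁ + β / s₂) := by
    intro α β hα hβ hαβ
    have := h.triangle_halfPlane hpn h1W h2W s1 s2 (seesV _ h1V _ h2V) p₁ p₂ hs₁1 hs₂1 hit₁ hit₂
      hα hβ hαβ
    simpa only [add_sub_cancel_left] using this
  -- `a` and `b` are the coordinates of `x - p` with respect to `n₁` and `n₂`.
  let a : ℂ → ℝ := fun x => (((x - p) / d).re / (1 + 2 * ε) + ((x - p) / d).im / ε) / 2
  let b : ℂ → ℝ := fun x => (((x - p) / d).re / (1 + 2 * ε) - ((x - p) / d).im / ε) / 2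
  have ha : Continuous a := by fun_prop
  have hb : Continuous b := by fun_prop
  have hab : ∀ x, x = p + (a x * n₁ + b x * n₂) := by
    intro x
    have h1 : (1 + 2 * ε : ℂ) ≠ 0 := by exact_mod_cast (by positivity : (1 + 2 * ε : ℝ) ≠ 0)
    have h2 : (ε : ℂ) ≠ 0 := by exact_mod_cast hε0.ne'
    have h3 : (x - p) / d = ((x - p) / d).re + ((x - p) / d).im * I := (re_add_im _).symm
    have h4 : x - p = (((x - p) / d).re + ((x - p) / d).im * I) * d := by rw [← h3]; field_simp
    have h5 : a x * n₁ + b x * n₂ = (((x - p) / d).re + ((x - p) / d).im * I) * d := by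
      simp only [a, b, hn₁, hn₂]; push_cast; field_simp; ring
    rw [h5, ← h4]; ring
  set P := (1 / s₁ + 1 / s₂) / (2 * (1 + 2 * ε)) with hP
  set Q := (1 / s₁ - 1 / s₂) / (2 * ε) with hQ
  have hP0 : 0 < P := by positivity
  have hform : ∀ x, a x / s₁ + b x / s₂ = (((P : ℂ) - Q * I) / d * (x - p)).re := by
    intro x
    have : (((P : ℂ) - Q * I) / d * (x - p)).re
        = P * ((x - p) / d).re + Q * ((x - p) / d).im := by
      rw [div_mul_eq_mul_div, mul_div_assoc, mul_re]; simp
    rw [this]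
    simp only [a, b, hP, hQ]
    field_simp
    ring
  refine ⟨(P - Q * I) / d, 1 + ((P - Q * I) / d * p).re, ?_, {x | 0 < a x ∧ 0 < b x ∧ a x + b x < 1},
    ?_, ?_, ?_⟩
  · refine div_ne_zero (fun h0 => hP0.ne' ?_) hd0
    simpa using congrArg Complex.re h0
  · exact (isOpen_lt continuous_const ha).inter ((isOpen_lt continuous_const hb).inter
      (isOpen_lt (ha.add hb) continuous_const))
  · intro x hx
    rw [segment_eq_image'] at hx
    obtain ⟨s, hs, rfl⟩ := hx
    have : (C + s • (M - C) - p) / d = ((s + ε : ℝ) : ℂ) := by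
      rw [hp, ← hd]; simp only [real_smul]; push_cast; field_simp; ring
    have hsε : 0 < s + ε := by linarith [hs.1]
    simp only [a, b, this, mem_ofPred_eq, ofReal_re, ofReal_im, zero_div, add_zero, sub_zero]
    refine ⟨by positivity, by positivity, ?_⟩
    rw [← add_div, ← two_mul, mul_div_cancel_left₀ _ two_ne_zero, div_lt_one (by positivity)]
    linarith [hs.2]
  · rintro x ⟨h1, h2, h3⟩
    have := key (a x) (b x) h1 h2 h3
    rw [← hab x, hform x, mul_sub, sub_re, lt_sub_iff_add_lt] at this
    exact this

theorem re_mul_segment {ν C M : ℂ} (s : ℝ) :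
    (ν * (C + s * (M - C))).re = (ν * C).re + s * ((ν * M).re - (ν * C).re) := by
  have : ν * (C + s * (M - C)) = ν * C + s * (ν * M - ν * C) := by ring
  rw [this, add_re, re_ofReal_mul, sub_re]

theorem HalfPlaneNear.left {U X : Set ℂ} {C M ν : ℂ} {c : ℝ} (h : HalfPlaneNear U X C M ν c)
    (hC : C ∉ visSet U X) : (ν * C).re ≤ c := by
  obtain ⟨O, -, hs, hO⟩ := h
  exact not_lt.mp fun h1 => hC ((hO C (hs (left_mem_segment ℝ _ _))).mpr h1)

theorem HalfPlaneNear.right {U X : Set ℂ} {C M ν : ℂ} {c : ℝ} (h : HalfPlaneNear U X C M ν c)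
    (hM : M ∈ visSet U X) : c < (ν * M).re := by
  obtain ⟨O, -, hs, hO⟩ := h
  exact (hO M (hs (right_mem_segment ℝ _ _))).mp hM

/-- The point of the segment `C M` on the line `re (ν * x) = c`. -/
noncomputable def linePoint (ν : ℂ) (c : ℝ) (C M : ℂ) : ℂ :=
  C + ((c - (ν * C).re) / ((ν * M).re - (ν * C).re) : ℝ) * (M - C)

theorem linePoint_mem {ν C M : ℂ} {c : ℝ} (h1 : (ν * C).re ≤ c) (h2 : c < (ν * M).re) :
    linePoint ν c C M ∈ segment ℝ C M := by
  have : 0 < (ν * M).re - (ν * C).re := by linarith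
  exact mem_segment_of_smul (div_nonneg (by linarith) this.le) ((div_le_one this).mpr (by linarith))

theorem re_linePoint {ν C M : ℂ} {c : ℝ} (h1 : (ν * C).re ≤ c) (h2 : c < (ν * M).re) :
    (ν * linePoint ν c C M).re = c := by
  have : (ν * M).re - (ν * C).re ≠ 0 := by linarith
  rw [linePoint, re_mul_segment, div_mul_cancel₀ _ this]; ring

/-- Two local descriptions of `visSet U X` along a segment that enters it agree up to scaling. -/
theorem HalfPlaneNear.unique {U X : Set ℂ} {C M ν ν₀ : ℂ} {c c₀ : ℝ}
    (hC : C ∉ visSet U X) (hM : M ∈ visSet U X) (hν₀ : ν₀ ≠ 0)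
    (h : HalfPlaneNear U X C M ν c) (h₀ : HalfPlaneNear U X C M ν₀ c₀) :
    ∃ k : ℝ, 0 < k ∧ ν = k * ν₀ ∧ c = k * c₀ := by
  have l1 := h.left hC
  have l2 := h.right hM
  have m1 := h₀.left hC
  have m2 := h₀.right hM
  obtain ⟨O, hO, hs, hOW⟩ := h
  obtain ⟨O₀, hO₀, hs₀, hOW₀⟩ := h₀
  have heq : ∀ x ∈ O ∩ O₀, (c < (ν * x).re ↔ c₀ < (ν₀ * x).re) :=
    fun x hx => (hOW x hx.1).symm.trans (hOW₀ x hx.2)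
  have hseg : ∀ x ∈ segment ℝ C M, x ∈ O ∩ O₀ := fun x hx => ⟨hs hx, hs₀ hx⟩
  -- the two lines cross the segment at the same point
  have hsame : (ν₀ * linePoint ν c C M).re = c₀ := by
    set D := (ν * M).re - (ν * C).re with hD
    set D₀ := (ν₀ * M).re - (ν₀ * C).re with hD₀
    have hDp : 0 < D := by linarith
    have hD₀p : 0 < D₀ := by linarith
    have hiff : ∀ s : ℝ, 0 ≤ s → s ≤ 1 → (c < (ν * C).re + s * D ↔ c₀ < (ν₀ * C).re + s * D₀) := by
      intro s h0 h1
      have := heq _ (hseg _ (mem_segment_of_smul h0 h1))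
      rwa [re_mul_segment, re_mul_segment] at this
    set s := (c - (ν * C).re) / D with hsd
    set s₀ := (c₀ - (ν₀ * C).re) / D₀ with hsd₀
    have e1 : s * D = c - (ν * C).re := div_mul_cancel₀ _ hDp.ne'
    have e2 : s₀ * D₀ = c₀ - (ν₀ * C).re := div_mul_cancel₀ _ hD₀p.ne'
    have hs0 : 0 ≤ s := div_nonneg (by linarith) hDp.le
    have hs1 : s < 1 := (div_lt_one hDp).mpr (by linarith)
    have hs₀0 : 0 ≤ s₀ := div_nonneg (by linarith) hD₀p.le
    have hs₀1 : s₀ < 1 := (div_lt_one hD₀p).mpr (by linarith)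
    have hss : s = s₀ := by
      rcases lt_trichotomy s s₀ with hlt | heq | hgt
      · have := (hiff s₀ hs₀0 hs₀1.le).mp (by nlinarith)
        linarith
      · exact heq
      · have := (hiff s hs0 hs1.le).mpr (by nlinarith)
        linarith
    rw [linePoint, re_mul_segment, ← hD, ← hD₀, ← hsd, hss, e2]; ring
  have hline := re_linePoint l1 l2
  set e := linePoint ν c C M with he
  have heO := hseg e (linePoint_mem l1 l2)
  obtain ⟨ε, hε, hball⟩ := Metric.isOpen_iff.mp (hO.inter hO₀) e heO
  have hall : ∀ y : ℂ, (0 < (ν * y).re ↔ 0 < (ν₀ * y).re) := by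
    intro y
    by_cases hy : y = 0
    · simp [hy]
    have hyn : 0 < ‖y‖ := norm_pos_iff.mpr hy
    set k := ε / (2 * ‖y‖) with hk
    have hk0 : 0 < k := by positivity
    have := heq (e + k * y) (hball (by
      rw [Metric.mem_ball, dist_eq_norm, add_sub_cancel_left, norm_mul, norm_real,
        Real.norm_of_nonneg hk0.le, hk]
      field_simp; linarith))
    rw [mul_add, mul_add, add_re, add_re, hline, hsame, mul_left_comm, mul_left_comm ν₀,
      re_ofReal_mul, re_ofReal_mul, lt_add_iff_pos_right, lt_add_iff_pos_right,
      mul_pos_iff_of_pos_left hk0, mul_pos_iff_of_pos_left hk0] at this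
    exact this
  -- Multiplication by `ν / ν₀` preserves the open right half-plane, so the ratio is a positive
  -- real.
  have hρ : ∀ y : ℂ, (0 < (ν / ν₀ * y).re ↔ 0 < y.re) := by
    intro y
    have := hall (y / ν₀)
    rwa [mul_div_cancel₀ _ hν₀, mul_div_assoc', ← div_mul_eq_mul_div] at this
  have hre : 0 < (ν / ν₀).re := by simpa using (hρ 1).mpr (by simp)
  have him : (ν / ν₀).im = 0 := by
    have i1 := (hρ I).not.mpr (by simp)
    have i2 := (hρ (-I)).not.mpr (by simp)
    simp at i1 i2
    linarith
  have hν : ν = ((ν / ν₀).re : ℝ) * ν₀ := by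
    have : ν / ν₀ = ((ν / ν₀).re : ℝ) := Complex.ext rfl (by simpa using him)
    rw [← this, div_mul_cancel₀ _ hν₀]
  refine ⟨(ν / ν₀).re, hre, hν, ?_⟩
  rw [← hline, ← hsame, ← re_ofReal_mul, ← mul_assoc, ← hν]

theorem HalfPlaneNear.scale {U X : Set ℂ} {C M ν : ℂ} {c k : ℝ} (hk : 0 < k)
    (h : HalfPlaneNear U X C M ν c) : HalfPlaneNear U X C M (k * ν) (k * c) := by
  obtain ⟨O, hO, hs, hOW⟩ := h
  refine ⟨O, hO, hs, fun x hx => ?_⟩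
  rw [hOW x hx, mul_assoc, re_ofReal_mul, mul_lt_mul_iff_right₀ hk]

theorem eventually_segment_subset {O : Set ℂ} (hO : IsOpen O) {C M : ℂ}
    (h : segment ℝ C M ⊆ O) : ∀ᶠ q : ℂ × ℂ in 𝓝 (C, M), segment ℝ q.1 q.2 ⊆ O :=
  (isOpen_sees hO).mem_nhds h

/-- Local descriptions of `visSet U X` along entering segments do not change locally. -/
theorem VisSetting.halfPlaneNear_eventually {U X : Set ℂ} (h : VisSetting U X) (ν : ℂ) (c : ℝ)
    {C M : ℂ} (hC : C ∉ visSet U X) (hM : M ∈ visSet U X) (hCM : Sees U C M) :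
    ∀ᶠ q : ℂ × ℂ in 𝓝 (C, M), q.1 ∉ visSet U X → q.2 ∈ visSet U X →
      (HalfPlaneNear U X q.1 q.2 ν c ↔ HalfPlaneNear U X C M ν c) := by
  obtain ⟨ν₀, c₀, hν₀, O, hO, hs, hOW⟩ := h.exists_halfPlane hC hM hCM
  filter_upwards [eventually_segment_subset hO hs] with q hq hq1 hq2
  have a0 : HalfPlaneNear U X C M ν₀ c₀ := ⟨O, hO, hs, hOW⟩
  have aq : HalfPlaneNear U X q.1 q.2 ν₀ c₀ := ⟨O, hO, hq, hOW⟩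
  constructor
  · intro hh
    obtain ⟨k, hk, rfl, rfl⟩ := hh.unique hq1 hq2 hν₀ aq
    exact a0.scale hk
  · intro hh
    obtain ⟨k, hk, rfl, rfl⟩ := hh.unique hC hM hν₀ a0
    exact aq.scale hk

theorem iff_of_locally_iff {S : Set ℂ} (hS : IsPreconnected S) {R : ℂ → Prop}
    (h : ∀ x ∈ S, ∀ᶠ y in 𝓝[S] x, (R y ↔ R x)) {x y : ℂ} (hx : x ∈ S) (hy : y ∈ S) :
    R x ↔ R y := by
  classical
  have hc : ContinuousOn (fun x => decide (R x)) S := by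
    intro x hx
    refine tendsto_nhds_of_eventually_eq ?_
    filter_upwards [h x hx] with y hy
    simp [hy]
  have := hS.constant hc hx hy
  simpa using this

/-- Locally constant predicates on entering segments are constant along a segment that sees, but
does not meet, `visSet U X`. -/
theorem VisSetting.entering_iff {U X : Set ℂ} (h : VisSetting U X) {Q : ℂ → ℂ → Prop}
    (hQ : ∀ C M, C ∉ visSet U X → M ∈ visSet U X → Sees U C M →
      ∀ᶠ q : ℂ × ℂ in 𝓝 (C, M), q.1 ∉ visSet U X → q.2 ∈ visSet U X → (Q q.1 q.2 ↔ Q C M))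
    {A B : ℂ} (hout : ∀ C ∈ segment ℝ A B, C ∉ visSet U X)
    (hsee : ∀ C ∈ segment ℝ A B, ∃ M ∈ visSet U X, Sees U C M) {MA MB : ℂ}
    (hMA : MA ∈ visSet U X) (hMB : MB ∈ visSet U X) (hA : Sees U A MA) (hB : Sees U B MB) :
    Q A MA ↔ Q B MB := by
  -- For fixed `C`, any two targets are connected inside the seen part of `visSet U X` through the
  -- meeting point of `RayMeets`. Only `C` then remains to be moved along the segment.
  have fiber : ∀ C, C ∉ visSet U X → ∀ M₁ ∈ visSet U X, ∀ M₂ ∈ visSet U X, Sees U C M₁ →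
      Sees U C M₂ → (Q C M₁ ↔ Q C M₂) := by
    intro C hC M₁ h₁ M₂ h₂ hC₁ hC₂
    have along : ∀ M N, (∀ p ∈ segment ℝ M N, Sees U C p ∧ p ∈ visSet U X) →
        (Q C M ↔ Q C N) := by
      intro M N hMN
      refine iff_of_locally_iff (R := Q C) (isPreconnected_segment M N) ?_
        (left_mem_segment ℝ _ _) (right_mem_segment ℝ _ _)
      intro p hp
      obtain ⟨hCp, hpW⟩ := hMN p hp
      have hcont : Continuous fun y : ℂ => (C, y) := by fun_prop
      filter_upwards [nhdsWithin_le_nhds (hcont.continuousAt.eventually (hQ C p hC hpW hCp)),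
        self_mem_nhdsWithin] with y hy hyS
      exact hy hC (hMN y hyS).2
    have main : ∀ u : ℂ, ∀ M₁ ∈ visSet U X, ∀ M₂ ∈ visSet U X, Sees U C M₁ →
        Sees U C M₂ → RayMeets U X C u M₁ M₂ → (Q C M₁ ↔ Q C M₂) := by
      rintro u M₁ h₁ M₂ h₂ hC₁ hC₂ ⟨l, τ, t, hl, -, -, -, -, hs⟩
      rw [along _ _ hs]
      refine along _ _ fun p hp => ?_
      obtain ⟨hCN, hNW⟩ := hs _ (right_mem_segment ℝ _ _)
      have hsee1 : Sees U M₁ (C + l * (M₁ - C)) := by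
        rcases le_total l 1 with hle | hle
        · exact hC₁.mono_seg (right_mem_segment ℝ _ _) (mem_segment_of_smul hl.le hle)
        · refine hCN.mono_seg ?_ (right_mem_segment ℝ _ _)
          have := mem_segment_of_smul (A := C) (p := C + l * (M₁ - C)) (θ := 1 / l) (by positivity)
            ((div_le_one hl).mpr hle)
          convert this using 1
          have : (l : ℂ) ≠ 0 := by exact_mod_cast hl.ne'
          push_cast; field_simp; ring
      exact ⟨Sees.to_segment h.log hC₁ hCN hsee1 hp, h.segment_subset h₁ hNW hsee1 hp⟩
    obtain ⟨u, σ, hu, hF⟩ := exists_frame h.isOpen h.bdd h.log h.conn h.sub hC h₁ hC₁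
    rcases rayMeets_or hu hF h₁ h₂ hC₁ hC₂ with hR | hR
    · exact main u M₁ h₁ M₂ h₂ hC₁ hC₂ hR
    · exact (main u M₂ h₂ M₁ h₁ hC₂ hC₁ hR).symm
  have hR : ∀ C, C ∉ visSet U X → ∀ M ∈ visSet U X, Sees U C M →
      ((∃ M ∈ visSet U X, Sees U C M ∧ Q C M) ↔ Q C M) := by
    intro C hC M hM hCM
    constructor
    · rintro ⟨M', hM', hCM', hq⟩
      exact (fiber C hC M' hM' M hM hCM' hCM).mp hq
    · exact fun hq => ⟨M, hM, hCM, hq⟩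
  have hAs := left_mem_segment ℝ A B
  have hBs := right_mem_segment ℝ A B
  rw [← hR A (hout A hAs) MA hMA hA, ← hR B (hout B hBs) MB hMB hB]
  refine iff_of_locally_iff (R := fun C => ∃ M ∈ visSet U X, Sees U C M ∧ Q C M)
    (isPreconnected_segment A B) ?_ hAs hBs
  intro C hC
  obtain ⟨M, hM, hCM⟩ := hsee C hC
  have hcont : Continuous fun y : ℂ => (y, M) := by fun_prop
  filter_upwards [nhdsWithin_le_nhds (hcont.continuousAt.eventually (hQ C M (hout C hC) hM hCM)),
    nhdsWithin_le_nhds (hcont.continuousAt.eventually ((isOpen_sees h.isOpen).mem_nhds hCM)),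
    self_mem_nhdsWithin] with y hy hyM hyS
  rw [hR y (hout y hyS) M hM hyM, hR C (hout C hC) M hM hCM]
  exact hy (hout y hyS) hM

/-! ### Areas of triangles, quadrilaterals and strips. -/

/-- The planar cross product. -/
noncomputable def cross (v w : ℂ) : ℝ := v.re * w.im - v.im * w.re

/-- The real linear map with rows given by four real coefficients. -/
noncomputable def planeMap (a b c d : ℝ) : ℂ →ₗ[ℝ] ℂ where
  toFun z := ⟨a * z.re + b * z.im, c * z.re + d * z.im⟩
  map_add' x y := by apply Complex.ext <;> simp <;> ring
  map_smul' r x := by apply Complex.ext <;> simp <;> ring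

theorem planeMap_apply (a b c d : ℝ) (z : ℂ) :
    planeMap a b c d z = ⟨a * z.re + b * z.im, c * z.re + d * z.im⟩ := rfl

theorem det_planeMap (a b c d : ℝ) : LinearMap.det (planeMap a b c d) = a * d - b * c := by
  rw [← LinearMap.det_toMatrix Complex.basisOneI, Matrix.det_fin_two]
  simp [LinearMap.toMatrix_apply, planeMap_apply]

theorem volume_rect (x₁ x₂ y₁ y₂ : ℝ) :
    volume {z : ℂ | (x₁ ≤ z.re ∧ z.re ≤ x₂) ∧ y₁ ≤ z.im ∧ z.im ≤ y₂}
      = ENNReal.ofReal (x₂ - x₁) * ENNReal.ofReal (y₂ - y₁) := by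
  have h : {z : ℂ | (x₁ ≤ z.re ∧ z.re ≤ x₂) ∧ y₁ ≤ z.im ∧ z.im ≤ y₂}
      = measurableEquivRealProd ⁻¹' (Icc x₁ x₂ ×ˢ Icc y₁ y₂) := by
    ext z; simp [measurableEquivRealProd_apply]; tauto
  rw [h, volume_preserving_equiv_real_prod.measure_preimage
    (measurableSet_Icc.prod measurableSet_Icc).nullMeasurableSet, Measure.volume_eq_prod,
    Measure.prod_prod, Real.volume_Icc, Real.volume_Icc]

theorem volume_planeMap_preimage_rect {a b c d : ℝ} (h : a * d - b * c ≠ 0) (x₁ x₂ y₁ y₂ : ℝ) :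
    volume {z : ℂ | (x₁ ≤ a * z.re + b * z.im ∧ a * z.re + b * z.im ≤ x₂) ∧
        y₁ ≤ c * z.re + d * z.im ∧ c * z.re + d * z.im ≤ y₂}
      = ENNReal.ofReal |(a * d - b * c)⁻¹| *
        (ENNReal.ofReal (x₂ - x₁) * ENNReal.ofReal (y₂ - y₁)) := by
  have := Measure.addHaar_preimage_linearMap (μ := (volume : Measure ℂ)) (f := planeMap a b c d)
    (by rwa [det_planeMap]) {z : ℂ | (x₁ ≤ z.re ∧ z.re ≤ x₂) ∧ y₁ ≤ z.im ∧ z.im ≤ y₂}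
  rw [det_planeMap, volume_rect] at this
  exact this

theorem volume_standard_triangle :
    volume {z : ℂ | (0 < z.re ∧ z.re < 1) ∧ 0 < z.im ∧ z.im < 1 - z.re} = ENNReal.ofReal (1 / 2) := by
  have h : {z : ℂ | (0 < z.re ∧ z.re < 1) ∧ 0 < z.im ∧ z.im < 1 - z.re}
      = measurableEquivRealProd ⁻¹' (regionBetween (fun _ => 0) (fun x => 1 - x) (Ioo 0 1)) := by
    ext z; simp [measurableEquivRealProd_apply, regionBetween]
  have hm : MeasurableSet (regionBetween (fun _ : ℝ => (0 : ℝ)) (fun x => 1 - x) (Ioo 0 1)) :=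
    measurableSet_regionBetween measurable_const (by fun_prop) measurableSet_Ioo
  rw [h, volume_preserving_equiv_real_prod.measure_preimage hm.nullMeasurableSet,
    Measure.volume_eq_prod, volume_regionBetween_eq_integral]
  · congr 1
    rw [← integral_Ioc_eq_integral_Ioo, ← intervalIntegral.integral_of_le zero_le_one]
    simp only [Pi.sub_apply, sub_zero]
    rw [intervalIntegral.integral_sub (by simp) (by simp), integral_id]
    norm_num
  · exact integrableOn_const (by simp)
  · exact (Continuous.integrableOn_Icc (by fun_prop)).mono_set Ioo_subset_Icc_self
  · exact measurableSet_Ioo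
  · intro x hx; simp [hx.2.le]

theorem volume_triangle_ge (p q r : ℂ) :
    ENNReal.ofReal (|cross (q - p) (r - p)| / 2) ≤ volume (convexHull ℝ ({p, q, r} : Set ℂ)) := by
  set T : Set ℂ := {z : ℂ | (0 < z.re ∧ z.re < 1) ∧ 0 < z.im ∧ z.im < 1 - z.re} with hT
  set v := q - p with hv
  set w := r - p with hw
  set L := planeMap v.re w.re v.im w.im with hL
  have hsub : (fun z => p + z) '' (L '' T) ⊆ convexHull ℝ ({p, q, r} : Set ℂ) := by
    rintro _ ⟨_, ⟨z, ⟨⟨h1, h2⟩, h3, h4⟩, rfl⟩, rfl⟩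
    have hc := convex_convexHull ℝ ({p, q, r} : Set ℂ)
    have hx := hc.sum_mem (t := Finset.univ) (w := ![1 - z.re - z.im, z.re, z.im])
      (z := ![p, q, r])
      (by intro i _; fin_cases i; exacts [(by simp; linarith), h1.le, h3.le])
      (by simp [Fin.sum_univ_three]; ring)
      (by intro i _; fin_cases i <;> exact subset_convexHull ℝ _ (by simp))
    simp only [Fin.sum_univ_three, Matrix.cons_val_zero, Matrix.cons_val_one, Matrix.cons_val] at hx
    convert hx using 1
    apply Complex.ext <;> simp [hL, planeMap_apply, hv, hw] <;> ring
  refine le_trans ?_ (measure_mono hsub)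
  rw [image_add_left, measure_preimage_add, Measure.addHaar_image_linearMap, det_planeMap,
    volume_standard_triangle, ← ENNReal.ofReal_mul (abs_nonneg _)]
  apply ENNReal.ofReal_le_ofReal
  have : cross v w = v.re * w.im - w.re * v.im := by unfold cross; ring
  rw [this]
  linarith

/-- A bound on the area of convex subsets bounds triangles of mutually visible points. -/
theorem abs_cross_le {U : Set ℂ} (hL : LogConnected U) {κ : ℝ} (hκ : 0 ≤ κ)
    (hK : ∀ K ⊆ U, Convex ℝ K → volume K ≤ ENNReal.ofReal κ) {p q r : ℂ} (hpq : Sees U p q)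
    (hqr : Sees U q r) (hrp : Sees U r p) : |cross (q - p) (r - p)| ≤ 2 * κ := by
  have h1 := (volume_triangle_ge p q r).trans
    (hK _ (Sees.convexHull_subset hL hpq hqr hrp) (convex_convexHull ℝ _))
  have := (ENNReal.ofReal_le_ofReal_iff hκ).mp h1
  linarith

/-- On a line the segment `a d` is covered by `a b` and `b d`, in whatever order the points lie. -/
theorem Sees.trans_of_line {U : Set ℂ} {ν a b d : ℂ} {c : ℝ} (hν : ν ≠ 0) (ha : (ν * a).re = c)
    (hb : (ν * b).re = c) (hd : (ν * d).re = c) (hab : Sees U a b) (hbd : Sees U b d) :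
    Sees U a d := by
  set φ : ℝ →ᵃ[ℝ] ℂ := AffineMap.lineMap (c / ν) ((c + I) / ν) with hφ
  have hpt : ∀ x, (ν * x).re = c → φ (ν * x).im = x := by
    intro x hx
    have hx' : ν * x = c + (ν * x).im * I := by
      rw [← hx]; exact (re_add_im _).symm
    have hφx : φ (ν * x).im = (c + (ν * x).im * I) / ν := by
      rw [hφ, AffineMap.lineMap_apply]
      simp only [vsub_eq_sub, vadd_eq_add, real_smul]
      field_simp
      ring
    rw [hφx, ← hx', mul_div_cancel_left₀ _ hν]
  have hseg : ∀ x y, (ν * x).re = c → (ν * y).re = c →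
      segment ℝ x y = φ '' uIcc (ν * x).im (ν * y).im := by
    intro x y hx hy
    rw [← segment_eq_uIcc, image_segment, hpt x hx, hpt y hy]
  unfold Sees at *
  rw [hseg _ _ ha hb] at hab
  rw [hseg _ _ hb hd] at hbd
  rw [hseg _ _ ha hd]
  exact (image_mono uIcc_subset_uIcc_union_uIcc).trans
    (by rw [image_union]; exact union_subset hab hbd)

/-- Two points `A`, `B` above a line, joined in `U` to points `A'`, `B'` of the line with all
consecutive pairs visible: the lower point `B` is close to the line `A A'`. -/
theorem abs_cross_quad_le {U : Set ℂ} (hL : LogConnected U) {κ : ℝ} (hκ : 0 ≤ κ)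
    (hK : ∀ K ⊆ U, Convex ℝ K → volume K ≤ ENNReal.ofReal κ) {A B A' B' ν : ℂ} {c : ℝ}
    (hν : ν ≠ 0) (hA' : (ν * A').re = c) (hB' : (ν * B').re = c) (hAB : (ν * A).re ≤ (ν * B).re)
    (hBc : (ν * B).re ≤ c) (hAA' : Sees U A A') (hA'B' : Sees U A' B') (hB'B : Sees U B' B)
    (hABs : Sees U A B) : |cross (A - A') (B - A')| ≤ 4 * κ := by
  have case1 : Sees U A' B → |cross (A - A') (B - A')| ≤ 4 * κ := fun h =>
    (abs_cross_le hL hκ hK hAA'.symm hABs h.symm).trans (by linarith)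
  set a := A - A' with ha
  set b := B - A' with hb
  set b' := B' - A' with hb'
  set yA := c - (ν * A).re with hyA
  set yB := c - (ν * B).re with hyB
  have fa : (ν * a).re = -yA := by rw [ha, mul_sub, sub_re, hA']; ring
  have fb : (ν * b).re = -yB := by rw [hb, mul_sub, sub_re, hA']; ring
  have fb' : (ν * b').re = 0 := by rw [hb', mul_sub, sub_re, hA', hB']; ring
  have hy0 : 0 ≤ yB := by linarith
  have hyBA : yB ≤ yA := by linarith
  have id : cross b b' * yA = cross a b' * yB := by
    have : cross b b' * (ν * a).re + cross b' a * (ν * b).re + cross a b * (ν * b').re = 0 := by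
      simp only [cross, mul_re]; ring
    rw [fa, fb, fb'] at this
    have h2 : cross b' a = -cross a b' := by simp only [cross]; ring
    rw [h2] at this
    linarith
  rcases hy0.eq_or_lt with h0 | hyBp
  · refine case1 (Sees.trans_of_line (c := c) hν hA' hB' (by linarith) hA'B' hB'B)
  have hyAp : 0 < yA := hyBp.trans_le hyBA
  set D := cross a b with hD
  set D' := cross a b' with hD'
  -- The signs of `D` and `D'` tell the sides of the line `A A'` on which `B` and `B'` lie. If the
  -- sides are opposite, `B B'` crosses `A A'` in a point `X`, and the triangles `X A B` and `X A'
  -- B'` are filled.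
  rcases lt_trichotomy (D * D') 0 with hneg | hzero | hpos
  · have hDD : D' - D ≠ 0 := fun h => by
      have : D' = D := by linarith
      rw [this] at hneg; nlinarith [sq_nonneg D]
    set η := D' / (D' - D) with hη
    have hη01 : 0 < η ∧ η < 1 := by
      rcases mul_neg_iff.mp hneg with ⟨h1, h2⟩ | ⟨h1, h2⟩
      · have h3 : D' - D < 0 := by linarith
        exact ⟨div_pos_of_neg_of_neg h2 h3, (div_lt_one_of_neg h3).mpr (by linarith)⟩
      · have h3 : 0 < D' - D := by linarith
        exact ⟨div_pos h2 h3, (div_lt_one h3).mpr (by linarith)⟩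
    have hηe : (1 - η) * D' + η * D = 0 := by rw [hη]; field_simp; ring
    -- `η` and `ξ` locate `X` on `B' B` and on `A' A`. Since `B` is no farther from the window line
    -- than `A`, one has `ξ ≤ η`.
    set ξ := η * yB / yA with hξ
    have hξ0 : 0 < ξ := div_pos (mul_pos hη01.1 hyBp) hyAp
    have hξη : ξ ≤ η := by
      rw [hξ, div_le_iff₀ hyAp]; exact mul_le_mul_of_nonneg_left hyBA hη01.1.le
    have hX : B' + η * (B - B') = A' + ξ * (A - A') := by
      have e1 : cross a (b' + η * (b - b') - ξ * a) = 0 := by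
        have : cross a (b' + η * (b - b') - ξ * a) = (1 - η) * D' + η * D := by
          simp only [hD, hD', cross, sub_im, add_im, im_ofReal_mul, sub_re, add_re, re_ofReal_mul]
          ring
        rw [this, hηe]
      have e2 : (ν * (b' + η * (b - b') - ξ * a)).re = 0 := by
        have : ν * (b' + η * (b - b') - ξ * a)
            = ν * b' + η * (ν * b - ν * b') - ξ * (ν * a) := by ring
        rw [this, sub_re, add_re, re_ofReal_mul, re_ofReal_mul, sub_re, fa, fb, fb', hξ]
        field_simp; ring
      set x := b' + η * (b - b') - ξ * a with hx
      have hfa : (ν * a).re ≠ 0 := by rw [fa]; linarith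
      have hx0 : x = 0 := by
        simp only [cross] at e1
        rw [mul_re] at e2 hfa
        have r1 : (ν.re * a.re - ν.im * a.im) * x.re = 0 := by
          linear_combination a.re * e2 + ν.im * e1
        have r2 : (ν.re * a.re - ν.im * a.im) * x.im = 0 := by
          linear_combination a.im * e2 + ν.re * e1
        exact Complex.ext (by simpa [hfa] using r1) (by simpa [hfa] using r2)
      have : B' + η * (B - B') - (A' + ξ * (A - A')) = x := by
        rw [hx, ha, hb, hb']; ring
      rw [hx0] at this
      exact sub_eq_zero.mp this
    set X := A' + ξ * (A - A') with hXd
    have hX1 : X ∈ segment ℝ A' A := mem_segment_of_smul hξ0.le (by linarith)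
    have hX2 : X ∈ segment ℝ B' B := by
      rw [← hX]; exact mem_segment_of_smul hη01.1.le hη01.2.le
    have t1 := abs_cross_le hL hκ hK
      (hAA'.symm.mono_seg hX1 (right_mem_segment ℝ _ _)) hABs
      (hB'B.mono_seg (right_mem_segment ℝ _ _) hX2)
    have t2 := abs_cross_le hL hκ hK
      (hAA'.symm.mono_seg (left_mem_segment ℝ _ _) hX1)
      (hB'B.mono_seg hX2 (left_mem_segment ℝ _ _)) hA'B'.symm
    have c1 : cross (A - X) (B - X) = (1 - ξ) * D := by
      have e1 : A - X = ((1 - ξ : ℝ) : ℂ) * a := by rw [hXd, ha]; push_cast; ring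
      have e2 : B - X = b - ξ * a := by rw [hXd, ha, hb]; ring
      rw [e1, e2]
      simp only [hD, cross, sub_im, im_ofReal_mul, sub_re, re_ofReal_mul]; ring
    have c2 : cross (X - A') (B' - A') = ξ * D' := by
      have e1 : X - A' = (ξ : ℂ) * a := by rw [hXd, ha]; ring
      rw [e1, ← hb']
      simp only [hD', cross, im_ofReal_mul, re_ofReal_mul]; ring
    rw [c1, abs_mul, abs_of_nonneg (by linarith : 0 ≤ 1 - ξ)] at t1
    rw [c2, abs_mul, abs_of_pos hξ0] at t2
    have t3 : (1 - η) * |D'| = η * |D| := by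
      have := congrArg abs (show (1 - η) * D' = -(η * D) by linarith)
      rwa [abs_neg, abs_mul, abs_mul, abs_of_pos hη01.1, abs_of_pos (sub_pos.mpr hη01.2)] at this
    have hD0 := abs_nonneg D
    have t4 : ξ * ξ * |D| ≤ 2 * κ * (1 - ξ) := by
      calc ξ * ξ * |D| ≤ ξ * (η * |D|) := by
            rw [mul_assoc]
            exact mul_le_mul_of_nonneg_left (mul_le_mul_of_nonneg_right hξη hD0) hξ0.le
        _ = (1 - η) * (ξ * |D'|) := by rw [← t3]; ring
        _ ≤ (1 - η) * (2 * κ) := mul_le_mul_of_nonneg_left t2 (by linarith)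
        _ ≤ 2 * κ * (1 - ξ) := by
            rw [mul_comm]; exact mul_le_mul_of_nonneg_left (by linarith) (by linarith)
    -- For `ξ ≤ 1/2` the triangle `X A B` gives `|D| ≤ 2κ / (1 - ξ) ≤ 4κ`; otherwise `t4` gives `|D|
    -- / 4 ≤ ξ² |D| ≤ κ`.
    rcases le_total ξ (1 / 2) with h | h
    · nlinarith
    · have h5 : 1 / 4 ≤ ξ * ξ := by nlinarith
      have h6 : 2 * κ * (1 - ξ) ≤ κ := by nlinarith
      nlinarith
  · rcases mul_eq_zero.mp hzero with h | h
    · rw [h, abs_zero]; linarith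
    · have hb0 : b' = 0 := by
        rw [hD'] at h
        simp only [cross] at h
        have hfa : (ν * a).re ≠ 0 := by rw [fa]; linarith
        rw [mul_re] at fb' hfa
        have r1 : (ν.re * a.re - ν.im * a.im) * b'.re = 0 := by
          linear_combination a.re * fb' + ν.im * h
        have r2 : (ν.re * a.re - ν.im * a.im) * b'.im = 0 := by
          linear_combination a.im * fb' + ν.re * h
        exact Complex.ext (by simpa [hfa] using r1) (by simpa [hfa] using r2)
      have : B' = A' := sub_eq_zero.mp hb0
      exact case1 (this ▸ hB'B)
  -- With `B` and `B'` on the same side of `A A'`, the points `A` and `B'` are on opposite sides of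
  -- `A' B`, which is therefore a visible diagonal.
  · refine case1 (Sees.diagonal hL hAA'.symm hABs hB'B.symm hA'B'.symm ?_)
    rw [← ha, ← hb, ← hb']
    have e1 : (a * (starRingEnd ℂ) b).im = -D := by
      simp only [hD, cross, mul_im, conj_re, conj_im]; ring
    have e2 : (b' * (starRingEnd ℂ) b).im = cross b b' := by
      simp only [cross, mul_im, conj_re, conj_im]; ring
    have e3 : cross b b' = D' * yB / yA := by
      rw [eq_div_iff hyAp.ne', id]
    rw [e1, e2, e3]
    have : 0 < D * D' * (yB / yA) := mul_pos hpos (div_pos hyBp hyAp)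
    have e4 : -D * (D' * yB / yA) = -(D * D' * (yB / yA)) := by ring
    linarith

theorem volume_vertical_strip {ν : ℂ} (hν : ν ≠ 0) (c : ℝ) :
    volume {z : ℂ | (ν * z).re = c} = 0 := by
  have hdet : ν.re * ν.re - (-ν.im) * ν.im ≠ 0 := by
    have := normSq_pos.mpr hν
    rw [normSq_apply] at this
    linarith
  have hn : ∀ n : ℕ, volume {z : ℂ | (c ≤ ν.re * z.re + -ν.im * z.im ∧
      ν.re * z.re + -ν.im * z.im ≤ c) ∧ -(n : ℝ) ≤ ν.im * z.re + ν.re * z.im ∧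
      ν.im * z.re + ν.re * z.im ≤ n} = 0 := by
    intro n
    rw [volume_planeMap_preimage_rect hdet]
    simp
  refine measure_mono_null ?_ (measure_iUnion_null hn)
  intro z hz
  obtain ⟨n, hn⟩ := exists_nat_ge |ν.im * z.re + ν.re * z.im|
  rw [mem_iUnion]
  have hz' : ν.re * z.re + -ν.im * z.im = c := by
    rw [← (show (ν * z).re = c from hz), mul_re]; ring
  exact ⟨n, ⟨hz'.ge, hz'.le⟩, abs_le.mp hn⟩

/-- The region to which `abs_cross_quad_le` confines the lower point has area at most `8 κ`. -/
theorem volume_lower_region_le {A A' ν : ℂ} {c κ : ℝ} (hν : ν ≠ 0)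
    (hA' : (ν * A').re = c) (hA : (ν * A).re ≤ c) :
    volume {B : ℂ | ((ν * A).re ≤ (ν * B).re ∧ (ν * B).re ≤ c) ∧
      |cross (A - A') (B - A')| ≤ 4 * κ} ≤ ENNReal.ofReal (8 * κ) := by
  rcases hA.eq_or_lt with heq | hlt
  · refine (measure_mono_null ?_ (volume_vertical_strip hν c)).le.trans zero_le
    rintro B ⟨⟨h1, h2⟩, -⟩
    exact le_antisymm h2 (heq ▸ h1)
  · set a := A - A' with ha
    have hy : (ν * a).re = (ν * A).re - c := by rw [ha, mul_sub, sub_re, hA']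
    have hdet : ν.re * a.re - (-ν.im) * (-a.im) = (ν * A).re - c := by
      rw [← hy, mul_re]; ring
    have hdet0 : ν.re * a.re - (-ν.im) * (-a.im) ≠ 0 := by rw [hdet]; linarith
    set k := cross a A' with hk
    -- A parallelogram cut out by two linear conditions, of widths `c - (ν * A).re` and `8 κ`. The
    -- first width is also the absolute determinant and cancels.
    have := volume_planeMap_preimage_rect hdet0 ((ν * A).re) c (k - 4 * κ) (k + 4 * κ)
    refine (measure_mono ?_).trans (this.le.trans ?_)
    · rintro B ⟨⟨h1, h2⟩, h3⟩
      have e1 : ν.re * B.re + -ν.im * B.im = (ν * B).re := by rw [mul_re]; ring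
      have e2 : -a.im * B.re + a.re * B.im = cross a (B - A') + k := by
        rw [hk]; simp only [cross, sub_re, sub_im]; ring
      rw [abs_le] at h3
      refine ⟨by rw [e1]; exact ⟨h1, h2⟩, ?_⟩
      rw [e2]
      constructor <;> linarith [h3.1, h3.2]
    · rw [hdet, ← ENNReal.ofReal_mul (by linarith), ← ENNReal.ofReal_mul (abs_nonneg _)]
      apply ENNReal.ofReal_le_ofReal
      rw [abs_inv, abs_of_neg (by linarith)]
      have : 0 < c - (ν * A).re := by linarith
      rw [neg_sub, ← mul_assoc, inv_mul_cancel₀ this.ne', one_mul]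
      linarith

/-- The lower points seen from `A` in a region seen from `O`. -/
theorem volume_star_region_le {A O : ℂ} {κ : ℝ} :
    volume {B : ℂ | ‖B - O‖ ≤ ‖A - O‖ ∧ |cross (A - O) (B - O)| ≤ 2 * κ}
      ≤ ENNReal.ofReal (8 * κ) := by
  set a := A - O with ha
  by_cases h0 : a = 0
  · refine (measure_mono_null ?_ (measure_singleton O)).le.trans zero_le
    rintro B ⟨h1, -⟩
    rw [h0, norm_zero] at h1
    exact sub_eq_zero.mp (norm_le_zero_iff.mp h1)
  · have hN : 0 < normSq a := normSq_pos.mpr h0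
    have hdet : a.re * a.re - a.im * (-a.im) = normSq a := by rw [normSq_apply]; ring
    set k := cross a O with hk
    set j := a.re * O.re + a.im * O.im with hj
    -- The disc is enlarged to the strip where the inner product of `a` and `B - O` is at most
    -- `|a|²` in absolute value; the resulting rectangle has area `2|a|² · 4κ / |a|²`.
    have := volume_planeMap_preimage_rect (a := a.re) (b := a.im) (c := -a.im) (d := a.re)
      (by rw [hdet]; exact hN.ne') (j - normSq a) (j + normSq a) (k - 2 * κ) (k + 2 * κ)
    refine (measure_mono ?_).trans (this.le.trans ?_)
    · rintro B ⟨h1, h3⟩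
      have e1 : a.re * B.re + a.im * B.im = ((starRingEnd ℂ) a * (B - O)).re + j := by
        rw [hj, mul_re]; simp; ring
      have e2 : -a.im * B.re + a.re * B.im = cross a (B - O) + k := by
        rw [hk]; simp only [cross, sub_re, sub_im]; ring
      have h4 : |((starRingEnd ℂ) a * (B - O)).re| ≤ normSq a := by
        refine (abs_re_le_norm _).trans ?_
        rw [norm_mul, norm_conj, normSq_eq_norm_sq, sq]
        exact mul_le_mul_of_nonneg_left h1 (norm_nonneg _)
      rw [abs_le] at h3 h4
      refine ⟨?_, ?_⟩
      · rw [e1]; constructor <;> linarith [h4.1, h4.2]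
      · rw [e2]; constructor <;> linarith [h3.1, h3.2]
    · rw [hdet, ← ENNReal.ofReal_mul (by linarith), ← ENNReal.ofReal_mul (abs_nonneg _)]
      apply ENNReal.ofReal_le_ofReal
      rw [abs_of_pos (inv_pos.mpr hN)]
      apply le_of_eq
      field_simp
      ring

/-- Two points with the segment between them outside `visSet U X` but seeing it see it through the
same window. -/
theorem VisSetting.common_window {U X : Set ℂ} (h : VisSetting U X) {A B MA MB ν : ℂ} {c : ℝ}
    (hν : ν ≠ 0) (hout : ∀ C ∈ segment ℝ A B, C ∉ visSet U X)
    (hsee : ∀ C ∈ segment ℝ A B, ∃ M ∈ visSet U X, Sees U C M)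
    (hMA : MA ∈ visSet U X) (hMB : MB ∈ visSet U X) (hA : Sees U A MA) (hB : Sees U B MB)
    (hw : HalfPlaneNear U X A MA ν c) :
    HalfPlaneNear U X B MB ν c ∧ Sees U (linePoint ν c A MA) (linePoint ν c B MB) := by
  have hAW := hout A (left_mem_segment ℝ _ _)
  have l1 := hw.left hAW
  have l2 := hw.right hMA
  have hA'U : linePoint ν c A MA ∈ U := hA (linePoint_mem l1 l2)
  have hA'c := re_linePoint l1 l2
  set A' := linePoint ν c A MA with hA'
  -- The window description and visibility from `A'` along the window line are continued together
  -- from `A` to `B`. The latter is locally constant because visibility along a line is transitive.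
  let Q : ℂ → ℂ → Prop := fun C M => HalfPlaneNear U X C M ν c ∧ Sees U A' (linePoint ν c C M)
  have hQ : ∀ C M, C ∉ visSet U X → M ∈ visSet U X → Sees U C M →
      ∀ᶠ q : ℂ × ℂ in 𝓝 (C, M), q.1 ∉ visSet U X → q.2 ∈ visSet U X → (Q q.1 q.2 ↔ Q C M) := by
    intro C M hC hM hCM
    have hev := h.halfPlaneNear_eventually ν c hC hM hCM
    by_cases hCMw : HalfPlaneNear U X C M ν c
    · have m1 := hCMw.left hC
      have m2 := hCMw.right hM
      have hcont : ContinuousAt (fun q : ℂ × ℂ => linePoint ν c q.1 q.2) (C, M) := by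
        unfold linePoint
        have hne : (ν * M).re - (ν * C).re ≠ 0 := by linarith
        have : ContinuousAt (fun q : ℂ × ℂ => (c - (ν * q.1).re) / ((ν * q.2).re - (ν * q.1).re))
            (C, M) := by
          refine ContinuousAt.div ?_ ?_ hne <;> exact Continuous.continuousAt (by fun_prop)
        exact continuousAt_fst.add ((continuous_ofReal.continuousAt.comp this).mul
          (Continuous.continuousAt (by fun_prop)))
      have hEU := hCM (linePoint_mem m1 m2)
      have hnear : ∀ᶠ q : ℂ × ℂ in 𝓝 (C, M),
          Sees U (linePoint ν c C M) (linePoint ν c q.1 q.2) := by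
        refine hcont.eventually (p := fun x => Sees U (linePoint ν c C M) x) ?_
        have hc : Continuous fun x : ℂ => (linePoint ν c C M, x) := by fun_prop
        exact hc.continuousAt.eventually ((isOpen_sees h.isOpen).mem_nhds (Sees.refl hEU))
      filter_upwards [hev, hnear] with q hq hqs hq1 hq2
      have hqw := (hq hq1 hq2).mpr hCMw
      have ec := re_linePoint m1 m2
      have eq := re_linePoint (hqw.left hq1) (hqw.right hq2)
      constructor
      · rintro ⟨-, hs⟩
        exact ⟨hCMw, Sees.trans_of_line hν hA'c eq ec hs hqs.symm⟩
      · rintro ⟨-, hs⟩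
        exact ⟨hqw, Sees.trans_of_line hν hA'c ec eq hs hqs⟩
    · filter_upwards [hev] with q hq hq1 hq2
      exact ⟨fun hh => absurd ((hq hq1 hq2).mp hh.1) hCMw, fun hh => absurd hh.1 hCMw⟩
  exact (h.entering_iff hQ hout hsee hMA hMB hA hB).mp ⟨hw, Sees.refl hA'U⟩

/-! ### Levels by the number of segments from a base point. -/

/-- The points reached from `O` by a path in `U` made of at most `k` segments. -/
def level (U : Set ℂ) (O : ℂ) : ℕ → Set ℂ
  | 0 => {O}
  | k + 1 => visSet U (level U O k)

theorem level_subset {U : Set ℂ} {O : ℂ} (hO : O ∈ U) : ∀ k, level U O k ⊆ U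
  | 0 => by simpa [level] using hO
  | k + 1 => visSet_subset U _

theorem subset_visSet {U X : Set ℂ} (hX : X ⊆ U) : X ⊆ visSet U X :=
  fun x hx => ⟨x, hx, Sees.refl (hX hx)⟩

theorem level_mono {U : Set ℂ} {O : ℂ} (hO : O ∈ U) : Monotone (level U O) :=
  monotone_nat_of_le_succ fun k => subset_visSet (level_subset hO k)

theorem isPathConnected_visSet {U X : Set ℂ} (hXU : X ⊆ U) (hX : IsPathConnected X) :
    IsPathConnected (visSet U X) := by
  obtain ⟨o, ho, hX⟩ := hX
  refine ⟨o, subset_visSet hXU ho, ?_⟩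
  rintro y ⟨x, hx, hs⟩
  refine ((hX hx).mono (subset_visSet hXU)).trans ?_
  refine JoinedIn.of_segment_subset fun p hp => ⟨x, hx, ?_⟩
  rw [segment_symm] at hp
  exact hs.mono_seg hp (right_mem_segment ℝ _ _)

theorem isPathConnected_level {U : Set ℂ} {O : ℂ} (hO : O ∈ U) :
    ∀ k, IsPathConnected (level U O k)
  | 0 => isPathConnected_singleton O
  | k + 1 => isPathConnected_visSet (level_subset hO k) (isPathConnected_level hO k)

/-- Being on some level is a locally constant property, because nearby points of `U` see each other.
-/
theorem exists_level {U : Set ℂ} (hU : IsOpen U) (hc : IsPreconnected U) {O x : ℂ} (hO : O ∈ U)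
    (hx : x ∈ U) : ∃ k, x ∈ level U O k := by
  refine (iff_of_locally_iff (R := fun y => ∃ k, y ∈ level U O k) hc ?_ hO hx).mp ⟨0, rfl⟩
  intro y hy
  have hcont : Continuous fun z : ℂ => (y, z) := by fun_prop
  have : ∀ᶠ z in 𝓝 y, Sees U y z :=
    hcont.continuousAt.eventually ((isOpen_sees hU).mem_nhds (Sees.refl hy))
  filter_upwards [nhdsWithin_le_nhds this] with z hz
  exact ⟨fun ⟨k, hk⟩ => ⟨k + 1, z, hk, hz⟩, fun ⟨k, hk⟩ => ⟨k + 1, y, hk, hz.symm⟩⟩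

/-- A planar domain in which branches of logarithms about outside points exist, with a bound on the
areas of its convex subsets. -/
structure Domain (U : Set ℂ) (κ : ℝ) : Prop where
  isOpen : IsOpen U
  bdd : Bornology.IsBounded U
  log : LogConnected U
  conn : IsPreconnected U
  nonneg : 0 ≤ κ
  convex_le : ∀ K ⊆ U, Convex ℝ K → volume K ≤ ENNReal.ofReal κ

theorem Domain.visSetting {U : Set ℂ} {κ : ℝ} (h : Domain U κ) {O : ℂ} (hO : O ∈ U) (k : ℕ) :
    VisSetting U (level U O k) :=
  ⟨h.isOpen, h.bdd, h.log, isPathConnected_level hO k, level_subset hO k⟩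

theorem Domain.isOpen_level {U : Set ℂ} {κ : ℝ} (h : Domain U κ) (O : ℂ) (k : ℕ) :
    IsOpen (level U O (k + 1)) := isOpen_visSet h.isOpen _

theorem Domain.exists_mem_level {U : Set ℂ} {κ : ℝ} (h : Domain U κ) {O x : ℂ} (hO : O ∈ U)
    (hx : x ∈ U) : ∃ k, x ∈ level U O (k + 1) := by
  obtain ⟨k, hk⟩ := exists_level h.isOpen h.conn hO hx
  exact ⟨k, level_mono hO k.le_succ hk⟩

/-! ### Measuring the visible pairs. -/

theorem volume_le_of_slices {E : Set (ℂ × ℂ)} (hE : MeasurableSet E) {U : Set ℂ}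
    (hU : MeasurableSet U) (hEU : ∀ p ∈ E, p.1 ∈ U) {m : ENNReal}
    (h : ∀ A, volume {B | (A, B) ∈ E} ≤ m) : volume E ≤ m * volume U := by
  rw [Measure.volume_eq_prod, Measure.prod_apply hE, ← setLIntegral_const,
    ← lintegral_indicator hU]
  refine lintegral_mono fun A => ?_
  by_cases hA : A ∈ U
  · rw [indicator_of_mem hA]; exact h A
  · rw [indicator_of_notMem hA]
    have : Prod.mk A ⁻¹' E = ∅ := by
      ext B
      simp only [mem_preimage, mem_empty_iff_false, iff_false]
      exact fun hB => hA (hEU _ hB)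
    rw [this, measure_empty]

theorem volume_preimage_swap {E : Set (ℂ × ℂ)} (hE : MeasurableSet E) :
    volume (Prod.swap ⁻¹' E) = volume E := by
  rw [Measure.volume_eq_prod]
  exact Measure.measurePreserving_swap.measure_preimage hE.nullMeasurableSet

theorem volume_le_of_swap_slices {E : Set (ℂ × ℂ)} (hE : MeasurableSet E) {U : Set ℂ}
    (hU : MeasurableSet U) (hEU : ∀ p ∈ E, p.2 ∈ U) {m : ENNReal}
    (h : ∀ B, volume {A | (A, B) ∈ E} ≤ m) : volume E ≤ m * volume U := by
  rw [← volume_preimage_swap hE]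
  exact volume_le_of_slices (measurable_swap hE) hU (fun p hp => hEU _ hp) h

/-- The map of pairs that moves each point a quarter of the way towards the other one. -/
noncomputable def quarterMap : ℂ × ℂ →ₗ[ℝ] ℂ × ℂ where
  toFun p := ((3 / 4 : ℝ) • p.1 + (1 / 4 : ℝ) • p.2, (1 / 4 : ℝ) • p.1 + (3 / 4 : ℝ) • p.2)
  map_add' p q := by ext1 <;> simp <;> ring
  map_smul' r p := by ext1 <;> simp <;> ring

/-- Sum and difference as coordinates on pairs. -/
noncomputable def sumDiffEquiv : (ℂ × ℂ) ≃ₗ[ℝ] ℂ × ℂ where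
  toFun p := (p.1 + p.2, p.1 - p.2)
  invFun p := ((1 / 2 : ℝ) • (p.1 + p.2), (1 / 2 : ℝ) • (p.1 - p.2))
  map_add' p q := by ext1 <;> simp <;> ring
  map_smul' r p := by ext1 <;> simp <;> ring
  left_inv p := by ext1 <;> simp <;> ring
  right_inv p := by ext1 <;> simp <;> ring

/-- The sum of the pair is fixed and the difference is halved; the difference ranges over two real
dimensions. -/
theorem det_quarterMap : LinearMap.det quarterMap = 1 / 4 := by
  have h : quarterMap = (sumDiffEquiv.symm : (ℂ × ℂ) →ₗ[ℝ] ℂ × ℂ) ∘ₗ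
      (LinearMap.prodMap LinearMap.id ((1 / 2 : ℝ) • LinearMap.id)) ∘ₗ
      (sumDiffEquiv.symm.symm : (ℂ × ℂ) →ₗ[ℝ] ℂ × ℂ) := by
    apply LinearMap.ext
    intro p
    ext1 <;> simp [quarterMap, sumDiffEquiv] <;> ring
  rw [h, LinearMap.det_conj, LinearMap.det_prodMap, LinearMap.det_smul]
  simp
  norm_num

theorem volume_preimage_quarterMap (E : Set (ℂ × ℂ)) :
    volume (quarterMap ⁻¹' E) = 4 * volume E := by
  rw [Measure.volume_eq_prod, Measure.addHaar_preimage_linearMap _ (by rw [det_quarterMap]; norm_num),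
    det_quarterMap]
  norm_num

/-- The point of the segment between the points of a pair at parameter `s`. -/
noncomputable def pairPoint (p : ℂ × ℂ) (s : ℝ) : ℂ := p.1 + s * (p.2 - p.1)

theorem pairPoint_mem {p : ℂ × ℂ} {s : ℝ} (hs : s ∈ Icc (0 : ℝ) 1) :
    pairPoint p s ∈ segment ℝ p.1 p.2 := mem_segment_of_smul hs.1 hs.2

theorem segment_pairPoint (p : ℂ × ℂ) (s t : ℝ) :
    segment ℝ (pairPoint p s) (pairPoint p t) = pairPoint p '' uIcc s t := by
  rw [← segment_eq_uIcc]
  have : ∀ x, pairPoint p x = AffineMap.lineMap p.1 p.2 x := fun x => by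
    rw [pairPoint, AffineMap.lineMap_apply]; simp; ring
  have hf : pairPoint p = (AffineMap.lineMap p.1 p.2 : ℝ →ᵃ[ℝ] ℂ) := funext this
  rw [hf, image_segment]

theorem isOpen_pairPoint {W : Set ℂ} (hW : IsOpen W) (T : Set ℝ) :
    IsOpen {p : ℂ × ℂ | ∃ s ∈ T, pairPoint p s ∈ W} := by
  have : {p : ℂ × ℂ | ∃ s ∈ T, pairPoint p s ∈ W} = ⋃ s ∈ T, (fun p => pairPoint p s) ⁻¹' W := by
    ext p; simp
  rw [this]
  exact isOpen_biUnion fun s _ => hW.preimage (by unfold pairPoint; fun_prop)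

/-- The mutually visible pairs whose segment enters `W` after its first quarter. -/
def latePairs (U W : Set ℂ) : Set (ℂ × ℂ) :=
  {p | Sees U p.1 p.2 ∧ (∃ s ∈ Icc (0 : ℝ) 1, pairPoint p s ∈ W) ∧
    ¬ ∃ s ∈ Icc (0 : ℝ) (1 / 4), pairPoint p s ∈ W}

theorem measurableSet_latePairs {U W : Set ℂ} (hU : IsOpen U) (hW : IsOpen W) :
    MeasurableSet (latePairs U W) :=
  (isOpen_sees hU).measurableSet.inter ((isOpen_pairPoint hW _).measurableSet.inter
    (isOpen_pairPoint hW _).measurableSet.compl)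

theorem latePairs_subset_shadow {U X : Set ℂ} {p : ℂ × ℂ} (hp : p ∈ latePairs U (visSet U X)) :
    pairPoint p (1 / 4) ∈ shadow U X p.1 := by
  obtain ⟨hs, ⟨s, hs01, hsW⟩, hn⟩ := hp
  have h0 : pairPoint p 0 = p.1 := by simp [pairPoint]
  have hlt : 1 / 4 < s := by
    by_contra hle
    exact hn ⟨s, ⟨hs01.1, not_lt.mp hle⟩, hsW⟩
  refine ⟨pairPoint p s, hsW, hs.mono_seg (left_mem_segment ℝ _ _) (pairPoint_mem hs01), ?_, ?_⟩
  · rw [← h0, segment_pairPoint, uIcc_of_le hs01.1]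
    refine mem_image_of_mem _ ⟨by norm_num, hlt.le⟩
  · rw [← h0, segment_pairPoint, uIcc_of_le (by norm_num)]
    rintro _ ⟨t, ht, rfl⟩ htW
    exact hn ⟨t, ht, htW⟩

/-- The first point lies exactly one stage beyond `visSet U X`. Over a given first point only one
level can therefore contribute late pairs. -/
theorem latePairs_fst {U X : Set ℂ} {p : ℂ × ℂ} (hp : p ∈ latePairs U (visSet U X)) :
    p.1 ∈ U ∧ p.1 ∉ visSet U X ∧ p.1 ∈ visSet U (visSet U X) := by
  have h := latePairs_subset_shadow hp
  obtain ⟨hs, -, hn⟩ := hp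
  refine ⟨hs.left_mem, fun hW => hn ⟨0, by norm_num, by simpa [pairPoint] using hW⟩, ?_⟩
  obtain ⟨M, hM, hAM, -⟩ := h
  exact ⟨M, hM, hAM⟩

/-- The quarter points lie in the convex shadow of `A`; the homothety of ratio `4` about `A`
recovers `B` and multiplies areas by `16`. -/
theorem volume_slice_latePairs_le {U X : Set ℂ} (h : VisSetting U X) {m : ENNReal}
    (hK : ∀ K ⊆ U, Convex ℝ K → volume K ≤ m) (A : ℂ) :
    volume {B | (A, B) ∈ latePairs U (visSet U X)} ≤ 16 * m := by
  by_cases hA : A ∈ visSet U X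
  · have : {B | (A, B) ∈ latePairs U (visSet U X)} = ∅ := by
      ext B
      simp only [mem_ofPred_eq, mem_empty_iff_false, iff_false]
      exact fun hB => (latePairs_fst hB).2.1 hA
    rw [this, measure_empty]; exact zero_le
  · have hsub : {B | (A, B) ∈ latePairs U (visSet U X)} ⊆
        AffineMap.homothety A (4 : ℝ) '' shadow U X A := by
      intro B hB
      refine ⟨_, latePairs_subset_shadow hB, ?_⟩
      simp [AffineMap.homothety_apply, pairPoint]
    refine (measure_mono hsub).trans ?_
    rw [Measure.addHaar_image_homothety, Complex.finrank_real_complex]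
    have : ENNReal.ofReal |(4 : ℝ) ^ 2| = 16 := by norm_num
    rw [this]
    gcongr
    exact hK _ (shadow_subset U X A) (h.convex_shadow hA)

/-- A point leaves the levels at a unique stage. -/
theorem level_index_unique {U : Set ℂ} {O x : ℂ} (hO : O ∈ U) {j k : ℕ}
    (hj : x ∉ level U O j) (hj' : x ∈ level U O (j + 1)) (hk : x ∉ level U O k)
    (hk' : x ∈ level U O (k + 1)) : j = k := by
  rcases lt_trichotomy j k with h | h | h
  · exact absurd (level_mono hO h hj') hk
  · exact h
  · exact absurd (level_mono hO h hk') hj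

theorem Domain.volume_latePairs_le {U : Set ℂ} {κ : ℝ} (h : Domain U κ) {O : ℂ} (hO : O ∈ U) :
    volume (⋃ k, latePairs U (level U O (k + 1))) ≤ 16 * ENNReal.ofReal κ * volume U := by
  refine volume_le_of_slices
    (MeasurableSet.iUnion fun k => measurableSet_latePairs h.isOpen (h.isOpen_level O k))
    h.isOpen.measurableSet ?_ ?_
  · intro p hp
    obtain ⟨k, hk⟩ := mem_iUnion.mp hp
    exact hk.1.left_mem
  · intro A
    by_cases hA : ∃ B, (A, B) ∈ ⋃ k, latePairs U (level U O (k + 1))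
    · obtain ⟨B, hB⟩ := hA
      obtain ⟨k, hk⟩ := mem_iUnion.mp hB
      have hk' := latePairs_fst hk
      refine (measure_mono ?_).trans
        (volume_slice_latePairs_le (h.visSetting hO k) h.convex_le A)
      intro C hC
      obtain ⟨j, hj⟩ := mem_iUnion.mp hC
      have hj' := latePairs_fst hj
      have : j + 1 = k + 1 := level_index_unique hO hj'.2.1 hj'.2.2 hk'.2.1 hk'.2.2
      change (A, C) ∈ latePairs U (level U O (k + 1))
      rwa [← this]
    · push Not at hA
      have : {B | (A, B) ∈ ⋃ k, latePairs U (level U O (k + 1))} = ∅ := by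
        ext B
        exact ⟨fun hB => hA B hB, fun hB => hB.elim⟩
      rw [this, measure_empty]; exact zero_le

/-- The mutually visible pairs of points seen from `O`. -/
def starPairs (U : Set ℂ) (O : ℂ) : Set (ℂ × ℂ) :=
  {p | Sees U p.1 p.2 ∧ p.1 ∈ level U O 1 ∧ p.2 ∈ level U O 1}

theorem measurableSet_starPairs {U : Set ℂ} (hU : IsOpen U) (O : ℂ) :
    MeasurableSet (starPairs U O) := by
  have h1 : IsOpen (level U O 1) := isOpen_visSet hU _
  exact (isOpen_sees hU).measurableSet.inter ((h1.preimage continuous_fst).measurableSet.inter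
    (h1.preimage continuous_snd).measurableSet)

theorem Domain.slice_starPairs_subset {U : Set ℂ} {κ : ℝ} (h : Domain U κ) {O A B : ℂ}
    (hAB : (A, B) ∈ starPairs U O) : |cross (A - O) (B - O)| ≤ 2 * κ := by
  obtain ⟨hs, ⟨_, rfl, hA⟩, ⟨_, rfl, hB⟩⟩ := hAB
  exact abs_cross_le h.log h.nonneg h.convex_le hA.symm hs hB

/-- The mutually visible pairs in `visSet U W` whose segment does not meet `W`. -/
def outerPairs (U W : Set ℂ) : Set (ℂ × ℂ) :=
  {p | Sees U p.1 p.2 ∧ (p.1 ∈ visSet U W ∧ p.2 ∈ visSet U W) ∧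
    ¬ ∃ s ∈ Icc (0 : ℝ) 1, pairPoint p s ∈ W}

theorem measurableSet_outerPairs {U W : Set ℂ} (hU : IsOpen U) (hW : IsOpen W) :
    MeasurableSet (outerPairs U W) := by
  have h1 : IsOpen (visSet U W) := isOpen_visSet hU _
  exact (isOpen_sees hU).measurableSet.inter (((h1.preimage continuous_fst).inter
    (h1.preimage continuous_snd)).measurableSet.inter (isOpen_pairPoint hW _).measurableSet.compl)

/-- The pairs whose second point is nearer to the window of the first. -/
def towardPairs (U X : Set ℂ) : Set (ℂ × ℂ) :=
  {p | ∃ (ν M : ℂ) (c : ℝ), ν ≠ 0 ∧ M ∈ visSet U X ∧ Sees U p.1 M ∧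
    HalfPlaneNear U X p.1 M ν c ∧ (ν * p.1).re < (ν * p.2).re}

/-- The same `ν`, `M`, `c` serve for all nearby pairs. Openness supplies the measurability needed
for slicing. -/
theorem isOpen_towardPairs {U : Set ℂ} (hU : IsOpen U) (X : Set ℂ) :
    IsOpen (towardPairs U X) := by
  rw [isOpen_iff_mem_nhds]
  rintro p ⟨ν, M, c, hν, hM, hs, ⟨G, hG, hpG, hGW⟩, hlt⟩
  have hc : Continuous fun q : ℂ × ℂ => (q.1, M) := by fun_prop
  have e1 : ∀ᶠ q : ℂ × ℂ in 𝓝 p, Sees U q.1 M :=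
    hc.continuousAt.eventually ((isOpen_sees hU).mem_nhds hs)
  have e2 : ∀ᶠ q : ℂ × ℂ in 𝓝 p, Sees G q.1 M :=
    hc.continuousAt.eventually ((isOpen_sees hG).mem_nhds hpG)
  have e3 : ∀ᶠ q : ℂ × ℂ in 𝓝 p, (ν * q.1).re < (ν * q.2).re :=
    (isOpen_lt (f := fun q : ℂ × ℂ => (ν * q.1).re) (g := fun q : ℂ × ℂ => (ν * q.2).re)
      (by fun_prop) (by fun_prop)).mem_nhds hlt
  filter_upwards [e1, e2, e3] with q h1 h2 h3
  exact ⟨ν, M, c, hν, hM, h1, ⟨G, hG, h2, hGW⟩, h3⟩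

theorem swap_mem_outerPairs {U W : Set ℂ} {A B : ℂ} (h : (A, B) ∈ outerPairs U W) :
    (B, A) ∈ outerPairs U W := by
  obtain ⟨hs, ⟨hA, hB⟩, hn⟩ := h
  refine ⟨hs.symm, ⟨hB, hA⟩, ?_⟩
  rintro ⟨s, hs, hsW⟩
  refine hn ⟨1 - s, ⟨by linarith [hs.2], by linarith [hs.1]⟩, ?_⟩
  convert hsW using 1
  simp only [pairPoint]; push_cast; ring

theorem outerPairs_not_mem {U W : Set ℂ} {A B : ℂ} (h : (A, B) ∈ outerPairs U W) :
    ∀ C ∈ segment ℝ A B, C ∉ W := by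
  intro C hC hCW
  rw [segment_eq_image'] at hC
  obtain ⟨s, hs, rfl⟩ := hC
  exact h.2.2 ⟨s, hs, by simpa [pairPoint] using hCW⟩

/-- A point of an outer pair confines the points nearer to its window to a set of small area. -/
theorem Domain.abs_cross_outerPairs_le {U X : Set ℂ} {κ : ℝ} (h : Domain U κ)
    (hX : VisSetting U X) (hX' : VisSetting U (visSet U X)) {A B M ν : ℂ} {c : ℝ}
    (hAB : (A, B) ∈ outerPairs U (visSet U X)) (hν : ν ≠ 0) (hM : M ∈ visSet U X)
    (hAM : Sees U A M) (hw : HalfPlaneNear U X A M ν c) :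
    (∃ N ∈ visSet U X, Sees U B N ∧ HalfPlaneNear U X B N ν c) ∧ (ν * B).re ≤ c ∧
      ((ν * A).re ≤ (ν * B).re →
        |cross (A - linePoint ν c A M) (B - linePoint ν c A M)| ≤ 4 * κ) := by
  have hout := outerPairs_not_mem hAB
  obtain ⟨hs, ⟨hA, hB⟩, -⟩ := hAB
  obtain ⟨N, hN, hBN⟩ := hB
  have hA0 := hout A (left_mem_segment ℝ _ _)
  have hB0 := hout B (right_mem_segment ℝ _ _)
  obtain ⟨hw', hAB'⟩ := hX.common_window hν hout
    (fun C hC => hX'.segment_subset hA ⟨N, hN, hBN⟩ hs hC) hM hN hAM hBN hw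
  have l1 := hw.left hA0
  have l2 := hw.right hM
  have m1 := hw'.left hB0
  have m2 := hw'.right hN
  refine ⟨⟨N, hN, hBN, hw'⟩, m1, fun hle => ?_⟩
  exact abs_cross_quad_le h.log h.nonneg h.convex_le hν (re_linePoint l1 l2) (re_linePoint m1 m2)
    hle m1 (hAM.mono_seg (left_mem_segment ℝ _ _) (linePoint_mem l1 l2)) hAB'
    (hBN.mono_seg (left_mem_segment ℝ _ _) (linePoint_mem m1 m2)).symm hs

theorem Domain.volume_slice_outerPairs_le {U X : Set ℂ} {κ : ℝ} (h : Domain U κ)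
    (hX : VisSetting U X) (hX' : VisSetting U (visSet U X)) (A : ℂ) :
    volume {B | (A, B) ∈ outerPairs U (visSet U X) ∩ towardPairs U X} ≤ ENNReal.ofReal (8 * κ) ∧
    volume {B | (B, A) ∈ outerPairs U (visSet U X) \ towardPairs U X}
      ≤ ENNReal.ofReal (8 * κ) := by
  by_cases hA : A ∈ visSet U (visSet U X) ∧ A ∉ visSet U X
  · obtain ⟨⟨M, hM, hAM⟩, hA0⟩ := hA
    obtain ⟨ν, c, hν, hw⟩ := hX.exists_halfPlane hA0 hM hAM
    have l1 := hw.left hA0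
    have l2 := hw.right hM
    have hreg := volume_lower_region_le (κ := κ) hν (re_linePoint l1 l2) l1
    constructor
    · refine (measure_mono ?_).trans hreg
      rintro B ⟨hAB, ν', M', c', hν', hM', hAM', hw', hlt⟩
      obtain ⟨-, h2, h3⟩ := h.abs_cross_outerPairs_le hX hX' hAB hν hM hAM hw
      -- The degenerate pair `(A, A)` carries the description along `A M'` over to `A M`, so that
      -- the two normals are proportional.
      have hAA : (A, A) ∈ outerPairs U (visSet U X) := by
        refine ⟨Sees.refl hAM.left_mem, ⟨⟨M, hM, hAM⟩, ⟨M, hM, hAM⟩⟩, ?_⟩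
        rintro ⟨s, -, hsW⟩
        exact hA0 (by simpa [pairPoint] using hsW)
      have hw2 := (hX.common_window hν' (outerPairs_not_mem hAA)
        (by rw [segment_same]; rintro C rfl; exact ⟨M, hM, hAM⟩) hM' hM hAM' hAM hw').1
      obtain ⟨k, hk, rfl, -⟩ := HalfPlaneNear.unique hA0 hM hν hw2 hw
      have hle : (ν * A).re ≤ (ν * B).re := by
        dsimp only at hlt
        rw [mul_assoc, mul_assoc, re_ofReal_mul, re_ofReal_mul] at hlt
        exact (lt_of_mul_lt_mul_left hlt hk.le).le
      exact ⟨⟨hle, h2⟩, h3 hle⟩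
    · refine (measure_mono ?_).trans hreg
      rintro B ⟨hBA, hn⟩
      obtain ⟨⟨N, hN, hBN, hwN⟩, h2, h3⟩ :=
        h.abs_cross_outerPairs_le hX hX' (swap_mem_outerPairs hBA) hν hM hAM hw
      have hle : (ν * A).re ≤ (ν * B).re := by
        by_contra hlt
        exact hn ⟨ν, N, c, hν, hN, hBN, hwN, not_le.mp hlt⟩
      exact ⟨⟨hle, h2⟩, h3 hle⟩
  · have hno : ∀ B, (A, B) ∉ outerPairs U (visSet U X) := fun B hB =>
      hA ⟨hB.2.1.1, outerPairs_not_mem hB A (left_mem_segment ℝ _ _)⟩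
    have e1 : {B | (A, B) ∈ outerPairs U (visSet U X) ∩ towardPairs U X} = ∅ := by
      ext B; exact ⟨fun hB => hno B hB.1, fun hB => hB.elim⟩
    have e2 : {B | (B, A) ∈ outerPairs U (visSet U X) \ towardPairs U X} = ∅ := by
      ext B; exact ⟨fun hB => hno B (swap_mem_outerPairs hB.1), fun hB => hB.elim⟩
    rw [e1, e2, measure_empty]
    exact ⟨zero_le, zero_le⟩

/-- The mutually visible pairs on a common level, the segment between them missing the preceding
levels. -/
def levelPairs (U : Set ℂ) (O : ℂ) : ℕ → Set (ℂ × ℂ)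
  | 0 => starPairs U O
  | k + 1 => outerPairs U (level U O (k + 1))

/-- A choice of a nearer point in the pairs on a common level. -/
def nearPairs (U : Set ℂ) (O : ℂ) : ℕ → Set (ℂ × ℂ)
  | 0 => {p | ‖p.2 - O‖ ≤ ‖p.1 - O‖}
  | k + 1 => towardPairs U (level U O k)

theorem Domain.measurableSet_levelPairs {U : Set ℂ} {κ : ℝ} (h : Domain U κ) (O : ℂ) :
    ∀ k, MeasurableSet (levelPairs U O k)
  | 0 => measurableSet_starPairs h.isOpen O
  | k + 1 => measurableSet_outerPairs h.isOpen (h.isOpen_level O k)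

theorem Domain.measurableSet_nearPairs {U : Set ℂ} {κ : ℝ} (h : Domain U κ) (O : ℂ) :
    ∀ k, MeasurableSet (nearPairs U O k)
  | 0 => (isClosed_le (f := fun p : ℂ × ℂ => ‖p.2 - O‖) (g := fun p => ‖p.1 - O‖)
      (by fun_prop) (by fun_prop)).measurableSet
  | k + 1 => (isOpen_towardPairs h.isOpen _).measurableSet

theorem levelPairs_symm {U : Set ℂ} {O A B : ℂ} :
    ∀ {k}, (A, B) ∈ levelPairs U O k → (B, A) ∈ levelPairs U O k
  | 0, h => ⟨h.1.symm, h.2.2, h.2.1⟩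
  | _ + 1, h => swap_mem_outerPairs h

theorem levelPairs_sees {U : Set ℂ} {O : ℂ} {p : ℂ × ℂ} :
    ∀ {k}, p ∈ levelPairs U O k → Sees U p.1 p.2
  | 0, h => h.1
  | _ + 1, h => h.1

theorem levelPairs_index {U : Set ℂ} {O A B C : ℂ} (hO : O ∈ U) :
    ∀ {j k}, (A, B) ∈ levelPairs U O j → (A, C) ∈ levelPairs U O k → j = k
  | 0, 0, _, _ => rfl
  | 0, k + 1, hj, hk => absurd (level_mono hO (Nat.le_add_left 1 k) hj.2.1)
      (outerPairs_not_mem hk A (left_mem_segment ℝ _ _))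
  | j + 1, 0, hj, hk => absurd (level_mono hO (Nat.le_add_left 1 j) hk.2.1)
      (outerPairs_not_mem hj A (left_mem_segment ℝ _ _))
  | _ + 1, _ + 1, hj, hk =>
      level_index_unique hO (outerPairs_not_mem hj A (left_mem_segment ℝ _ _)) hj.2.1.1
        (outerPairs_not_mem hk A (left_mem_segment ℝ _ _)) hk.2.1.1

theorem Domain.volume_slice_levelPairs_le {U : Set ℂ} {κ : ℝ} (h : Domain U κ) {O : ℂ}
    (hO : O ∈ U) (A : ℂ) : ∀ k,
    volume {B | (A, B) ∈ levelPairs U O k ∩ nearPairs U O k} ≤ ENNReal.ofReal (8 * κ) ∧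
    volume {B | (B, A) ∈ levelPairs U O k \ nearPairs U O k} ≤ ENNReal.ofReal (8 * κ)
  | 0 => by
    constructor
    · refine (measure_mono ?_).trans (volume_star_region_le (A := A) (O := O))
      rintro B ⟨hAB, hle⟩
      exact ⟨hle, h.slice_starPairs_subset hAB⟩
    · refine (measure_mono ?_).trans (volume_star_region_le (A := A) (O := O))
      rintro B ⟨hBA, hn⟩
      exact ⟨(not_le.mp hn).le, h.slice_starPairs_subset (levelPairs_symm (k := 0) hBA)⟩
  | k + 1 => h.volume_slice_outerPairs_le (h.visSetting hO k) (h.visSetting hO (k + 1)) A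

/-- At most one of the sets is nonempty. It is used for slices of different levels over one point.
-/
theorem measure_iUnion_le_of_subsingleton {s : ℕ → Set ℂ} {m : ENNReal}
    (hs : ∀ i j x y, x ∈ s i → y ∈ s j → i = j) (h : ∀ i, volume (s i) ≤ m) :
    volume (⋃ i, s i) ≤ m := by
  by_cases hne : ∃ i x, x ∈ s i
  · obtain ⟨i, x, hx⟩ := hne
    refine (measure_mono (iUnion_subset fun j y hy => ?_)).trans (h i)
    rwa [hs i j x y hx hy]
  · push Not at hne
    have : ⋃ i, s i = ∅ := by
      ext x; simp [hne]
    rw [this, measure_empty]; exact zero_le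

/-- Each pair is charged to its point farther from the window, or from `O` on the first level, ties
included. Pairs in `nearPairs` are sliced over the first point and the remaining ones over the
second, with `8 κ` for each kind. -/
theorem Domain.volume_levelPairs_le {U : Set ℂ} {κ : ℝ} (h : Domain U κ) {O : ℂ} (hO : O ∈ U) :
    volume (⋃ k, levelPairs U O k) ≤ 16 * ENNReal.ofReal κ * volume U := by
  have hsub : ⋃ k, levelPairs U O k ⊆ (⋃ k, levelPairs U O k ∩ nearPairs U O k) ∪
      ⋃ k, levelPairs U O k \ nearPairs U O k := by
    intro p hp
    obtain ⟨k, hk⟩ := mem_iUnion.mp hp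
    by_cases hn : p ∈ nearPairs U O k
    · exact Or.inl (mem_iUnion.mpr ⟨k, hk, hn⟩)
    · exact Or.inr (mem_iUnion.mpr ⟨k, hk, hn⟩)
  have m1 : volume (⋃ k, levelPairs U O k ∩ nearPairs U O k)
      ≤ ENNReal.ofReal (8 * κ) * volume U := by
    refine volume_le_of_slices (MeasurableSet.iUnion fun k =>
      (h.measurableSet_levelPairs O k).inter (h.measurableSet_nearPairs O k))
      h.isOpen.measurableSet ?_ fun A => ?_
    · intro p hp
      obtain ⟨k, hk⟩ := mem_iUnion.mp hp
      exact (levelPairs_sees hk.1).left_mem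
    · have e : {B | (A, B) ∈ ⋃ k, levelPairs U O k ∩ nearPairs U O k}
          = ⋃ k, {B | (A, B) ∈ levelPairs U O k ∩ nearPairs U O k} := by
        ext B; simp
      rw [e]
      exact measure_iUnion_le_of_subsingleton
        (fun i j x y hx hy => levelPairs_index hO hx.1 hy.1)
        fun k => (h.volume_slice_levelPairs_le hO A k).1
  have m2 : volume (⋃ k, levelPairs U O k \ nearPairs U O k)
      ≤ ENNReal.ofReal (8 * κ) * volume U := by
    refine volume_le_of_swap_slices (MeasurableSet.iUnion fun k =>
      (h.measurableSet_levelPairs O k).diff (h.measurableSet_nearPairs O k))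
      h.isOpen.measurableSet ?_ fun A => ?_
    · intro p hp
      obtain ⟨k, hk⟩ := mem_iUnion.mp hp
      exact (levelPairs_sees hk.1).right_mem
    · have e : {B | (B, A) ∈ ⋃ k, levelPairs U O k \ nearPairs U O k}
          = ⋃ k, {B | (B, A) ∈ levelPairs U O k \ nearPairs U O k} := by
        ext B; simp
      rw [e]
      exact measure_iUnion_le_of_subsingleton
        (fun i j x y hx hy => levelPairs_index hO (levelPairs_symm hx.1) (levelPairs_symm hy.1))
        fun k => (h.volume_slice_levelPairs_le hO A k).2
  refine (measure_mono hsub).trans ((measure_union_le _ _).trans ((add_le_add m1 m2).trans ?_))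
  rw [← add_mul, ENNReal.ofReal_mul (by norm_num), ← add_mul]
  norm_num

/-- Let `k` be the first stage whose level the segment meets; by relative convexity the parameters
met form an interval. If it contains `1/4` and `3/4`, the quarter points form a level pair. If not,
it misses the first or the last quarter, and the pair or its swap is late. -/
theorem Domain.sees_subset {U : Set ℂ} {κ : ℝ} (h : Domain U κ) {O : ℂ} (hO : O ∈ U) :
    {p : ℂ × ℂ | Sees U p.1 p.2} ⊆ (⋃ k, latePairs U (level U O (k + 1))) ∪
      (Prod.swap ⁻¹' ⋃ k, latePairs U (level U O (k + 1))) ∪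
      quarterMap ⁻¹' ⋃ k, levelPairs U O k := by
  classical
  intro p hs
  have hex : ∃ k, ∃ s ∈ Icc (0 : ℝ) 1, pairPoint p s ∈ level U O (k + 1) := by
    obtain ⟨k, hk⟩ := h.exists_mem_level hO hs.left_mem
    exact ⟨k, 0, by norm_num, by simpa [pairPoint] using hk⟩
  set k := Nat.find hex with hk
  have hmin : ∀ j < k, ¬ ∃ s ∈ Icc (0 : ℝ) 1, pairPoint p s ∈ level U O (j + 1) :=
    fun j hj => Nat.find_min hex hj
  obtain ⟨s₀, hs₀, hs₀W⟩ := Nat.find_spec hex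
  rw [← hk] at hs₀W
  have hconv : ∀ s ∈ Icc (0 : ℝ) 1, ∀ t ∈ Icc (0 : ℝ) 1, pairPoint p s ∈ level U O (k + 1) →
      pairPoint p t ∈ level U O (k + 1) → ∀ r ∈ uIcc s t, pairPoint p r ∈ level U O (k + 1) := by
    intro s hsI t htI hsW htW r hr
    refine (h.visSetting hO k).segment_subset hsW htW
      (hs.mono_seg (pairPoint_mem hsI) (pairPoint_mem htI)) ?_
    rw [segment_pairPoint]
    exact mem_image_of_mem _ hr
  have q1 : (1 / 4 : ℝ) ∈ Icc (0 : ℝ) 1 := by norm_num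
  have q3 : (3 / 4 : ℝ) ∈ Icc (0 : ℝ) 1 := by norm_num
  have back : (∀ s ∈ Icc (3 / 4 : ℝ) 1, pairPoint p s ∉ level U O (k + 1)) →
      p.swap ∈ latePairs U (level U O (k + 1)) := by
    intro hno
    have hrev : ∀ s : ℝ, pairPoint p.swap s = pairPoint p (1 - s) := fun s => by
      simp only [pairPoint, Prod.fst_swap, Prod.snd_swap]; push_cast; ring
    refine ⟨hs.symm, ⟨1 - s₀, ⟨by linarith [hs₀.2], by linarith [hs₀.1]⟩, ?_⟩, ?_⟩
    · rw [hrev, sub_sub_cancel]; exact hs₀W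
    · rintro ⟨s, hsI, hsW⟩
      rw [hrev] at hsW
      exact hno (1 - s) ⟨by linarith [hsI.2], by linarith [hsI.1]⟩ hsW
  by_cases h1 : pairPoint p (1 / 4) ∈ level U O (k + 1)
  · by_cases h3 : pairPoint p (3 / 4) ∈ level U O (k + 1)
    · right
      refine mem_iUnion.mpr ⟨k, ?_⟩
      have hq : quarterMap p = (pairPoint p (1 / 4), pairPoint p (3 / 4)) := by
        ext1 <;> simp [quarterMap, pairPoint] <;> ring
      rw [hq]
      have hss := hs.mono_seg (pairPoint_mem q1) (pairPoint_mem q3)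
      rcases hkk : k with _ | j
      · rw [hkk] at h1 h3
        exact ⟨hss, h1, h3⟩
      · rw [hkk] at h1 h3
        refine ⟨hss, ⟨h1, h3⟩, ?_⟩
        rintro ⟨s, hsI, hsW⟩
        -- The segment between the quarter points is the middle half of the original one, so
        -- minimality at stage `j` applies to it.
        refine hmin j (by omega) ⟨1 / 4 + s * (1 / 2), ⟨by linarith [hsI.1], by linarith [hsI.2]⟩, ?_⟩
        convert hsW using 1
        simp only [pairPoint]; push_cast; ring
    · refine Or.inl (Or.inr (mem_iUnion.mpr ⟨k, back fun s hsI hsW => h3 ?_⟩))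
      exact hconv _ q1 s ⟨by linarith [hsI.1], hsI.2⟩ h1 hsW _
        (by rw [uIcc_of_le (by linarith [hsI.1])]; exact ⟨by norm_num, hsI.1⟩)
  · by_cases h2 : ∃ s ∈ Icc (1 / 4 : ℝ) 1, pairPoint p s ∈ level U O (k + 1)
    · obtain ⟨s, hsI, hsW⟩ := h2
      refine Or.inl (Or.inl (mem_iUnion.mpr ⟨k, hs, ⟨s₀, hs₀, hs₀W⟩, ?_⟩))
      rintro ⟨t, htI, htW⟩
      exact h1 (hconv t ⟨htI.1, by linarith [htI.2]⟩ s ⟨by linarith [hsI.1], hsI.2⟩ htW hsW _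
        (by rw [uIcc_of_le (by linarith [hsI.1, htI.2])]; exact ⟨htI.2, hsI.1⟩))
    · refine Or.inl (Or.inr (mem_iUnion.mpr ⟨k, back fun s hsI hsW => h2 ?_⟩))
      exact ⟨s, ⟨by linarith [hsI.1], hsI.2⟩, hsW⟩

/-- Here `96 = 16 + 16 + 4 · 16`: late pairs in both orders, and level pairs, whose measure is
multiplied by `4` under the preimage by `quarterMap`. -/
theorem Domain.volume_sees_le {U : Set ℂ} {κ : ℝ} (h : Domain U κ) :
    volume {p : ℂ × ℂ | Sees U p.1 p.2} ≤ 96 * ENNReal.ofReal κ * volume U := by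
  rcases U.eq_empty_or_nonempty with hU | ⟨O, hO⟩
  · have : {p : ℂ × ℂ | Sees U p.1 p.2} = ∅ := by
      ext p
      exact ⟨fun hp => by simpa [hU] using Sees.left_mem hp, fun hp => hp.elim⟩
    rw [this, measure_empty]; exact zero_le
  · have hm := MeasurableSet.iUnion fun k =>
      measurableSet_latePairs h.isOpen (h.isOpen_level O k)
    refine (measure_mono (h.sees_subset hO)).trans ((measure_union_le _ _).trans ?_)
    refine (add_le_add_left (measure_union_le _ _) _).trans ?_
    rw [volume_preimage_swap hm, volume_preimage_quarterMap]
    refine (add_le_add (add_le_add (h.volume_latePairs_le hO) (h.volume_latePairs_le hO))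
      (mul_le_mul_right (h.volume_levelPairs_le hO) 4)).trans (le_of_eq ?_)
    ring

/-! ### Logarithms on filled compact sets and on components. -/

theorem HasLog.mono {z : ℂ} {Y Z : Set ℂ} (h : HasLog z Z) (hYZ : Y ⊆ Z) : HasLog z Y :=
  let ⟨f, hf, he⟩ := h
  ⟨f, hf.mono hYZ, fun x hx => he x (hYZ hx)⟩

/-- The base point of a branch of the logarithm can be moved along segments. -/
theorem HasLog.move {z w : ℂ} {Y : Set ℂ} (h : HasLog z Y) (hd : ∀ y ∈ Y, y ∉ segment ℝ z w) :
    HasLog w Y := by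
  obtain ⟨f, hf, he⟩ := h
  have hne : ∀ y ∈ Y, z - y ≠ 0 := fun y hy h0 => hd y hy (by
    rw [← sub_eq_zero.mp h0]; exact left_mem_segment ℝ _ _)
  have hs : ∀ y ∈ Y, (w - y) / (z - y) ∈ slitPlane := fun y hy => div_mem_slitPlane (hd y hy)
  refine ⟨fun y => f y + log ((w - y) / (z - y)), hf.add (ContinuousOn.clog ?_ hs), ?_⟩
  · exact ContinuousOn.div (by fun_prop) (by fun_prop) hne
  · intro y hy
    rw [exp_add, he y hy, exp_log (slitPlane_ne_zero (hs y hy)), mul_div_assoc',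
      div_eq_iff (hne y hy)]
    ring

theorem hasLog_eventually {z : ℂ} {Y : Set ℂ} (hY : IsClosed Y) (hz : z ∉ Y) :
    ∀ᶠ w in 𝓝 z, (HasLog w Y ↔ HasLog z Y) := by
  obtain ⟨ε, hε, hb⟩ := Metric.isOpen_iff.mp hY.isOpen_compl z hz
  filter_upwards [Metric.ball_mem_nhds z hε] with w hw
  have hseg : segment ℝ z w ⊆ Yᶜ :=
    ((convex_ball z ε).segment_subset (Metric.mem_ball_self hε) hw).trans hb
  exact ⟨fun h => h.move fun y hy hys => hseg (segment_symm ℝ w z ▸ hys) hy,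
    fun h => h.move fun y hy hys => hseg hys hy⟩

/-- The existence of logarithms about `z` does not depend on `z` in a connected set. -/
theorem hasLog_iff_of_preconnected {Y C : Set ℂ} (hY : IsClosed Y) (hC : IsPreconnected C)
    (hd : Disjoint C Y) {z w : ℂ} (hz : z ∈ C) (hw : w ∈ C) : HasLog z Y ↔ HasLog w Y :=
  iff_of_locally_iff (R := fun x => HasLog x Y) hC (fun _ hx => nhdsWithin_le_nhds
    (hasLog_eventually hY (disjoint_left.mp hd hx))) hz hw

theorem hasLog_of_far {z : ℂ} {Y : Set ℂ} {R : ℝ} (hY : ∀ y ∈ Y, ‖y‖ ≤ R) (hz : R < ‖z‖) :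
    HasLog z Y := by
  by_cases h0 : z = 0
  -- For `z = 0` the bound `R` is negative and `Y` is empty.
  · refine ⟨0, continuousOn_const, fun y hy => ?_⟩
    rw [h0, norm_zero] at hz
    linarith [hY y hy, norm_nonneg y]
  have hs : ∀ y ∈ Y, 1 - y / z ∈ slitPlane := by
    intro y hy
    have h1 : ‖y / z‖ < 1 := by
      rw [norm_div, div_lt_one (norm_pos_iff.mpr h0)]
      exact (hY y hy).trans_lt hz
    left
    have := (abs_le.mp (abs_re_le_norm (y / z))).2
    rw [sub_re, one_re]
    linarith
  refine ⟨fun y => log (1 - y / z) + log (-z), ?_, fun y hy => ?_⟩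
  · exact (ContinuousOn.clog (by fun_prop) hs).add continuousOn_const
  · rw [exp_add, exp_log (slitPlane_ne_zero (hs y hy)), exp_log (neg_ne_zero.mpr h0)]
    field_simp
    ring

/-- A set together with the bounded components of its complement. -/
def fillSet (K : Set ℂ) : Set ℂ :=
  K ∪ {x | x ∉ K ∧ Bornology.IsBounded (connectedComponentIn Kᶜ x)}

theorem subset_fillSet (K : Set ℂ) : K ⊆ fillSet K := subset_union_left

theorem not_mem_fillSet {K : Set ℂ} {x : ℂ} :
    x ∉ fillSet K ↔ x ∈ Kᶜ ∧ ¬ Bornology.IsBounded (connectedComponentIn Kᶜ x) := by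
  simp only [fillSet, mem_union, mem_ofPred_eq, mem_compl_iff]
  tauto

theorem disjoint_connectedComponentIn_fillSet {K : Set ℂ} {x : ℂ} (hx : x ∉ fillSet K) :
    Disjoint (connectedComponentIn Kᶜ x) (fillSet K) := by
  rw [disjoint_left]
  intro y hy
  refine not_mem_fillSet.mpr ⟨connectedComponentIn_subset _ _ hy, ?_⟩
  rw [← connectedComponentIn_eq hy]
  exact (not_mem_fillSet.mp hx).2

theorem connectedComponentIn_subset_fillSet {K : Set ℂ} {x : ℂ} (hxK : x ∉ K)
    (hx : x ∈ fillSet K) : connectedComponentIn Kᶜ x ⊆ fillSet K := by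
  intro y hy
  refine Or.inr ⟨connectedComponentIn_subset _ _ hy, ?_⟩
  rw [← connectedComponentIn_eq hy]
  exact (hx.resolve_left hxK).2

/-- A point farther out than all of `K` escapes radially to infinity off `K`, so its component is
unbounded. -/
theorem norm_le_of_mem_fillSet {K : Set ℂ} {R : ℝ} (hR : 0 ≤ R) (hK : ∀ y ∈ K, ‖y‖ ≤ R) :
    ∀ y ∈ fillSet K, ‖y‖ ≤ R := by
  intro y hy
  by_contra hlt
  have hlt := not_le.mp hlt
  have hyK : y ∉ K := fun h => absurd (hK y h) (not_le.mpr hlt)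
  have hb := (hy.resolve_left hyK).2
  set ray := (fun t : ℝ => y + t * y) '' Ici 0 with hray
  have hsub : ray ⊆ connectedComponentIn Kᶜ y := by
    refine IsPreconnected.subset_connectedComponentIn
      (isPreconnected_Ici.image _ (Continuous.continuousOn (by fun_prop))) ⟨0, by simp, by simp⟩ ?_
    rintro _ ⟨t, ht, rfl⟩ hK'
    have h1 : ‖y + t * y‖ = (1 + t) * ‖y‖ := by
      rw [show y + t * y = ((1 + t : ℝ) : ℂ) * y by push_cast; ring, norm_mul, norm_real,
        Real.norm_of_nonneg (by linarith [mem_Ici.mp ht])]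
    have := hK _ hK'
    have ht' := mem_Ici.mp ht
    nlinarith
  obtain ⟨r, hr⟩ := (hb.subset hsub).subset_closedBall 0
  have hy0 : 0 < ‖y‖ := hR.trans_lt hlt
  have hmem : y + ((|r| / ‖y‖ : ℝ) : ℂ) * y ∈ ray := ⟨_, mem_Ici.mpr (by positivity), rfl⟩
  have := hr hmem
  rw [mem_closedBall_zero_iff, show y + ((|r| / ‖y‖ : ℝ) : ℂ) * y
    = ((1 + |r| / ‖y‖ : ℝ) : ℂ) * y by push_cast; ring, norm_mul, norm_real,
    Real.norm_of_nonneg (by positivity), add_mul, div_mul_cancel₀ _ hy0.ne'] at this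
  linarith [le_abs_self r]

theorem exists_bound_fillSet {K : Set ℂ} (hK : IsCompact K) :
    ∃ R, 0 ≤ R ∧ ∀ y ∈ fillSet K, ‖y‖ ≤ R := by
  obtain ⟨R, hR⟩ := hK.isBounded.subset_closedBall 0
  refine ⟨max R 0, le_max_right _ _, norm_le_of_mem_fillSet (le_max_right _ _) fun y hy => ?_⟩
  exact (mem_closedBall_zero_iff.mp (hR hy)).trans (le_max_left _ _)

theorem isBounded_fillSet {K : Set ℂ} (hK : IsCompact K) : Bornology.IsBounded (fillSet K) := by
  obtain ⟨R, -, hR⟩ := exists_bound_fillSet hK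
  exact Metric.isBounded_closedBall.subset fun y hy => mem_closedBall_zero_iff.mpr (hR y hy)

theorem isClosed_fillSet {K : Set ℂ} (hK : IsCompact K) : IsClosed (fillSet K) := by
  rw [← isOpen_compl_iff, isOpen_iff_mem_nhds]
  intro x hx
  refine mem_of_superset ((hK.isClosed.isOpen_compl.connectedComponentIn (x := x)).mem_nhds
    (mem_connectedComponentIn (not_mem_fillSet.mp hx).1)) ?_
  exact (disjoint_connectedComponentIn_fillSet hx).subset_compl_right

/-- The component of `z` in the complement of `K` is unbounded and avoids the filled set, so the
base point can be moved far away, where a logarithm is explicit. -/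
theorem hasLog_fillSet {K : Set ℂ} (hK : IsCompact K) {z : ℂ} (hz : z ∉ fillSet K) :
    HasLog z (fillSet K) := by
  obtain ⟨R, hR0, hR⟩ := exists_bound_fillSet hK
  have hub := (not_mem_fillSet.mp hz).2
  have hex : ∃ w ∈ connectedComponentIn Kᶜ z, R < ‖w‖ := by
    by_contra hno
    push Not at hno
    exact hub (Metric.isBounded_closedBall.subset fun y hy =>
      mem_closedBall_zero_iff.mpr (hno y hy))
  obtain ⟨w, hw, hwR⟩ := hex
  exact (hasLog_iff_of_preconnected (isClosed_fillSet hK) isPreconnected_connectedComponentIn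
    (disjoint_connectedComponentIn_fillSet hz)
    (mem_connectedComponentIn (not_mem_fillSet.mp hz).1) hw).mpr (hasLog_of_far hR hwR)

/-- A point outside the interior is a limit of points outside the filled set, and the existence of a
logarithm on the compact set `Y` is unaffected by small moves of the base point. -/
theorem logConnected_interior_fillSet {K : Set ℂ} (hK : IsCompact K) :
    LogConnected (interior (fillSet K)) := by
  intro z hz Y hY hYc
  have hzY : z ∉ Y := fun h => hz (hY h)
  rw [← mem_compl_iff, ← closure_compl] at hz
  obtain ⟨w, hw, hwF⟩ :=
    (mem_closure_iff_frequently.mp hz).and_eventually (hasLog_eventually hYc.isClosed hzY)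
      |>.exists
  exact hwF.mp ((hasLog_fillSet hK hw).mono (hY.trans interior_subset))

/-- The components of a bounded open set inherit the existence of logarithms. -/
theorem LogConnected.component {V : Set ℂ} (hV : IsOpen V) (hb : Bornology.IsBounded V)
    (hL : LogConnected V) (x : ℂ) : LogConnected (connectedComponentIn V x) := by
  intro z hz Y hY hYc
  have hYV := hY.trans (connectedComponentIn_subset V x)
  by_cases hzV : z ∈ V
  · set C := connectedComponentIn V z with hC
    have hCo : IsOpen C := hV.connectedComponentIn
    have hzC : z ∈ C := mem_connectedComponentIn hzV
    have hCV : C ⊆ V := connectedComponentIn_subset V z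
    have hdis : Disjoint (connectedComponentIn V x) C := by
      rw [disjoint_left]
      intro y hy hyC
      exact hz (by rw [connectedComponentIn_eq hy, ← connectedComponentIn_eq hyC]; exact hzC)
    -- The other component `C` is open and bounded, so it has a boundary point, which lies outside
    -- `V`. The base point is moved there within the closure of `C`, which is connected and misses
    -- `Y`.
    have hclos : ∃ w ∈ closure C, w ∉ C := by
      by_contra hno
      push Not at hno
      have hclopen : IsClopen C := ⟨closure_subset_iff_isClosed.mp hno, hCo⟩
      rcases isClopen_iff.mp hclopen with h | h
      · rw [h] at hzC; exact hzC
      · exact NormedSpace.unbounded_univ ℝ ℂ (h ▸ hb.subset hCV)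
    obtain ⟨w, hw, hwC⟩ := hclos
    have hwV : w ∉ V := by
      intro hwV
      have hwo : connectedComponentIn V w ∈ 𝓝 w :=
        hV.connectedComponentIn.mem_nhds (mem_connectedComponentIn hwV)
      obtain ⟨y, hy, hyC⟩ := mem_closure_iff_nhds.mp hw _ hwo
      apply hwC
      rw [hC, connectedComponentIn_eq hyC, ← connectedComponentIn_eq hy]
      exact mem_connectedComponentIn hwV
    have hdc : Disjoint (closure C) Y :=
      (hdis.closure_right hV.connectedComponentIn).symm.mono_right hY
    exact (hasLog_iff_of_preconnected hYc.isClosed isPreconnected_connectedComponentIn.closure hdc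
      (subset_closure hzC) hw).mpr (hL w hwV Y hYV hYc)
  · exact hL z hzV Y hYV hYc

/-- A visible segment lies in one component. The components are disjoint and open, hence countably
many, and their bounds add up. -/
theorem volume_sees_open_le {V : Set ℂ} (hV : IsOpen V) (hb : Bornology.IsBounded V)
    (hL : LogConnected V) {κ : ℝ} (hκ : 0 ≤ κ)
    (hK : ∀ K ⊆ V, Convex ℝ K → volume K ≤ ENNReal.ofReal κ) :
    volume {p : ℂ × ℂ | Sees V p.1 p.2} ≤ 96 * ENNReal.ofReal κ * volume V := by
  set 𝒞 : Set (Set ℂ) := connectedComponentIn V '' V with h𝒞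
  have hsub : ∀ C ∈ 𝒞, C ⊆ V := by
    rintro _ ⟨x, -, rfl⟩; exact connectedComponentIn_subset V x
  have hopen : ∀ C ∈ 𝒞, IsOpen C := by
    rintro _ ⟨x, -, rfl⟩; exact hV.connectedComponentIn
  have hdis : 𝒞.PairwiseDisjoint id := by
    rintro _ ⟨x, -, rfl⟩ _ ⟨y, -, rfl⟩ hne
    simp only [Function.onFun, id]
    rw [disjoint_left]
    intro p hp hp'
    exact hne (by rw [connectedComponentIn_eq hp, connectedComponentIn_eq hp'])
  have hcount : 𝒞.Countable := hdis.countable_of_isOpen hopen (by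
    rintro _ ⟨x, hx, rfl⟩; exact ⟨x, mem_connectedComponentIn hx⟩)
  have hcover : {p : ℂ × ℂ | Sees V p.1 p.2} ⊆ ⋃ C ∈ 𝒞, {p : ℂ × ℂ | Sees C p.1 p.2} := by
    intro p hp
    simp only [mem_iUnion]
    refine ⟨_, mem_image_of_mem _ (Sees.left_mem hp), ?_⟩
    exact (isPreconnected_segment _ _).subset_connectedComponentIn (left_mem_segment ℝ _ _) hp
  have hdom : ∀ C ∈ 𝒞, Domain C κ := by
    rintro C hC
    refine ⟨hopen C hC, hb.subset (hsub C hC), ?_, ?_, hκ, fun K hKC => hK K (hKC.trans (hsub C hC))⟩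
    · obtain ⟨x, -, rfl⟩ := hC; exact hL.component hV hb x
    · obtain ⟨x, -, rfl⟩ := hC; exact isPreconnected_connectedComponentIn
  calc volume {p : ℂ × ℂ | Sees V p.1 p.2}
      ≤ ∑' C : 𝒞, volume {p : ℂ × ℂ | Sees (C : Set ℂ) p.1 p.2} :=
        (measure_mono hcover).trans (measure_biUnion_le _ hcount _)
    _ ≤ ∑' C : 𝒞, 96 * ENNReal.ofReal κ * volume (C : Set ℂ) :=
        ENNReal.tsum_le_tsum fun C => (hdom C C.2).volume_sees_le
    _ = 96 * ENNReal.ofReal κ * volume (⋃ C ∈ 𝒞, C) := by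
        rw [ENNReal.tsum_mul_left]
        congr 1
        exact (measure_biUnion hcount hdis fun C hC => (hopen C hC).measurableSet).symm
    _ ≤ 96 * ENNReal.ofReal κ * volume V := by
        gcongr
        exact iUnion₂_subset hsub

/-! ### From the filled curve to its interior. -/

theorem cross_add_right (a b c : ℂ) : cross a (b + c) = cross a b + cross a c := by
  simp only [cross, add_re, add_im]; ring

theorem cross_real_mul_right (a b : ℂ) (t : ℝ) : cross a (t * b) = t * cross a b := by
  simp only [cross, re_ofReal_mul, im_ofReal_mul]; ring

theorem cross_neg_left (a b : ℂ) : cross (-a) b = -cross a b := by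
  simp only [cross, neg_re, neg_im]; ring

theorem continuous_cross : Continuous fun p : ℂ × ℂ => cross p.1 p.2 := by
  unfold cross; fun_prop

theorem volume_cross_eq_zero {d : ℂ} (hd : d ≠ 0) (a : ℂ) :
    volume {z : ℂ | cross d (z - a) = 0} = 0 := by
  set ν : ℂ := -(I * (starRingEnd ℂ) d) with hν
  have hν0 : ν ≠ 0 := by simpa [hν] using hd
  have : {z : ℂ | cross d (z - a) = 0} = {z : ℂ | (ν * z).re = (ν * a).re} := by
    ext z
    have : cross d (z - a) = (ν * z).re - (ν * a).re := by
      simp [cross, hν]; ring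
    simp only [mem_ofPred_eq, this, sub_eq_zero]
  rw [this]
  exact volume_vertical_strip hν0 _

theorem volume_cross_pairs_eq_zero (v : ℂ) :
    volume {p : ℂ × ℂ | cross (p.1 - v) (p.2 - v) = 0} = 0 := by
  have hc : Continuous fun p : ℂ × ℂ => cross (p.1 - v) (p.2 - v) :=
    continuous_cross.comp (by fun_prop : Continuous fun p : ℂ × ℂ => (p.1 - v, p.2 - v))
  rw [Measure.volume_eq_prod,
    Measure.measure_prod_null (isClosed_eq hc continuous_const).measurableSet]
  have hv : ∀ᵐ x : ℂ, x ≠ v := by simp [ae_iff]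
  filter_upwards [hv] with x hx
  exact volume_cross_eq_zero (sub_ne_zero.mpr hx) v

/-- Near a boundary point on a line, one visible point on a side of the line puts that side of a
disc into the filled set. -/
theorem half_disc_subset_fillSet {K : Set ℂ} (hK : IsCompact K) {p d A : ℂ} {ε : ℝ} (hε : 0 < ε)
    (hline : ∀ x ∈ Metric.ball p ε, x ∈ K → cross d (x - p) = 0) (hA : 0 < cross d (A - p))
    (hs : segment ℝ p A ⊆ fillSet K) {x : ℂ} (hx : x ∈ Metric.ball p ε)
    (hx0 : 0 ≤ cross d (x - p)) : x ∈ fillSet K := by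
  have hlin : ∀ a b : ℂ, ∀ t : ℝ, cross d (a + t * b - p) = cross d (a - p) + t * cross d b := by
    intro a b t
    rw [← cross_real_mul_right, ← cross_add_right]; ring_nf
  have hcc : Continuous fun y : ℂ => cross d (y - p) :=
    continuous_cross.comp (by fun_prop : Continuous fun y : ℂ => (d, y - p))
  -- The open half disc is convex and misses `K`, so it lies in one component of the complement. It
  -- contains points of the segment `p A`, which are in the filled set; the diameter follows by
  -- closedness.
  set H : Set ℂ := Metric.ball p ε ∩ {y | 0 < cross d (y - p)} with hH
  have hconv : Convex ℝ H := by
    refine (convex_ball p ε).inter ?_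
    intro y hy z hz a b ha hb hab
    have e : cross d (a • y + b • z - p) = a * cross d (y - p) + b * cross d (z - p) := by
      rw [← cross_real_mul_right, ← cross_real_mul_right, ← cross_add_right]
      congr 1
      have : (a : ℂ) + b = 1 := by exact_mod_cast hab
      simp only [real_smul]
      linear_combination (-p) * (-this)
    rw [mem_ofPred_eq, e]
    have hy' : 0 < cross d (y - p) := hy
    have hz' : 0 < cross d (z - p) := hz
    rcases ha.eq_or_lt with h | h
    · have : b = 1 := by linarith
      rw [← h, this]; linarith
    · nlinarith [mul_pos h hy', mul_nonneg hb hz'.le]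
  have hHK : H ⊆ Kᶜ := fun y hy hyK => hy.2.ne' (hline y hy.1 hyK)
  have hnear : ∀ a b : ℂ, a ∈ Metric.ball p ε → ∀ᶠ t : ℝ in 𝓝[>] 0, a + t * b ∈ Metric.ball p ε := by
    intro a b ha
    have hc : Continuous fun t : ℝ => a + t * b := by fun_prop
    exact nhdsWithin_le_nhds (hc.continuousAt.eventually
      (Metric.isOpen_ball.mem_nhds (by simpa using ha)))
  have hpos : ∀ᶠ t : ℝ in 𝓝[>] 0, 0 < t ∧ t < 1 :=
    Ioo_mem_nhdsGT one_pos
  obtain ⟨t, htb, ht0, ht1⟩ := ((hnear p (A - p) (Metric.mem_ball_self hε)).and hpos).exists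
  have hq : p + t * (A - p) ∈ H := by
    refine ⟨htb, ?_⟩
    rw [mem_ofPred_eq, hlin, sub_self]
    have : cross d 0 = 0 := by simp [cross]
    rw [this, zero_add]
    exact mul_pos ht0 hA
  have hqF := hs (mem_segment_of_smul ht0.le ht1.le : p + t * (A - p) ∈ segment ℝ p A)
  have hHF : H ⊆ fillSet K :=
    (hconv.isPreconnected.subset_connectedComponentIn hq hHK).trans
      (connectedComponentIn_subset_fillSet (hHK hq) hqF)
  have hlim : Tendsto (fun t : ℝ => x + t * (A - p)) (𝓝[>] 0) (𝓝 x) := by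
    have hc : Continuous fun t : ℝ => x + t * (A - p) := by fun_prop
    have := hc.tendsto 0
    simp only [ofReal_zero, zero_mul, add_zero] at this
    exact this.mono_left nhdsWithin_le_nhds
  refine (isClosed_fillSet hK).mem_of_tendsto hlim ?_
  filter_upwards [hnear x (A - p) hx, hpos] with s hs1 hs2
  refine hHF ⟨hs1, ?_⟩
  rw [mem_ofPred_eq, hlin]
  have := mul_pos hs2.1 hA
  linarith

theorem mem_interior_fillSet_of_crossing {K : Set ℂ} (hK : IsCompact K) {p d A B : ℂ}
    (hline : ∀ᶠ x in 𝓝 p, x ∈ K → cross d (x - p) = 0) (hA : 0 < cross d (A - p))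
    (hB : cross d (B - p) < 0) (hpA : segment ℝ p A ⊆ fillSet K)
    (hpB : segment ℝ p B ⊆ fillSet K) : p ∈ interior (fillSet K) := by
  obtain ⟨ε, hε, hb⟩ := Metric.eventually_nhds_iff_ball.mp hline
  refine mem_interior.mpr ⟨_, fun x hx => ?_, Metric.isOpen_ball, Metric.mem_ball_self hε⟩
  rcases le_total 0 (cross d (x - p)) with h | h
  · exact half_disc_subset_fillSet hK hε hb hA hpA hx h
  · refine half_disc_subset_fillSet hK (d := -d) hε (fun y hy hyK => ?_) ?_ hpB hx ?_
    · rw [cross_neg_left, hb y hy hyK, neg_zero]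
    · rw [cross_neg_left]; linarith
    · rw [cross_neg_left]; linarith

theorem mem_interior_fillSet_of_not_mem {K : Set ℂ} (hK : IsCompact K) {x : ℂ} (hx : x ∈ fillSet K)
    (hxK : x ∉ K) : x ∈ interior (fillSet K) :=
  mem_interior.mpr ⟨_, connectedComponentIn_subset_fillSet hxK hx,
    hK.isClosed.isOpen_compl.connectedComponentIn, mem_connectedComponentIn hxK⟩

/-- A closed polygonal curve. -/
def closedCurve {n : ℕ} (v : Fin n → ℂ) : Set ℂ := ⋃ i, segment ℝ (v i) (v (finRotate n i))

/-- The edges are nondegenerate and none meets the interior of another one. -/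
structure SimpleEdges {n : ℕ} (v : Fin n → ℂ) : Prop where
  ne : ∀ i, v i ≠ v (finRotate n i)
  unique : ∀ i j p, p ∈ openSegment ℝ (v i) (v (finRotate n i)) →
    p ∈ segment ℝ (v j) (v (finRotate n j)) → j = i

theorem isCompact_closedCurve {n : ℕ} (v : Fin n → ℂ) : IsCompact (closedCurve v) :=
  isCompact_iUnion fun _ => isCompact_segment _ _

theorem SimpleEdges.eventually {n : ℕ} {v : Fin n → ℂ} (h : SimpleEdges v) {i : Fin n} {p : ℂ}
    (hp : p ∈ openSegment ℝ (v i) (v (finRotate n i))) :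
    ∀ᶠ x in 𝓝 p, ∀ j, x ∈ segment ℝ (v j) (v (finRotate n j)) → j = i := by
  rw [eventually_all]
  intro j
  by_cases hj : j = i
  · exact Eventually.of_forall fun _ _ => hj
  · have : ∀ᶠ x in 𝓝 p, x ∉ segment ℝ (v j) (v (finRotate n j)) :=
      (isCompact_segment _ _).isClosed.isOpen_compl.mem_nhds fun hpj => hj (h.unique i j p hp hpj)
    filter_upwards [this] with x hx hx'
    exact absurd hx' hx

theorem cross_eq_zero_of_mem_segment {a b x : ℂ} (h : x ∈ segment ℝ a b) :
    cross (b - a) (x - a) = 0 := by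
  rw [segment_eq_image'] at h
  obtain ⟨t, -, rfl⟩ := h
  rw [add_sub_cancel_left, real_smul, cross_real_mul_right]
  simp only [cross]; ring

/-- Such a segment meets the curve only in relative interiors of edges, and there transversally, so
the filled set contains both half discs at each meeting point. -/
theorem SimpleEdges.sees_interior {n : ℕ} {v : Fin n → ℂ} (h : SimpleEdges v) {A B : ℂ}
    (hs : Sees (fillSet (closedCurve v)) A B)
    (hA : ∀ i, cross (v (finRotate n i) - v i) (A - v i) ≠ 0)
    (hB : ∀ i, cross (v (finRotate n i) - v i) (B - v i) ≠ 0)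
    (hv : ∀ i, v i ∉ segment ℝ A B) : Sees (interior (fillSet (closedCurve v))) A B := by
  intro p hp
  have hK := isCompact_closedCurve v
  by_cases hpK : p ∈ closedCurve v
  swap
  · exact mem_interior_fillSet_of_not_mem hK (hs hp) hpK
  obtain ⟨i, hi⟩ := mem_iUnion.mp hpK
  have hpo : p ∈ openSegment ℝ (v i) (v (finRotate n i)) := by
    refine mem_openSegment_of_ne_left_right ?_ ?_ hi
    · rintro rfl; exact hv i hp
    · rintro rfl; exact hv _ hp
  set d := v (finRotate n i) - v i with hd
  have hp0 : cross d (p - v i) = 0 := cross_eq_zero_of_mem_segment hi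
  have hshift : ∀ x, cross d (x - p) = cross d (x - v i) := by
    intro x
    have : cross d (x - v i) = cross d (x - p) + cross d (p - v i) := by
      rw [← cross_add_right]; ring_nf
    rw [this, hp0, add_zero]
  have hline : ∀ᶠ x in 𝓝 p, x ∈ closedCurve v → cross d (x - p) = 0 := by
    filter_upwards [h.eventually hpo] with x hx hxK
    obtain ⟨j, hj⟩ := mem_iUnion.mp hxK
    obtain rfl := hx j hj
    rw [hshift]
    exact cross_eq_zero_of_mem_segment hj
  have hpA : segment ℝ p A ⊆ fillSet (closedCurve v) := hs.mono_seg hp (left_mem_segment ℝ _ _)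
  have hpB : segment ℝ p B ⊆ fillSet (closedCurve v) := hs.mono_seg hp (right_mem_segment ℝ _ _)
  have hsign : cross d (A - p) * cross d (B - p) < 0 := by
    have hA' := hA i
    have hB' := hB i
    rw [← hd, ← hshift] at hA' hB'
    obtain ⟨α, β, hα, hβ, hαβ, hpe⟩ := hp
    have hsum : α * cross d (A - p) + β * cross d (B - p) = 0 := by
      rw [← cross_real_mul_right, ← cross_real_mul_right, ← cross_add_right]
      have h1 : (α : ℂ) + β = 1 := by exact_mod_cast hαβ
      have : (α : ℂ) * (A - p) + β * (B - p) = 0 := by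
        rw [real_smul, real_smul] at hpe
        linear_combination hpe - p * h1
      rw [this]; simp [cross]
    have hβ0 : 0 < β := by
      refine hβ.lt_of_ne fun h0 => hA' ?_
      have : α = 1 := by linarith
      rw [← h0, this] at hsum; linarith
    have hα0 : 0 < α := by
      refine hα.lt_of_ne fun h0 => hB' ?_
      have : β = 1 := by linarith
      rw [← h0, this] at hsum; linarith
    have h2 : β * (cross d (A - p) * cross d (B - p)) = -(α * cross d (A - p) ^ 2) := by
      linear_combination cross d (A - p) * hsum
    have h3 : 0 < α * cross d (A - p) ^ 2 := by positivity
    by_contra hn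
    have := mul_nonneg hβ (not_lt.mp hn)
    linarith
  rcases mul_neg_iff.mp hsign with ⟨h1, h2⟩ | ⟨h1, h2⟩
  · exact mem_interior_fillSet_of_crossing hK hline h1 h2 hpA hpB
  · exact mem_interior_fillSet_of_crossing hK hline h2 h1 hpB hpA

/-- The exceptional pairs have a point on the line of an edge or are collinear with a vertex; they
form a null set. -/
theorem SimpleEdges.volume_sees_le {n : ℕ} {v : Fin n → ℂ} (h : SimpleEdges v) :
    volume {p : ℂ × ℂ | Sees (fillSet (closedCurve v)) p.1 p.2} ≤
      volume {p : ℂ × ℂ | Sees (interior (fillSet (closedCurve v))) p.1 p.2} := by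
  set d : Fin n → ℂ := fun i => v (finRotate n i) - v i with hd
  have hd0 : ∀ i, d i ≠ 0 := fun i => sub_ne_zero.mpr (h.ne i).symm
  set E₁ : Set (ℂ × ℂ) := ⋃ i, Prod.fst ⁻¹' {z | cross (d i) (z - v i) = 0} with hE₁
  set E₂ : Set (ℂ × ℂ) := ⋃ i, Prod.snd ⁻¹' {z | cross (d i) (z - v i) = 0} with hE₂
  set E₃ : Set (ℂ × ℂ) := ⋃ i, {p : ℂ × ℂ | cross (p.1 - v i) (p.2 - v i) = 0} with hE₃
  have n1 : volume E₁ = 0 := measure_iUnion_null fun i => by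
    rw [Measure.volume_eq_prod]
    exact Measure.quasiMeasurePreserving_fst.preimage_null (volume_cross_eq_zero (hd0 i) _)
  have n2 : volume E₂ = 0 := measure_iUnion_null fun i => by
    rw [Measure.volume_eq_prod]
    exact Measure.quasiMeasurePreserving_snd.preimage_null (volume_cross_eq_zero (hd0 i) _)
  have n3 : volume E₃ = 0 := measure_iUnion_null fun i => volume_cross_pairs_eq_zero (v i)
  have hsub : {p : ℂ × ℂ | Sees (fillSet (closedCurve v)) p.1 p.2} ⊆
      {p : ℂ × ℂ | Sees (interior (fillSet (closedCurve v))) p.1 p.2} ∪ (E₁ ∪ E₂ ∪ E₃) := by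
    rintro p hp
    by_cases hE : p ∈ E₁ ∪ E₂ ∪ E₃
    · exact Or.inr hE
    · left
      simp only [mem_union, not_or, hE₁, hE₂, hE₃, mem_iUnion, not_exists, mem_preimage,
        mem_ofPred_eq] at hE
      obtain ⟨⟨e1, e2⟩, e3⟩ := hE
      refine h.sees_interior hp e1 e2 fun i hi => e3 i ?_
      obtain ⟨α, β, -, -, hαβ, hvi⟩ := hi
      have h1 : (α : ℂ) = 1 - β := by
        rw [eq_sub_iff_add_eq]; exact_mod_cast hαβ
      rw [real_smul, real_smul] at hvi
      have f1 : p.1 - v i = (-β : ℝ) * (p.2 - p.1) := by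
        push_cast
        linear_combination hvi - p.1 * h1
      have f2 : p.2 - v i = (α : ℝ) * (p.2 - p.1) := by
        linear_combination hvi - p.2 * h1
      rw [f1, f2]
      simp only [cross, re_ofReal_mul, im_ofReal_mul]; ring
  refine (measure_mono hsub).trans ((measure_union_le _ _).trans ?_)
  rw [measure_union_null (measure_union_null n1 n2) n3, add_zero]

theorem sum_log_edges {n : ℕ} {v : Fin n → ℂ} {z : ℂ} (hz : HasLog z (closedCurve v)) :
    ∑ i, log ((v (finRotate n i) - z) / (v i - z)) = 0 := by
  obtain ⟨f, hf, he⟩ := hz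
  have : ∀ i, log ((v (finRotate n i) - z) / (v i - z)) = f (v (finRotate n i)) - f (v i) :=
    fun i => (log_edge hf he (subset_iUnion (fun i => segment ℝ (v i) (v (finRotate n i))) i)).symm
  simp only [this, Finset.sum_sub_distrib]
  rw [Equiv.sum_comp (finRotate n) (fun i => f (v i)), sub_self]

/-- The curve does not fill to itself: the sum of the logarithms jumps across an edge. -/
theorem SimpleEdges.interior_nonempty {n : ℕ} {v : Fin n → ℂ} (h : SimpleEdges v) (i₀ : Fin n) :
    (interior (fillSet (closedCurve v))).Nonempty := by
  classical
  by_contra hempty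
  rw [not_nonempty_iff_eq_empty] at hempty
  have hK := isCompact_closedCurve v
  -- With empty interior there are no bounded complementary components, so logarithms on the curve
  -- exist about every point off it, and `sum_log_edges` applies to all these points.
  have hfill : ∀ z, z ∉ closedCurve v → z ∉ fillSet (closedCurve v) := by
    intro z hz hzF
    have := mem_interior_fillSet_of_not_mem hK hzF hz
    rw [hempty] at this
    exact this
  set a := v i₀ with ha
  set b := v (finRotate n i₀) with hb
  set d := (b - a) / 2 with hd
  set p := (a + b) / 2 with hp
  have hd0 : d ≠ 0 := div_ne_zero (sub_ne_zero.mpr (h.ne i₀).symm) two_ne_zero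
  have hpo : p ∈ openSegment ℝ a b := by
    refine ⟨1 / 2, 1 / 2, by norm_num, by norm_num, by norm_num, ?_⟩
    rw [hp, real_smul, real_smul]; push_cast; ring
  -- The point `z ε` crosses the edge `i₀` at its midpoint in the normal direction. The ratio of
  -- that edge crosses the cut of the logarithm at `-1`, while the other terms are continuous; a
  -- constant zero sum cannot absorb the jump of `2πi`.
  set z : ℝ → ℂ := fun ε => p + ε * (I * d) with hzdef
  have hzc : Continuous z := by fun_prop
  have hz0 : z 0 = p := by simp [hzdef]
  set G : ℝ → ℂ := fun ε => ∑ i ∈ Finset.univ.erase i₀,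
    log ((v (finRotate n i) - z ε) / (v i - z ε)) with hG
  set g : ℝ → ℂ := fun ε => (b - z ε) / (a - z ε) with hg
  have hgform : ∀ ε : ℝ, g ε = ((ε ^ 2 - 1) / (1 + ε ^ 2) : ℝ) + (2 * ε / (1 + ε ^ 2) : ℝ) * I := by
    intro ε
    have e1 : b - z ε = d * (1 - ε * I) := by rw [hzdef, hp, hd]; ring
    have e2 : a - z ε = -d * (1 + ε * I) := by rw [hzdef, hp, hd]; ring
    have hn1 : (1 : ℂ) + ε * I ≠ 0 := fun h0 => by simpa using congrArg re h0
    have hn2 : (1 : ℂ) + (ε : ℂ) ^ 2 ≠ 0 := by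
      have : (0 : ℝ) < 1 + ε ^ 2 := by positivity
      exact_mod_cast this.ne'
    change (b - z ε) / (a - z ε) = _
    rw [e1, e2, div_eq_iff (mul_ne_zero (neg_ne_zero.mpr hd0) hn1)]
    push_cast
    field_simp
    linear_combination (-2 * ε ^ 2 : ℂ) * I_sq * (-1)
  have hgim : ∀ ε, (g ε).im = 2 * ε / (1 + ε ^ 2) := fun ε => by
    rw [hgform, add_im, ofReal_im, im_ofReal_mul, I_im]; ring
  have hgre : ∀ ε, (g ε).re = (ε ^ 2 - 1) / (1 + ε ^ 2) := fun ε => by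
    rw [hgform, add_re, ofReal_re, re_ofReal_mul, I_re]; ring
  have hg0 : g 0 = -1 := by
    apply Complex.ext
    · rw [hgre]; norm_num
    · rw [hgim]; norm_num
  have hgc : ContinuousAt g 0 := by
    refine ContinuousAt.div (by fun_prop) (by fun_prop) ?_
    rw [hz0, hp]
    intro h0
    apply hd0
    rw [hd]; linear_combination -h0
  have hGc : ContinuousAt G 0 := by
    refine tendsto_finsetSum _ fun i hi => ?_
    have hpi : z 0 ∉ segment ℝ (v i) (v (finRotate n i)) := fun hmem =>
      (Finset.ne_of_mem_erase hi) (h.unique i₀ i _ (by rw [hz0]; exact hpo) hmem)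
    refine ContinuousAt.clog (ContinuousAt.div (by fun_prop) (by fun_prop) ?_)
      (div_mem_slitPlane hpi)
    intro h0
    exact hpi (by rw [← sub_eq_zero.mp h0]; exact left_mem_segment ℝ _ _)
  have hoff : ∀ᶠ ε : ℝ in 𝓝 0, ε ≠ 0 → log (g ε) = -G ε := by
    have hev : ∀ᶠ ε : ℝ in 𝓝 0, ∀ j, z ε ∈ segment ℝ (v j) (v (finRotate n j)) → j = i₀ :=
      hzc.continuousAt.eventually (by rw [hz0]; exact h.eventually hpo)
    filter_upwards [hev] with ε hε hε0
    have hzK : z ε ∉ closedCurve v := by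
      intro hmem
      obtain ⟨j, hj⟩ := mem_iUnion.mp hmem
      obtain rfl := hε j hj
      have hcr := cross_eq_zero_of_mem_segment hj
      rw [← ha, ← hb] at hcr
      have e1 : b - a = 2 * d := by rw [hd]; ring
      have e2 : z ε - a = d * (1 + ε * I) := by rw [hzdef, hp, hd]; ring
      rw [e1, e2] at hcr
      have : cross (2 * d) (d * (1 + ε * I)) = 2 * ε * normSq d := by
        simp [cross, normSq_apply]; ring
      rw [this] at hcr
      have hN := normSq_pos.mpr hd0
      exact absurd hcr (mul_ne_zero (mul_ne_zero two_ne_zero hε0) hN.ne')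
    have hsum := sum_log_edges ((hasLog_fillSet hK (hfill _ hzK)).mono (subset_fillSet _))
    rw [← Finset.add_sum_erase _ _ (Finset.mem_univ i₀)] at hsum
    exact eq_neg_of_add_eq_zero_left hsum
  have hre : ((-1 : ℂ)).re < 0 := by norm_num
  have him : ((-1 : ℂ)).im = 0 := by norm_num
  have hgt : Tendsto g (𝓝 0) (𝓝 (-1)) := by rw [← hg0]; exact hgc
  have up : Tendsto (fun ε => log (g ε)) (𝓝[>] 0) (𝓝 (Real.log ‖(-1 : ℂ)‖ + Real.pi * I)) := by
    refine (tendsto_log_nhdsWithin_im_nonneg_of_re_neg_of_im_zero hre him).comp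
      (tendsto_nhdsWithin_iff.mpr ⟨hgt.mono_left nhdsWithin_le_nhds, ?_⟩)
    filter_upwards [self_mem_nhdsWithin] with ε hε
    have hε' : 0 < ε := hε
    change 0 ≤ (g ε).im
    rw [hgim]
    positivity
  have down : Tendsto (fun ε => log (g ε)) (𝓝[<] 0) (𝓝 (Real.log ‖(-1 : ℂ)‖ - Real.pi * I)) := by
    refine (tendsto_log_nhdsWithin_im_neg_of_re_neg_of_im_zero hre him).comp
      (tendsto_nhdsWithin_iff.mpr ⟨hgt.mono_left nhdsWithin_le_nhds, ?_⟩)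
    filter_upwards [self_mem_nhdsWithin] with ε hε
    have hε' : ε < 0 := hε
    change (g ε).im < 0
    rw [hgim]
    exact div_neg_of_neg_of_pos (by linarith) (by positivity)
  have hGn : Tendsto (fun ε => -G ε) (𝓝 0) (𝓝 (-G 0)) := hGc.neg
  have up' := tendsto_nhds_unique up ((hGn.mono_left nhdsWithin_le_nhds).congr' (by
    filter_upwards [nhdsWithin_le_nhds hoff, self_mem_nhdsWithin] with ε h1 h2
    exact (h1 (ne_of_gt h2)).symm))
  have down' := tendsto_nhds_unique down ((hGn.mono_left nhdsWithin_le_nhds).congr' (by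
    filter_upwards [nhdsWithin_le_nhds hoff, self_mem_nhdsWithin] with ε h1 h2
    exact (h1 (ne_of_lt h2)).symm))
  have := congrArg im (up'.trans down'.symm)
  simp at this
  linarith [Real.pi_pos]

/-! ### Transfer to polygons and conclusion. -/

theorem Polygon.IsSimple.edge_unique {n : ℕ} {P : Polygon (EuclideanSpace ℝ (Fin 2)) n}
    (hP : P.IsSimple) {i j : Fin n} {p : EuclideanSpace ℝ (Fin 2)}
    (hi : p ∈ openSegment ℝ (P i) (P (finRotate n i)))
    (hj : p ∈ segment ℝ (P j) (P (finRotate n j))) : j = i := by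
  rw [openSegment_eq_image_lineMap] at hi
  rw [segment_eq_image_lineMap] at hj
  obtain ⟨t, ht, rfl⟩ := hi
  obtain ⟨s, hs, hst⟩ := hj
  -- The parametrization omits the end of each edge; that point is the parameter `0` of the next
  -- edge, while `t` is positive.
  rcases hs.2.eq_or_lt with h1 | h1
  · rw [h1, AffineMap.lineMap_apply_one] at hst
    have := hP.2 (a₁ := (finRotate n j, ⟨0, by norm_num⟩)) (a₂ := (i, ⟨t, ht.1.le, ht.2⟩))
      (by simpa [Polygon.edgePath] using hst)
    exact absurd (congrArg (fun q => (q.2 : ℝ)) this) ht.1.ne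
  · have := hP.2 (a₁ := (j, ⟨s, hs.1, h1⟩)) (a₂ := (i, ⟨t, ht.1.le, ht.2⟩)) hst
    exact congrArg Prod.fst this

theorem Polygon.IsSimple.vertex_ne {n : ℕ} {P : Polygon (EuclideanSpace ℝ (Fin 2)) n}
    (hP : P.IsSimple) (i : Fin n) : P i ≠ P (finRotate n i) := by
  intro h
  have := hP.2 (a₁ := (i, ⟨0, by norm_num⟩)) (a₂ := (finRotate n i, ⟨0, by norm_num⟩))
    (by simpa [Polygon.edgePath] using h)
  obtain ⟨m, rfl⟩ : ∃ m, n = m + 2 := ⟨n - 2, by have := hP.1; omega⟩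
  have h1 : i = i + 1 := by simpa using congrArg Prod.fst this
  simp at h1

theorem LinearIsometryEquiv.preimage_segment {E : Type*} [NormedAddCommGroup E] [NormedSpace ℝ E]
    (e : E ≃ₗᵢ[ℝ] ℂ) (a b : E) : e ⁻¹' segment ℝ (e a) (e b) = segment ℝ a b := by
  have := image_segment ℝ (e : E ≃ₗ[ℝ] ℂ).toLinearMap.toAffineMap a b
  have h : segment ℝ (e a) (e b) = e '' segment ℝ a b := this.symm
  rw [h, preimage_image_eq _ e.injective]

theorem Polygon.IsSimple.simpleEdges {n : ℕ} {P : Polygon (EuclideanSpace ℝ (Fin 2)) n}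
    (hP : P.IsSimple) (e : EuclideanSpace ℝ (Fin 2) ≃ₗᵢ[ℝ] ℂ) :
    SimpleEdges fun i => e (P i) := by
  refine ⟨fun i h => hP.vertex_ne i (e.injective h), fun i j p hi hj => ?_⟩
  have := image_openSegment ℝ
    (e : EuclideanSpace ℝ (Fin 2) ≃ₗ[ℝ] ℂ).toLinearMap.toAffineMap (P i) (P (finRotate n i))
  have h : openSegment ℝ (e (P i)) (e (P (finRotate n i)))
      = e '' openSegment ℝ (P i) (P (finRotate n i)) := this.symm
  rw [h] at hi
  obtain ⟨q, hq, rfl⟩ := hi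
  refine hP.edge_unique hq ?_
  rw [← e.preimage_segment]
  exact hj

theorem Polygon.boundary_eq_preimage {n : ℕ} (P : Polygon (EuclideanSpace ℝ (Fin 2)) n)
    (e : EuclideanSpace ℝ (Fin 2) ≃ₗᵢ[ℝ] ℂ) :
    P.boundary ℝ = e ⁻¹' closedCurve fun i => e (P i) := by
  unfold closedCurve Polygon.boundary Polygon.edgeSet
  rw [preimage_iUnion]
  refine iUnion_congr fun i => ?_
  rw [affineSegment_eq_segment, e.preimage_segment]

theorem Polygon.region_eq_preimage {n : ℕ} (P : Polygon (EuclideanSpace ℝ (Fin 2)) n)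
    (e : EuclideanSpace ℝ (Fin 2) ≃ₗᵢ[ℝ] ℂ) :
    P.region = e ⁻¹' fillSet (closedCurve fun i => e (P i)) := by
  set K := closedCurve fun i => e (P i) with hK
  have hb := P.boundary_eq_preimage e
  rw [← hK] at hb
  ext x
  have hmem : x ∈ P.boundary ℝ ↔ e x ∈ K := by rw [hb]; rfl
  simp only [Polygon.region, fillSet, mem_union, mem_ofPred_eq, mem_preimage, hmem]
  refine or_congr_right (and_congr_right fun hx => ?_)
  have hx' : x ∈ (P.boundary ℝ)ᶜ := fun h => hx (hmem.mp h)
  have himg : e '' (P.boundary ℝ)ᶜ = Kᶜ := by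
    rw [hb, ← preimage_compl, image_preimage_eq _ e.surjective]
  have hcomp := e.toHomeomorph.image_connectedComponentIn hx'
  have hcomp' : e '' connectedComponentIn (P.boundary ℝ)ᶜ x = connectedComponentIn Kᶜ (e x) := by
    rw [← himg]; exact hcomp
  rw [← hcomp']
  refine ⟨fun h => e.isometry.lipschitz.isBounded_image h, fun h => ?_⟩
  have := e.isometry.antilipschitz.isBounded_preimage h
  rwa [preimage_image_eq _ e.injective] at this

theorem isClosed_sees {F : Set ℂ} (hF : IsClosed F) : IsClosed {p : ℂ × ℂ | Sees F p.1 p.2} := by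
  have : {p : ℂ × ℂ | Sees F p.1 p.2} = ⋂ s ∈ Icc (0 : ℝ) 1, (fun p => pairPoint p s) ⁻¹' F := by
    ext p
    simp only [mem_iInter, mem_preimage]
    refine ⟨fun h s hs => h (pairPoint_mem hs), fun h x hx => ?_⟩
    rw [segment_eq_image'] at hx
    obtain ⟨s, hs, rfl⟩ := hx
    simpa [pairPoint] using h s hs
  rw [this]
  exact isClosed_biInter fun s _ => hF.preimage (by unfold pairPoint; fun_prop)

theorem segSet_preimage (e : EuclideanSpace ℝ (Fin 2) ≃ₗᵢ[ℝ] ℂ) (F : Set ℂ) :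
    segSet (e ⁻¹' F) = Prod.map e e ⁻¹' {p : ℂ × ℂ | Sees F p.1 p.2} := by
  ext p
  have h : segment ℝ p.1 p.2 ⊆ e ⁻¹' F ↔ Sees F (e p.1) (e p.2) := by
    rw [← e.preimage_segment, preimage_subset_preimage_iff (by simp [e.surjective.range_eq])]
    rfl
  change _ ∧ _ ∧ _ ↔ Sees F (e p.1) (e p.2)
  rw [h]
  exact ⟨fun hp => hp.2.2, fun hp => ⟨hp.left_mem, hp.right_mem, hp⟩⟩

theorem mainTheorem4 {n : ℕ} (P : Polygon (EuclideanSpace ℝ (Fin 2)) n) (hP : P.IsSimple) :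
    BeerIndexDefined P.region ∧ beerIndex P.region ≤ 180 * convexityRatio P.region := by
  set e : EuclideanSpace ℝ (Fin 2) ≃ₗᵢ[ℝ] ℂ := Complex.orthonormalBasisOneI.repr.symm
  set v : Fin n → ℂ := fun i => e (P i)
  have hv : SimpleEdges v := hP.simpleEdges e
  set F := fillSet (closedCurve v) with hF
  have hR : P.region = e ⁻¹' F := P.region_eq_preimage e
  have hK := isCompact_closedCurve v
  have hFc : IsClosed F := isClosed_fillSet hK
  have he : MeasurePreserving e := e.measurePreserving
  have hemb : MeasurableEmbedding e := e.toHomeomorph.measurableEmbedding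
  have hvol : ∀ s : Set ℂ, volume (e ⁻¹' s) = volume s := he.measure_preimage_emb hemb
  have hee : MeasurePreserving (Prod.map e e) := he.prod he
  have hseg := segSet_preimage e F
  rw [← hR] at hseg
  have hsegF : volume (segSet P.region) = volume {p : ℂ × ℂ | Sees F p.1 p.2} := by
    rw [hseg, hee.measure_preimage (isClosed_sees hFc).measurableSet.nullMeasurableSet]
  have hRF : volume P.region = volume F := by rw [hR, hvol]
  have hpos : 0 < volume P.region := by
    rw [hRF]
    exact (isOpen_interior.measure_pos _
      (hv.interior_nonempty ⟨0, by have := hP.1; omega⟩)).trans_le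
      (measure_mono interior_subset)
  have hfin : volume P.region < ⊤ := by
    rw [hRF]
    exact (isBounded_fillSet hK).measure_lt_top
  refine ⟨⟨?_, hpos, hfin, ?_⟩, ?_⟩
  · rw [hR]
    exact (hFc.measurableSet.preimage he.measurable).nullMeasurableSet
  · rw [hseg]
    exact ((isClosed_sees hFc).measurableSet.preimage hee.measurable).nullMeasurableSet
  · set M := supConvexMeasure P.region with hM
    have hMtop : M ≠ ⊤ := by
      refine ne_top_of_le_ne_top hfin.ne (sSup_le ?_)
      rintro _ ⟨C, hC, -, rfl⟩
      exact measure_mono hC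
    -- The supremum over convex subsets of the whole region serves as `κ` for the interior.
    have hconv : ∀ C ⊆ interior F, Convex ℝ C → volume C ≤ ENNReal.ofReal M.toReal := by
      intro C hC hCc
      rw [ENNReal.ofReal_toReal hMtop, ← hvol C]
      refine le_sSup ⟨e ⁻¹' C, ?_, ?_, rfl⟩
      · rw [hR]; exact preimage_mono (hC.trans interior_subset)
      · exact hCc.linear_preimage (e : EuclideanSpace ℝ (Fin 2) ≃ₗ[ℝ] ℂ).toLinearMap
    have hmain := hv.volume_sees_le.trans (volume_sees_open_le isOpen_interior
      ((isBounded_fillSet hK).subset interior_subset) (logConnected_interior_fillSet hK)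
      ENNReal.toReal_nonneg hconv)
    rw [← hF, ← hsegF, ENNReal.ofReal_toReal hMtop] at hmain
    unfold beerIndex convexityRatio
    rw [ENNReal.div_le_iff (pow_ne_zero 2 hpos.ne') (ENNReal.pow_ne_top hfin.ne)]
    calc volume (segSet P.region) ≤ 96 * M * volume P.region :=
          hmain.trans (by rw [hRF]; gcongr; exact interior_subset)
      _ ≤ 180 * M * volume P.region := by gcongr; norm_num
      _ = 180 * (M / volume P.region) * volume P.region ^ 2 := by
          rw [sq, mul_assoc 180 (M / _), ← mul_assoc (M / _), ENNReal.div_mul_cancel hpos.ne' hfin.ne,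
            mul_assoc]
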